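/- Let $h\ge 0$ be measurable on $[0,\infty)$ with $\int_0^\infty h<1$. Let $f$ be a probability density on $(0,\infty)$ with finite mean $m^{-1}=\int_0^\infty t f(t)\,dt$, distribution function $F$ and renewal density $\varphi=\sum_{n\ge1}f^{*n}$. Let $\hat N_R=\sum_{n\ge 0}\delta_{\hat S_n}$, $\hat S_n=\hat S_0+\tau_1+\cdots+\tau_n$, be the delayed renewal process on $[0,\infty)$ whose delay $\hat S_0$ has density $m(1-F)$ and whose waiting times $\tau_i$ have density $f$, all independent. For $t_0\ge0$ let $N_c(\cdot\mid t_0)=\sum_{n\ge0}N_c^{(n)}(\cdot\mid t_0)$ be the cluster of an immigrant at $t_0$: $N_c^{(0)}(\cdot\mid t_0)=\delta_{t_0}$ and $N_c^{(n+1)}(\cdot\mid t_0)=\sum_{x\in N_c^{(n)}(\cdot\mid t_0)}N_s^{(n+1)}(\cdot\mid x)$, where each individual at $x$ has its own independent Poisson process $N_s(\cdot\mid x)$ of offspring, with intensity $h(y-x)\,dy$ on $[x,\infty)$. The stationary renewal Hawkes process (this is its name; it is a process on $[0,\infty)$ without immigrants before time $0$) is $\hat N=\sum_{t_0\in\hat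 N_R}N_c(\cdot\mid t_0)$, where the clusters are independent of each other and of $\hat N_R$. Let $\Xi$ be the class of measurable $z:\mathbb R\to[0,1]$ such that $1-z$ vanishes outside a bounded set. The p.g.fl. of a point process $N$ is $\mathbb E\big[\prod_{x\in N}z(x)\big]$, $z\in\Xi$; write $\hat G$, $\hat G_R$ and $G_c[\,\cdot\mid t]$ for those of $\hat N$, $\hat N_R$ and $N_c(\cdot\mid t)$. Then: 1. The centre process $\hat N_R$ is stationary: for every $s\ge0$, the process of the points $\hat S_n-s$ with $\hat S_n\ge s$ has the law of $\hat N_R$. Almost surely, $\hat N(B)<\infty$ for every bounded $B$. 2. For every $z\in\Xi$, $$\hat G[z]=\hat G_R\big[G_c[z\mid\cdot\,]\big]=1+\sum_{k=1}^\infty m\int_{0<t_1<\cdots<t_k}\ \prod_{i=1}^k\big(G_c[z\mid t_i]-1\big)\,dt_1\,\varphi(t_2-t_1)\,dt_2\cdots\varphi(t_k-t_{k-1})\,dt_k ,$$ where all the integrals and the series converge absolutely. 3. Poisson case: if $f(t)=\mu e^{-\mu t}$ for almost every $t>0$, with $\mu>0$ constant, then $m=\mu$, $\varphi=\mu$ almost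 everywhere on $(0,\infty)$ and, for every $z\in\Xi$, the formula reduces to the Hawkes–Oakes formula $$\hat G[z]=\exp\Big\{\int_0^\infty\mu\,\big(G_c[z(s+\cdot)\mid 0]-1\big)\,ds\Big\},$$ with an absolutely convergent integral. -/

import Mathlib

open MeasureTheory ProbabilityTheory Set
open scoped ENNReal

noncomputable section

namespace RenewalHawkes

/-! ### Probability generating functionals -/

/-- The class `Ξ`: measurable `z : ℝ → [0,1]` such that `1 - z` vanishes outside a bounded set. -/
def Xi : Set (ℝ → ℝ) :=
  {z | Measurable z ∧ (∀ t, z t ∈ Icc (0 : ℝ) 1) ∧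
    ∃ B : Set ℝ, Bornology.IsBounded B ∧ ∀ t, t ∉ B → z t = 1}

/-- `-log u ∈ [0,∞]` for `u ∈ [0,1]`, with `-log 0 = ∞`. -/
def negLog (u : ℝ) : ℝ≥0∞ := if u ≤ 0 then ⊤ else ENNReal.ofReal (-Real.log u)

/-- `exp (-a)` for `a ∈ [0,∞]`, with `exp (-∞) = 0`. -/
def expNeg (a : ℝ≥0∞) : ℝ := if a = ⊤ then 0 else Real.exp (-a.toReal)

/-- The probability generating functional `G[z] = 𝔼[exp (∫ log z dN)] = 𝔼[∏_{x ∈ N} z(x)]` of a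
random counting measure `N`; here `∫ log z dN ∈ [-∞,0]`. -/
def pgfl {Ω : Type*} [MeasurableSpace Ω] (P : Measure Ω) (N : Ω → Measure ℝ) (z : ℝ → ℝ) : ℝ :=
  ∫ ω, expNeg (∫⁻ x, negLog (z x) ∂(N ω)) ∂P

/-! ### The waiting time distribution -/

/-- Assumption (A): `h ≥ 0` is measurable on `[0,∞)` with `∫₀^∞ h < 1`. -/
structure IsOffspringDensity (h : ℝ → ℝ) : Prop where
  measurable : Measurable h
  nonneg : ∀ t, 0 ≤ t → 0 ≤ h t
  integrable : IntegrableOn h (Ioi 0)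
  integral_lt_one : ∫ t in Ioi (0 : ℝ), h t < 1

/-- Assumption (B): `f` is a probability density on `(0,∞)` with finite mean. -/
structure IsWaitingDensity (f : ℝ → ℝ) : Prop where
  measurable : Measurable f
  nonneg : ∀ t, 0 ≤ t → 0 ≤ f t
  integral_eq_one : ∫ t in Ioi (0 : ℝ), f t = 1
  mean_finite : IntegrableOn (fun t => t * f t) (Ioi 0)

/-- `F(t) = ∫₀ᵗ f(s) ds`. -/
def cdfOf (f : ℝ → ℝ) (t : ℝ) : ℝ := ∫ s in (0 : ℝ)..t, f s

/-- `m`, the reciprocal of the mean waiting time. -/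
def rate (f : ℝ → ℝ) : ℝ := (∫ t in Ioi (0 : ℝ), t * f t)⁻¹

/-- `convPow f n` is the convolution power `f^{*(n+1)}` on `(0,∞)`, where
`(g * f)(t) = ∫₀ᵗ g(t-s) f(s) ds`. -/
def convPow (f : ℝ → ℝ) : ℕ → ℝ → ℝ≥0∞
  | 0 => fun t => ENNReal.ofReal (f t)
  | n + 1 => fun t => ∫⁻ s in Ioo 0 t, convPow f n (t - s) * ENNReal.ofReal (f s)

/-- The renewal density `φ = ∑_{n ≥ 1} f^{*n}`. -/
def renewalDensity (f : ℝ → ℝ) (t : ℝ) : ℝ≥0∞ := ∑' n, convPow f n t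

/-! ### The clusters

The individuals of one cluster are labelled by finite words: the immigrant is `[]`, and `j :: u` is
the `j`-th child of the individual `u`. The data `d u = (K, X)` of an individual `u` say that `u` has
`K` children, born at the delays `X 0, …, X (K - 1)` after its own time. -/

/-- The satellite process `N_s(· | x)` of one individual living at time `x` with data `a`. -/
def satellite (a : ℕ × (ℕ → ℝ)) (x : ℝ) : Measure ℝ :=
  ∑ j ∈ Finset.range a.1, Measure.dirac (x + a.2 j)

/-- The individual labelled by the word exists. -/
def Alive (d : List ℕ → ℕ × (ℕ → ℝ)) : List ℕ → Prop
  | [] => True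
  | j :: u => Alive d u ∧ j < (d u).1

/-- The time of the individual labelled by the word, in the cluster of an immigrant at `t₀`. -/
def time (d : List ℕ → ℕ × (ℕ → ℝ)) (t₀ : ℝ) : List ℕ → ℝ
  | [] => t₀
  | j :: u => time d t₀ u + (d u).2 j

open Classical in
/-- The generations: `N_c^{(0)}(· | t₀) = δ_{t₀}` and
`N_c^{(n+1)}(· | t₀) = ∑_{x ∈ N_c^{(n)}(· | t₀)} N_s^{(n+1)}(· | x)`, the sum being over the
individuals `u` of generation `n`. -/
def generation (d : List ℕ → ℕ × (ℕ → ℝ)) (t₀ : ℝ) : ℕ → Measure ℝ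
  | 0 => Measure.dirac t₀
  | n + 1 => Measure.sum fun u : List ℕ =>
      if u.length = n ∧ Alive d u then satellite (d u) (time d t₀ u) else 0

/-- The cluster `N_c(· | t₀) = ∑_{n ≥ 0} N_c^{(n)}(· | t₀)` of an immigrant at `t₀`. -/
def cluster (d : List ℕ → ℕ × (ℕ → ℝ)) (t₀ : ℝ) : Measure ℝ :=
  Measure.sum (generation d t₀)

/-! ### The process

`T 0` is the delay, `T 1, T 2, …` are the waiting times, and `D (i, u)` are the data of the
individual `u` in the cluster of the `i`-th immigrant. -/

section process

variable {Ω : Type*} [MeasurableSpace Ω]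

/-- The epochs `Ŝ_n = T_0 + T_1 + ⋯ + T_n` of the delayed renewal process. -/
def epoch (T : ℕ → Ω → ℝ) (n : ℕ) (ω : Ω) : ℝ := ∑ k ∈ Finset.range (n + 1), T k ω

/-- The delayed renewal process `N̂_R = ∑_n δ_{Ŝ_n}`. -/
def centre (T : ℕ → Ω → ℝ) (ω : Ω) : Measure ℝ :=
  Measure.sum fun n => Measure.dirac (epoch T n ω)

/-- The cluster process `N̂ = ∑_{t₀ ∈ N̂_R} N_c(· | t₀)`. -/
def process (T : ℕ → Ω → ℝ) (D : ℕ × List ℕ → Ω → ℕ × (ℕ → ℝ)) (ω : Ω) : Measure ℝ :=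
  Measure.sum fun i => cluster (fun u => D (i, u) ω) (epoch T i ω)

/-- `G_c[z | t]`, the p.g.fl. of a cluster with centre `t`; the clusters are identically distributed
up to translation, and the data of the first one are used. -/
def clusterPgfl (P : Measure Ω) (D : ℕ × List ℕ → Ω → ℕ × (ℕ → ℝ)) (z : ℝ → ℝ) (t : ℝ) : ℝ :=
  pgfl P (fun ω => cluster (fun u => D (0, u) ω) t) z

/-- The random input of the stationary renewal Hawkes process: a delay with density `m (1 - F)` and
waiting times with density `f`, all independent; an independent family of satellite processes,
each of which is Poisson with intensity `h(x) dx` on `[0,∞)`, that is, has p.g.fl.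
`exp (∫₀^∞ (z(x) - 1) h(x) dx)` when its parent is at time `0`; and the waiting times are
independent of the satellite processes. -/
structure IsInput (P : Measure Ω) (f h : ℝ → ℝ) (T : ℕ → Ω → ℝ)
    (D : ℕ × List ℕ → Ω → ℕ × (ℕ → ℝ)) : Prop where
  measurable_wait : ∀ n, Measurable (T n)
  measurable_data : ∀ p, Measurable (D p)
  law_delay : P.map (T 0) =
    (volume.restrict (Ioi 0)).withDensity fun t => ENNReal.ofReal (rate f * (1 - cdfOf f t))
  law_wait : ∀ n, P.map (T (n + 1)) =
    (volume.restrict (Ioi 0)).withDensity fun t => ENNReal.ofReal (f t)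
  poisson : ∀ p, ∀ z ∈ Xi, pgfl P (fun ω => satellite (D p ω) 0) z =
    Real.exp (∫ x in Ioi (0 : ℝ), (z x - 1) * h x)
  indep_wait : iIndepFun T P
  indep_data : iIndepFun D P
  indep : IndepFun (fun ω n => T n ω) (fun ω p => D p ω) P

end process

/-- The domain `0 < t_1 < ⋯ < t_k`, with `k = n + 1` and coordinates numbered from `0`. -/
def chamber (n : ℕ) : Set (Fin (n + 1) → ℝ) := {t | 0 < t 0 ∧ StrictMono t}

/-- `(G(t_1) - 1) ⋯ (G(t_k) - 1) φ(t_2 - t_1) ⋯ φ(t_k - t_{k-1})`, with `k = n + 1`. -/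
def integrand (f : ℝ → ℝ) (G : ℝ → ℝ) (n : ℕ) (t : Fin (n + 1) → ℝ) : ℝ :=
  (∏ i : Fin (n + 1), (G (t i) - 1)) *
    ∏ i : Fin n, (renewalDensity f (t i.succ - t i.castSucc)).toReal

end RenewalHawkes

end

open MeasureTheory ProbabilityTheory Set
open scoped ENNReal

noncomputable section

namespace RenewalHawkes

open Filter Topology

/-! ### The maps `a ↦ exp (-a)` and `u ↦ -log u` -/

/-! Exponents replace products throughout: `expNeg` is a homeomorphism of [0,∞] onto [0,1] with
inverse `negLog`. Products of p.g.fl. factors become sums in [0,∞], and zero factors or infinitely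
many points need no separate care.

Clusters. Given the tree up to generation n, the data of the individuals of generation n are still
fresh and independent. Averaging over their offspring multiplies the weight of an individual at x by
exp(∫ (w(x+s) - 1) h(s) ds) (`integral_forestSum_succ`). Working from the last generation back to
the roots, and then letting the number of generations grow, a forest with fixed centres t_i has
p.g.fl. ∏ G_c[z | t_i] (`integral_expNeg_forestSum`). Averaging over the epochs gives Ĝ[z] =
Ĝ_R[G_c[z | ·]]. Since ∫ h < 1, the mean size of generation n is at most (∫ h)^n, so clusters are
finite; as the epochs tend to infinity and offspring lie to the right of their parents, the process
is locally finite.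

Stationarity. Let τ have law ρ, let Kχ(t) = 𝔼 χ(t+τ), and let δ be the law of the delay, with
density m ρ((t,∞)). Then ∫ χ dδ + m ∫₀^∞ Kχ = m ∫₀^∞ χ (`lintegral_delayLaw_add`). Telescoping over
K^n χ shows that the epochs have mean measure m dt. The same balance shows that the first epoch not
before s overshoots s with law δ (`recurrenceLaw_eq`), and the later waiting times are fresh.

Expansion. Put g = 1 - G_c[z | ·] on (0,∞). The mean B(t) of the product of G_c over the renewals
after t should solve B = K((1-g)B). The solution is B = ∑ (-1)^k b_k with b_0 = 1 and b_{k+1} =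
∑_{n≥1} K^n(g b_k). Exponentials e^{-lt} are eigenfunctions of K whose eigenvalue tends to 0 as l →
∞, and g vanishes far to the right; so for large l the b_k decay like 2^{-k} and everything
converges absolutely. A martingale argument (`integral_expNeg_walk`) identifies ∫ (1-g) B dδ with
Ĝ_R[G_c]. The mean measure m dt turns ∫ (g b_k + b_{k+1}) dδ into m ∫ g b_k, and the kernel φ of
∑_{n≥1} K^n unfolds this into the integral over the chamber (`lintegral_chamberWeight`).

Poisson case. For exponential waiting times B(t) = exp(∫_t^∞ μ (G_c - 1)) solves the same equation.
The delay is then a further exponential time, so the p.g.fl. is B(0). -/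

/-- `exp (-a)` as an extended nonnegative real. -/
def expN (a : ℝ≥0∞) : ℝ≥0∞ := EReal.exp (-(a : EReal))

lemma expN_top : expN ⊤ = 0 := by simp [expN]

lemma expN_zero : expN 0 = 1 := by simp [expN]

lemma expN_of_ne_top {a : ℝ≥0∞} (ha : a ≠ ⊤) : expN a = ENNReal.ofReal (Real.exp (-a.toReal)) := by
  lift a to NNReal using ha
  rw [expN, ENNReal.coe_toReal, ← EReal.exp_coe]
  rfl

lemma expN_add (a b : ℝ≥0∞) : expN (a + b) = expN a * expN b := by
  by_cases ha : a = ⊤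
  · simp [ha, expN_top]
  by_cases hb : b = ⊤
  · simp [hb, expN_top]
  rw [expN_of_ne_top ha, expN_of_ne_top hb, expN_of_ne_top (by simp [ha, hb]),
    ENNReal.toReal_add ha hb, neg_add, Real.exp_add, ENNReal.ofReal_mul (Real.exp_nonneg _)]

lemma continuous_expN : Continuous expN :=
  ENNReal.continuous_exp.comp (continuous_neg.comp continuous_coe_ennreal_ereal)

lemma measurable_expN : Measurable expN := continuous_expN.measurable

lemma expN_le_one (a : ℝ≥0∞) : expN a ≤ 1 := by
  simpa [expN] using EReal.coe_ennreal_nonneg a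

lemma expN_ne_top (a : ℝ≥0∞) : expN a ≠ ⊤ := ((expN_le_one a).trans_lt ENNReal.one_lt_top).ne

lemma expNeg_eq (a : ℝ≥0∞) : expNeg a = (expN a).toReal := by
  by_cases ha : a = ⊤
  · simp [ha, expN_top, expNeg]
  · rw [expN_of_ne_top ha, ENNReal.toReal_ofReal (Real.exp_nonneg _), expNeg, if_neg ha]

lemma expNeg_nonneg (a : ℝ≥0∞) : 0 ≤ expNeg a := by simp [expNeg_eq]

lemma expNeg_le_one (a : ℝ≥0∞) : expNeg a ≤ 1 := by
  rw [expNeg_eq]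
  exact ENNReal.toReal_le_of_le_ofReal zero_le_one (by simpa using expN_le_one a)

lemma ofReal_expNeg (a : ℝ≥0∞) : ENNReal.ofReal (expNeg a) = expN a := by
  rw [expNeg_eq, ENNReal.ofReal_toReal (expN_ne_top a)]

lemma continuous_expNeg : Continuous expNeg := by
  have : expNeg = fun a => (expN a).toReal := funext expNeg_eq
  rw [this]
  exact continuous_iff_continuousAt.2 fun a =>
    (ENNReal.continuousAt_toReal (expN_ne_top a)).comp continuous_expN.continuousAt

lemma measurable_expNeg : Measurable expNeg := continuous_expNeg.measurable

lemma expNeg_zero : expNeg 0 = 1 := by simp [expNeg]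

lemma expNeg_add (a b : ℝ≥0∞) : expNeg (a + b) = expNeg a * expNeg b := by
  simp [expNeg_eq, expN_add]

lemma expNeg_sum {ι : Type*} (s : Finset ι) (a : ι → ℝ≥0∞) :
    expNeg (∑ i ∈ s, a i) = ∏ i ∈ s, expNeg (a i) := by
  classical
  induction s using Finset.induction_on with
  | empty => simp [expNeg_zero]
  | insert i s hi ih => rw [Finset.sum_insert hi, Finset.prod_insert hi, expNeg_add, ih]

lemma measurable_negLog : Measurable negLog :=
  Measurable.ite measurableSet_Iic measurable_const
    (ENNReal.measurable_ofReal.comp Real.measurable_log.neg)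

lemma negLog_one : negLog 1 = 0 := by simp [negLog]

lemma expNeg_negLog {u : ℝ} (hu : u ∈ Icc (0 : ℝ) 1) : expNeg (negLog u) = u := by
  by_cases h : u ≤ 0
  · simp [negLog, expNeg, le_antisymm h hu.1]
  · have h' : 0 ≤ -Real.log u := neg_nonneg.2 (Real.log_nonpos hu.1 hu.2)
    simp only [negLog, h, expNeg, if_false, ENNReal.ofReal_ne_top, ENNReal.toReal_ofReal h',
      neg_neg]
    exact Real.exp_log (not_le.1 h)

lemma negLog_expNeg (a : ℝ≥0∞) : negLog (expNeg a) = a := by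
  by_cases ha : a = ⊤
  · simp [ha, expNeg, negLog]
  · simp [expNeg, negLog, ha, Real.exp_pos, ENNReal.ofReal_toReal]

lemma expNeg_injective : Function.Injective expNeg := fun a b h => by
  rw [← negLog_expNeg a, h, negLog_expNeg]

lemma negLog_mul {u v : ℝ} (hu : u ∈ Icc (0 : ℝ) 1) (hv : v ∈ Icc (0 : ℝ) 1) :
    negLog (u * v) = negLog u + negLog v := by
  apply expNeg_injective
  rw [expNeg_add, expNeg_negLog hu, expNeg_negLog hv,
    expNeg_negLog ⟨mul_nonneg hu.1 hv.1, mul_le_one₀ hu.2 hv.1 hv.2⟩]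

lemma negLog_anti {u v : ℝ} (huv : u ≤ v) : negLog v ≤ negLog u := by
  by_cases h : u ≤ 0
  · simp [negLog, h]
  · have hv : ¬ v ≤ 0 := by linarith
    simp only [negLog, h, hv, if_false]
    exact ENNReal.ofReal_le_ofReal (neg_le_neg (Real.log_le_log (not_le.1 h) huv))

/-! ### Expectations of `exp (-a)` -/

section expectation

variable {Ω : Type*} [MeasurableSpace Ω] {P : Measure Ω}

lemma integral_expNeg_mem [IsProbabilityMeasure P] (a : Ω → ℝ≥0∞) :
    ∫ ω, expNeg (a ω) ∂P ∈ Icc (0 : ℝ) 1 := by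
  refine ⟨integral_nonneg fun _ => expNeg_nonneg _, ?_⟩
  have := norm_integral_le_of_norm_le_const (μ := P) (C := 1) (f := fun ω => expNeg (a ω))
    (Eventually.of_forall fun ω => by
      rw [Real.norm_of_nonneg (expNeg_nonneg _)]; exact expNeg_le_one _)
  rw [Real.norm_of_nonneg (integral_nonneg fun _ => expNeg_nonneg _)] at this
  simpa using this

lemma integrable_expNeg [IsFiniteMeasure P] {a : Ω → ℝ≥0∞} (ha : Measurable a) :
    Integrable (fun ω => expNeg (a ω)) P :=
  Integrable.of_bound (measurable_expNeg.comp ha).aestronglyMeasurable 1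
    (Eventually.of_forall fun ω => by
      rw [Real.norm_of_nonneg (expNeg_nonneg _)]; exact expNeg_le_one _)

/-- As exp(-a) lies in [0,1], the constant 1 dominates; the exponents may converge to ∞. -/
lemma tendsto_integral_expNeg [IsFiniteMeasure P] {ι : Type*} {l : Filter ι}
    [l.IsCountablyGenerated] {a : ι → Ω → ℝ≥0∞}
    {b : Ω → ℝ≥0∞} (ha : ∀ n, Measurable (a n))
    (hab : ∀ ω, Tendsto (fun n => a n ω) l (𝓝 (b ω))) :
    Tendsto (fun n => ∫ ω, expNeg (a n ω) ∂P) l (𝓝 (∫ ω, expNeg (b ω) ∂P)) := by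
  refine tendsto_integral_filter_of_dominated_convergence (fun _ => 1)
    (Eventually.of_forall fun n => (measurable_expNeg.comp (ha n)).aestronglyMeasurable)
    (Eventually.of_forall fun n => Eventually.of_forall fun ω => ?_)
    (integrable_const _) (Eventually.of_forall fun ω => ?_)
  · rw [Real.norm_of_nonneg (expNeg_nonneg _)]; exact expNeg_le_one _
  · exact (continuous_expNeg.tendsto _).comp (hab ω)

/-- For independent `a i`, `𝔼[exp (-∑ a i)] = ∏ 𝔼[exp (-a i)]`. -/
lemma integral_expNeg_tsum {ι : Type*} [Countable ι] {a : ι → Ω → ℝ≥0∞}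
    (ha : ∀ i, Measurable (a i)) (hind : iIndepFun a P) :
    ∫ ω, expNeg (∑' i, a i ω) ∂P = expNeg (∑' i, negLog (∫ ω, expNeg (a i ω) ∂P)) := by
  have := hind.isProbabilityMeasure
  -- In [0,∞] the product rule for independent factors needs no integrability.
  have hind' : iIndepFun (fun i ω => expN (a i ω)) P :=
    hind.comp (fun _ => expN) (fun _ => measurable_expN)
  have hfin : ∀ s : Finset ι, ∫ ω, expNeg (∑ i ∈ s, a i ω) ∂P =
      expNeg (∑ i ∈ s, negLog (∫ ω, expNeg (a i ω) ∂P)) := by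
    intro s
    have key := lintegral_prod_eq_prod_lintegral_of_indepFun s _ hind'
      (fun i => measurable_expN.comp (ha i))
    have conv : ∀ b : Ω → ℝ≥0∞, Measurable b →
        ∫ ω, expNeg (b ω) ∂P = (∫⁻ ω, expN (b ω) ∂P).toReal := by
      intro b hb
      rw [integral_eq_lintegral_of_nonneg_ae (Eventually.of_forall fun _ => expNeg_nonneg _)
        (measurable_expNeg.comp hb).aestronglyMeasurable]
      simp only [ofReal_expNeg]
    rw [expNeg_sum]
    simp only [expNeg_negLog (integral_expNeg_mem _)]
    rw [conv _ (Finset.measurable_fun_sum s fun i _ => ha i),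
      Finset.prod_congr rfl fun i _ => conv _ (ha i), ← ENNReal.toReal_prod, ← key]
    congr 2
    funext ω
    induction s using Finset.cons_induction with
    | empty => simp [expN_zero]
    | cons i s hi ih => rw [Finset.sum_cons, Finset.prod_cons, expN_add, ih (by
        exact lintegral_prod_eq_prod_lintegral_of_indepFun s _ hind'
          (fun i => measurable_expN.comp (ha i)))]
  have h1 : Tendsto (fun s : Finset ι => ∫ ω, expNeg (∑ i ∈ s, a i ω) ∂P) atTop
      (𝓝 (∫ ω, expNeg (∑' i, a i ω) ∂P)) :=
    tendsto_integral_expNeg (fun s => Finset.measurable_fun_sum s fun i _ => ha i)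
      (fun ω => ENNReal.summable.hasSum)
  have h2 : Tendsto (fun s : Finset ι => expNeg (∑ i ∈ s, negLog (∫ ω, expNeg (a i ω) ∂P))) atTop
      (𝓝 (expNeg (∑' i, negLog (∫ ω, expNeg (a i ω) ∂P)))) :=
    (continuous_expNeg.tendsto _).comp ENNReal.summable.hasSum
  simp only [hfin] at h1
  exact tendsto_nhds_unique h1 h2

end expectation

/-! ### Resampling part of the coordinates of a product measure -/

open Classical in
/-- The family which agrees with `a` on `S` and with `b` off `S`. -/
def splice {ι X : Type*} (S : Set ι) (q : (ι → X) × (ι → X)) : ι → X :=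
  fun i => if i ∈ S then q.1 i else q.2 i

lemma splice_of_mem {ι X : Type*} {S : Set ι} {i : ι} (h : i ∈ S) (q : (ι → X) × (ι → X)) :
    splice S q i = q.1 i := if_pos h

lemma splice_of_notMem {ι X : Type*} {S : Set ι} {i : ι} (h : i ∉ S) (q : (ι → X) × (ι → X)) :
    splice S q i = q.2 i := if_neg h

lemma measurable_splice {ι X : Type*} [MeasurableSpace X] (S : Set ι) :
    Measurable (splice S : (ι → X) × (ι → X) → ι → X) := by
  refine measurable_pi_lambda _ fun i => ?_
  by_cases h : i ∈ S
  · simp only [splice, h, if_true]; fun_prop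
  · simp only [splice, h, if_false]; fun_prop

/-- Independent coordinates may be resampled on a set of indices. -/
lemma map_splice {ι X : Type*} [MeasurableSpace X] (M : ι → Measure X)
    [∀ i, IsProbabilityMeasure (M i)] (S : Set ι) :
    ((Measure.infinitePi M).prod (Measure.infinitePi M)).map (splice S) =
      Measure.infinitePi M := by
  classical
  refine Measure.eq_infinitePi _ fun s t ht => ?_
  rw [Measure.map_apply (measurable_splice S)
    (MeasurableSet.pi s.countable_toSet fun i _ => ht i)]
  -- The preimage of a box is a box in the coordinates of S times a box in the others, so its mass
  -- factors and the two finite products recombine.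
  have : splice S ⁻¹' (Set.pi s t) =
      (Set.pi (s.filter (· ∈ S)) t) ×ˢ (Set.pi (s.filter (· ∉ S)) t) := by
    ext q
    simp only [mem_preimage, Set.mem_pi, mem_prod, Finset.coe_filter, mem_ofPred_eq, Finset.mem_coe]
    constructor
    · intro h
      exact ⟨fun i hi => by simpa [splice, hi.2] using h i hi.1,
        fun i hi => by simpa [splice, hi.2] using h i hi.1⟩
    · rintro ⟨h1, h2⟩ i hi
      by_cases hS : i ∈ S
      · simpa [splice, hS] using h1 i ⟨hi, hS⟩
      · simpa [splice, hS] using h2 i ⟨hi, hS⟩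
  rw [this, Measure.prod_prod, Measure.infinitePi_pi _ fun i _ => ht i,
    Measure.infinitePi_pi _ fun i _ => ht i, Finset.prod_filter_mul_prod_filter_not]

lemma lintegral_splice {ι X : Type*} [MeasurableSpace X] (M : ι → Measure X)
    [∀ i, IsProbabilityMeasure (M i)] (S : Set ι) {F : (ι → X) → ℝ≥0∞} (hF : Measurable F) :
    ∫⁻ d, F d ∂Measure.infinitePi M =
      ∫⁻ a, ∫⁻ b, F (splice S (a, b)) ∂Measure.infinitePi M ∂Measure.infinitePi M := by
  conv_lhs => rw [← map_splice M S]
  rw [lintegral_map hF (measurable_splice S)]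
  exact lintegral_prod _ (hF.comp (measurable_splice S)).aemeasurable

lemma integral_splice {ι X : Type*} [MeasurableSpace X] (M : ι → Measure X)
    [∀ i, IsProbabilityMeasure (M i)] (S : Set ι) {F : (ι → X) → ℝ} (hF : Measurable F)
    (hI : Integrable F (Measure.infinitePi M)) :
    ∫ d, F d ∂Measure.infinitePi M =
      ∫ a, ∫ b, F (splice S (a, b)) ∂Measure.infinitePi M ∂Measure.infinitePi M := by
  rw [← map_splice M S] at hI
  conv_lhs => rw [← map_splice M S]
  rw [integral_map_of_stronglyMeasurable (measurable_splice S) hF.stronglyMeasurable]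
  exact integral_prod _ (hI.comp_measurable (measurable_splice S))

/-- Monotone convergence for sums in `[0,∞]`. -/
lemma tendsto_tsum_of_monotone {ι : Type*} [Countable ι] {a : ℕ → ι → ℝ≥0∞} {b : ι → ℝ≥0∞}
    (hmono : ∀ i, Monotone fun n => a n i) (hlim : ∀ i, Tendsto (fun n => a n i) atTop (𝓝 (b i))) :
    Tendsto (fun n => ∑' i, a n i) atTop (𝓝 (∑' i, b i)) := by
  -- The sum is an integral against counting measure.
  let _ : MeasurableSpace ι := ⊤
  have := lintegral_tendsto_of_tendsto_of_monotone (μ := Measure.count) (f := a) (F := b)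
    (fun n => Measurable.aemeasurable fun _ _ => trivial)
    (Eventually.of_forall hmono) (Eventually.of_forall hlim)
  simpa [lintegral_count] using this

/-! ### Integrals against clusters -/

lemma lintegral_satellite (a : ℕ × (ℕ → ℝ)) (x : ℝ) (ψ : ℝ → ℝ≥0∞) :
    ∫⁻ y, ψ y ∂satellite a x = ∑ j ∈ Finset.range a.1, ψ (x + a.2 j) := by
  simp [satellite]

lemma measurable_lintegral_satellite {ψ : ℝ → ℝ≥0∞} (hψ : Measurable ψ) (x : ℝ) :
    Measurable fun a => ∫⁻ y, ψ y ∂satellite a x := by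
  simp only [lintegral_satellite]
  refine measurable_from_prod_countable_right fun k => ?_
  change Measurable fun y : ℕ → ℝ => ∑ j ∈ Finset.range k, ψ (x + y j)
  fun_prop

/-- Only the data of the proper ancestors matter, and these are strictly shorter words. With
`time_congr`, this allows the data at the word's own level to be resampled without disturbing the
word. -/
lemma alive_congr {d d' : List ℕ → ℕ × (ℕ → ℝ)} :
    ∀ {u : List ℕ}, (∀ v, v.length < u.length → d v = d' v) → (Alive d u ↔ Alive d' u)
  | [], _ => by simp [Alive]
  | j :: u, h => by
      have h1 : Alive d u ↔ Alive d' u :=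
        alive_congr fun v hv => h v (hv.trans (by simp))
      simp [Alive, h1, h u (by simp)]

lemma time_congr {d d' : List ℕ → ℕ × (ℕ → ℝ)} {t : ℝ} :
    ∀ {u : List ℕ}, (∀ v, v.length < u.length → d v = d' v) → time d t u = time d' t u
  | [], _ => by simp [time]
  | j :: u, h => by
      have h1 : time d t u = time d' t u :=
        time_congr fun v hv => h v (hv.trans (by simp))
      simp [time, h1, h u (by simp)]

lemma time_add (d : List ℕ → ℕ × (ℕ → ℝ)) (s t : ℝ) :
    ∀ u : List ℕ, time d (s + t) u = s + time d t u
  | [] => by simp [time]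
  | j :: u => by simp [time, time_add d s t u, add_assoc]

open Classical in
-- The recursive definition lists satellites parent by parent; the bijection of pairs (u, j) with
-- nonempty words `j :: u` re-indexes them by the individuals themselves.
lemma lintegral_generation (d : List ℕ → ℕ × (ℕ → ℝ)) (t : ℝ) (ψ : ℝ → ℝ≥0∞) (n : ℕ) :
    ∫⁻ y, ψ y ∂generation d t n =
      ∑' u : List ℕ, if u.length = n ∧ Alive d u then ψ (time d t u) else 0 := by
  cases n with
  | zero =>
    rw [tsum_eq_single []]
    · simp [generation, Alive, time]
    · intro u hu
      simp [hu]
  | succ n =>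
    rw [generation, lintegral_sum_measure]
    have hcons : Function.Injective fun q : List ℕ × ℕ => q.2 :: q.1 := by
      rintro ⟨u, j⟩ ⟨v, k⟩ h
      simp_all
    rw [← hcons.tsum_eq (f := fun v : List ℕ =>
      if v.length = n + 1 ∧ Alive d v then ψ (time d t v) else 0), ENNReal.tsum_prod']
    · refine tsum_congr fun u => ?_
      by_cases hu : u.length = n ∧ Alive d u
      · simp only [hu, and_self, if_true, lintegral_satellite, List.length_cons, Alive, true_and,
          time]
        rw [tsum_eq_sum (s := Finset.range (d u).1)]
        · exact Finset.sum_congr rfl fun j hj => by simp [Finset.mem_range.1 hj]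
        · intro j hj
          simp_all
      · simp only [hu, if_false, lintegral_zero_measure, List.length_cons, Alive, add_left_inj]
        symm
        refine ENNReal.tsum_eq_zero.2 ?_
        intro j
        rw [if_neg]
        tauto
    · intro u hu
      cases u with
      | nil => simp at hu
      | cons j u => exact ⟨(u, j), rfl⟩

open Classical in
lemma lintegral_cluster (d : List ℕ → ℕ × (ℕ → ℝ)) (t : ℝ) (ψ : ℝ → ℝ≥0∞) :
    ∫⁻ y, ψ y ∂cluster d t = ∑' u : List ℕ, if Alive d u then ψ (time d t u) else 0 := by
  rw [cluster, lintegral_sum_measure]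
  simp only [lintegral_generation]
  rw [ENNReal.tsum_comm]
  refine tsum_congr fun u => ?_
  rw [tsum_eq_single u.length]
  · simp
  · intro n hn
    simp [hn.symm]

/-! ### Forests of clusters -/

section forest

variable {ι : Type*}

open Classical in
/-- The sum over the individuals `(i, u)` of a forest of clusters, the `i`-th one being centred at
`t i`, of a function of the generation and of the time. -/
def forestSum (H : ℕ → ℝ → ℝ≥0∞) (t : ι → ℝ) (d : ι × List ℕ → ℕ × (ℕ → ℝ)) : ℝ≥0∞ :=
  ∑' p : ι × List ℕ, if Alive (fun u => d (p.1, u)) p.2 then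
    H p.2.length (time (fun u => d (p.1, u)) (t p.1) p.2) else 0

lemma forestSum_eq_tsum_cluster (ψ : ℝ → ℝ≥0∞) (t : ι → ℝ) (d : ι × List ℕ → ℕ × (ℕ → ℝ)) :
    forestSum (fun _ => ψ) t d = ∑' i, ∫⁻ y, ψ y ∂cluster (fun u => d (i, u)) (t i) := by
  simp only [forestSum, lintegral_cluster]
  rw [ENNReal.tsum_prod']

lemma measurableSet_alive (i : ι) (u : List ℕ) :
    MeasurableSet {d : ι × List ℕ → ℕ × (ℕ → ℝ) | Alive (fun u => d (i, u)) u} := by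
  induction u with
  | nil => simp [Alive]
  | cons j u ih =>
    simp only [Alive]
    have h2 : MeasurableSet {d : ι × List ℕ → ℕ × (ℕ → ℝ) | j < (d (i, u)).1} :=
      measurableSet_lt measurable_const (by fun_prop)
    exact ih.inter h2

lemma measurable_time (i : ι) (u : List ℕ) :
    Measurable fun q : (ι → ℝ) × (ι × List ℕ → ℕ × (ℕ → ℝ)) =>
      time (fun u => q.2 (i, u)) (q.1 i) u := by
  induction u with
  | nil => simp only [time]; fun_prop
  | cons j u ih =>
    simp only [time]
    have : Measurable fun q : (ι → ℝ) × (ι × List ℕ → ℕ × (ℕ → ℝ)) => (q.2 (i, u)).2 j := by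
      fun_prop
    exact ih.add this

lemma measurable_forestSum_prod [Countable ι] {H : ℕ → ℝ → ℝ≥0∞} (hH : ∀ n, Measurable (H n)) :
    Measurable fun q : (ι → ℝ) × (ι × List ℕ → ℕ × (ℕ → ℝ)) => forestSum H q.1 q.2 := by
  refine Measurable.tsum fun p => Measurable.ite ?_ ?_ measurable_const
  · exact measurable_snd (measurableSet_alive p.1 p.2)
  · exact (hH _).comp (measurable_time p.1 p.2)

lemma measurable_forestSum [Countable ι] {H : ℕ → ℝ → ℝ≥0∞} (hH : ∀ n, Measurable (H n))
    (t : ι → ℝ) : Measurable (forestSum H t) :=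
  (measurable_forestSum_prod hH).comp (measurable_const.prodMk measurable_id)

/-- The p.g.fl. of the satellite process of a parent at `x`. -/
def offspringPgfl (h : ℝ → ℝ) (w : ℝ → ℝ) (x : ℝ) : ℝ :=
  Real.exp (∫ s in Ioi (0 : ℝ), (w (x + s) - 1) * h s)

/-- The law of a Poisson satellite process with intensity `h`, through its p.g.fl. -/
def IsPoissonData (h : ℝ → ℝ) (M : Measure (ℕ × (ℕ → ℝ))) : Prop :=
  ∀ w : ℝ → ℝ, Measurable w → (∀ x, w x ∈ Icc (0 : ℝ) 1) →
    ∫ a, expNeg (∫⁻ y, negLog (w y) ∂satellite a 0) ∂M =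
      Real.exp (∫ s in Ioi (0 : ℝ), (w s - 1) * h s)

lemma IsPoissonData.integral_satellite {h : ℝ → ℝ} {M : Measure (ℕ × (ℕ → ℝ))}
    (hM : IsPoissonData h M) {w : ℝ → ℝ} (hw : Measurable w) (hw' : ∀ x, w x ∈ Icc (0 : ℝ) 1)
    (x : ℝ) :
    ∫ a, expNeg (∫⁻ y, negLog (w y) ∂satellite a x) ∂M = offspringPgfl h w x := by
  rw [offspringPgfl, ← hM (fun s => w (x + s)) (by fun_prop) fun s => hw' _]
  simp only [lintegral_satellite, zero_add]

/-- The weight `z` on the generations before the `n`-th, and `w` on the `n`-th. -/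
def genWeight (z w : ℝ → ℝ) (n k : ℕ) (x : ℝ) : ℝ≥0∞ :=
  if k < n then negLog (z x) else if k = n then negLog (w x) else 0

lemma measurable_genWeight {z w : ℝ → ℝ} (hz : Measurable z) (hw : Measurable w) (n k : ℕ) :
    Measurable (genWeight z w n k) := by
  unfold genWeight
  split_ifs
  · exact measurable_negLog.comp hz
  · exact measurable_negLog.comp hw
  · exact measurable_const

lemma offspringPgfl_mem {h w : ℝ → ℝ} (hh : IsOffspringDensity h)
    (hw' : ∀ x, w x ∈ Icc (0 : ℝ) 1) (x : ℝ) : offspringPgfl h w x ∈ Icc (0 : ℝ) 1 := by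
  refine ⟨Real.exp_nonneg _, Real.exp_le_one_iff.2 ?_⟩
  refine setIntegral_nonpos measurableSet_Ioi fun s hs => ?_
  exact mul_nonpos_of_nonpos_of_nonneg (sub_nonpos.2 (hw' _).2) (hh.nonneg s (le_of_lt hs))

lemma measurable_offspringPgfl {h w : ℝ → ℝ} (hh : IsOffspringDensity h) (hw : Measurable w) :
    Measurable (offspringPgfl h w) := by
  have h1 : Measurable fun q : ℝ × ℝ => (w (q.1 + q.2) - 1) * h q.2 := by
    have := hh.measurable
    fun_prop
  exact Real.measurable_exp.comp h1.stronglyMeasurable.integral_prod_right.measurable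

open Classical in
-- Writing generation n + 1 as the satellites of generation n isolates the data at words of length
-- n; the rest depends on shorter words only.
lemma forestSum_genWeight_succ (z w : ℝ → ℝ) (n : ℕ) (t : ι → ℝ)
    (d : ι × List ℕ → ℕ × (ℕ → ℝ)) :
    forestSum (genWeight z w (n + 1)) t d =
      forestSum (genWeight z z n) t d + ∑' p : ι × List ℕ,
        if p.2.length = n ∧ Alive (fun u => d (p.1, u)) p.2 then
          ∫⁻ y, negLog (w y) ∂satellite (d p) (time (fun u => d (p.1, u)) (t p.1) p.2) else 0 := by
  have hgen : ∀ i, (∑' u : List ℕ, if u.length = n ∧ Alive (fun u => d (i, u)) u then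
      ∫⁻ y, negLog (w y) ∂satellite (d (i, u)) (time (fun u => d (i, u)) (t i) u) else 0) =
      ∑' u : List ℕ, if u.length = n + 1 ∧ Alive (fun u => d (i, u)) u then
        negLog (w (time (fun u => d (i, u)) (t i) u)) else 0 := by
    intro i
    rw [← lintegral_generation _ _ (fun y => negLog (w y)), generation, lintegral_sum_measure]
    refine tsum_congr fun u => ?_
    split_ifs <;> simp
  have hsum : (∑' p : ι × List ℕ, if p.2.length = n ∧ Alive (fun u => d (p.1, u)) p.2 then
      ∫⁻ y, negLog (w y) ∂satellite (d p) (time (fun u => d (p.1, u)) (t p.1) p.2) else 0) =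
      ∑' p : ι × List ℕ, if p.2.length = n + 1 ∧ Alive (fun u => d (p.1, u)) p.2 then
        negLog (w (time (fun u => d (p.1, u)) (t p.1) p.2)) else 0 := by
    rw [ENNReal.tsum_prod', ENNReal.tsum_prod']
    exact tsum_congr hgen
  rw [hsum, forestSum, forestSum, ← ENNReal.tsum_add]
  refine tsum_congr fun p => ?_
  by_cases hA : Alive (fun u => d (p.1, u)) p.2
  · simp only [hA, if_true, and_true, genWeight]
    rcases lt_trichotomy p.2.length n with h | h | h
    · simp [h, h.trans (Nat.lt_succ_self n), (h.trans (Nat.lt_succ_self n)).ne]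
    · simp [h]
    · have h1 : ¬ p.2.length < n + 1 := by omega
      have h2 : ¬ p.2.length < n := by omega
      simp [h1, h2, h.ne']
  · simp [hA]

variable [Countable ι] {h : ℝ → ℝ} {M : ι × List ℕ → Measure (ℕ × (ℕ → ℝ))}
  [∀ p, IsProbabilityMeasure (M p)]

/-- One step of the branching recursion: the last generation is integrated out. -/
lemma integral_forestSum_succ (hh : IsOffspringDensity h) (hM : ∀ p, IsPoissonData h (M p))
    {z w : ℝ → ℝ} (hz : Measurable z) (hw : Measurable w) (hz' : ∀ x, z x ∈ Icc (0 : ℝ) 1)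
    (hw' : ∀ x, w x ∈ Icc (0 : ℝ) 1) (n : ℕ) (t : ι → ℝ) :
    ∫ d, expNeg (forestSum (genWeight z w (n + 1)) t d) ∂Measure.infinitePi M =
      ∫ d, expNeg (forestSum (genWeight z (fun x => z x * offspringPgfl h w x) n) t d)
        ∂Measure.infinitePi M := by
  classical
  have hFm : Measurable (forestSum (genWeight z w (n + 1)) t) :=
    measurable_forestSum (fun k => measurable_genWeight hz hw (n + 1) k) t
  have hFe : Measurable fun d => expNeg (forestSum (genWeight z w (n + 1)) t d) :=
    measurable_expNeg.comp hFm
  -- The data `a` at words shorter than n fix the forest up to generation n; all other data `b` are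
  -- averaged out with `a` frozen.
  rw [integral_splice M {p | p.2.length < n} hFe (integrable_expNeg hFm)]
  congr 1 with a
  have hagree : ∀ (b : ι × List ℕ → ℕ × (ℕ → ℝ)) (i : ι) (u : List ℕ), u.length ≤ n →
      ∀ v : List ℕ, v.length < u.length →
        splice {p : ι × List ℕ | p.2.length < n} (a, b) (i, v) = a (i, v) :=
    fun b i u hu v hv => splice_of_mem
      (S := {p : ι × List ℕ | p.2.length < n}) (i := (i, v)) (hv.trans_le hu) _
  have hAl : ∀ b i u, u.length ≤ n →
      (Alive (fun v => splice {p : ι × List ℕ | p.2.length < n} (a, b) (i, v)) u ↔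
        Alive (fun v => a (i, v)) u) := fun b i u hu => alive_congr (hagree b i u hu)
  have hTi : ∀ b i u, u.length ≤ n →
      time (fun v => splice {p : ι × List ℕ | p.2.length < n} (a, b) (i, v)) (t i) u =
        time (fun v => a (i, v)) (t i) u := fun b i u hu => time_congr (hagree b i u hu)
  have hF : ∀ b, forestSum (genWeight z w (n + 1)) t (splice {p | p.2.length < n} (a, b)) =
      forestSum (genWeight z z n) t a + ∑' p : ι × List ℕ,
        if p.2.length = n ∧ Alive (fun u => a (p.1, u)) p.2 then
          ∫⁻ y, negLog (w y) ∂satellite (b p) (time (fun u => a (p.1, u)) (t p.1) p.2) else 0 := by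
    intro b
    rw [forestSum_genWeight_succ]
    congr 1
    · refine tsum_congr fun p => ?_
      by_cases hp : p.2.length ≤ n
      · simp only [hAl b p.1 p.2 hp, hTi b p.1 p.2 hp]
      · have h1 : ¬ p.2.length < n := by omega
        have h2 : p.2.length ≠ n := by omega
        simp [genWeight, h1, h2]
    · refine tsum_congr fun p => ?_
      by_cases hp : p.2.length = n
      · simp only [hAl b p.1 p.2 hp.le, hTi b p.1 p.2 hp.le]
        rw [splice_of_notMem (S := {p : ι × List ℕ | p.2.length < n}) (i := p) (by simp [hp])]
      · simp [hp]
  simp only [hF, expNeg_add]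
  rw [integral_const_mul]
  have hmeas : ∀ p : ι × List ℕ, Measurable fun c : ℕ × (ℕ → ℝ) =>
      if p.2.length = n ∧ Alive (fun u => a (p.1, u)) p.2 then
        ∫⁻ y, negLog (w y) ∂satellite c (time (fun u => a (p.1, u)) (t p.1) p.2) else 0 := by
    intro p
    split_ifs
    · exact measurable_lintegral_satellite (measurable_negLog.comp hw) _
    · exact measurable_const
  -- Given `a`, the satellites of distinct individuals read distinct coordinates of `b`, hence are
  -- independent.
  have hprod := integral_expNeg_tsum (fun p => (hmeas p).comp (measurable_pi_apply p))
    (iIndepFun_infinitePi (P := M) hmeas)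
  simp only [Function.comp_apply] at hprod
  rw [hprod, ← expNeg_add, forestSum, forestSum, ← ENNReal.tsum_add]
  congr 1
  refine tsum_congr fun p => ?_
  have hI : ∫ b, expNeg (if p.2.length = n ∧ Alive (fun u => a (p.1, u)) p.2 then
        ∫⁻ y, negLog (w y) ∂satellite (b p) (time (fun u => a (p.1, u)) (t p.1) p.2) else 0)
        ∂Measure.infinitePi M =
      if p.2.length = n ∧ Alive (fun u => a (p.1, u)) p.2 then
        offspringPgfl h w (time (fun u => a (p.1, u)) (t p.1) p.2) else 1 := by
    split_ifs with hp
    · rw [← (hM p).integral_satellite hw hw', ← Measure.infinitePi_map_eval M p]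
      have hsat : Measurable fun c => expNeg (∫⁻ y, negLog (w y)
          ∂satellite c (time (fun u => a (p.1, u)) (t p.1) p.2)) :=
        measurable_expNeg.comp (measurable_lintegral_satellite (measurable_negLog.comp hw) _)
      have hev : Measurable fun b : ι × List ℕ → ℕ × (ℕ → ℝ) => b p := measurable_pi_apply p
      exact (integral_map_of_stronglyMeasurable hev hsat.stronglyMeasurable).symm
    · simp [expNeg_zero]
  rw [hI]
  -- Generation n carries its own weight z and the factor of its offspring; `negLog_mul` merges the
  -- two into the new last weight.
  by_cases hA : Alive (fun u => a (p.1, u)) p.2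
  · simp only [hA, if_true, and_true, genWeight]
    rcases lt_trichotomy p.2.length n with h | h | h
    · simp [h, h.ne, negLog_one]
    · simp [h, negLog_mul (hz' _) (offspringPgfl_mem hh hw' _)]
    · simp [h.ne', not_lt.2 h.le, negLog_one]
  · simp [hA, negLog_one]

/-- The p.g.fl. of the first `n` generations of a cluster centred at `x`. -/
def truncPgfl (h z : ℝ → ℝ) : ℕ → ℝ → ℝ
  | 0 => z
  | n + 1 => fun x => z x * offspringPgfl h (truncPgfl h z n) x

lemma truncPgfl_mem (hh : IsOffspringDensity h) {z : ℝ → ℝ} (hz' : ∀ x, z x ∈ Icc (0 : ℝ) 1) :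
    ∀ n x, truncPgfl h z n x ∈ Icc (0 : ℝ) 1
  | 0, x => hz' x
  | n + 1, x => by
      have h1 := offspringPgfl_mem hh (truncPgfl_mem hh hz' n) x
      exact ⟨mul_nonneg (hz' x).1 h1.1, mul_le_one₀ (hz' x).2 h1.1 h1.2⟩

lemma measurable_truncPgfl (hh : IsOffspringDensity h) {z : ℝ → ℝ} (hz : Measurable z) :
    ∀ n, Measurable (truncPgfl h z n)
  | 0 => hz
  | n + 1 => hz.mul (measurable_offspringPgfl hh (measurable_truncPgfl hh hz n))

lemma integrableOn_sub_one_mul (hh : IsOffspringDensity h) {w : ℝ → ℝ} (hw : Measurable w)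
    (hw' : ∀ x, w x ∈ Icc (0 : ℝ) 1) : IntegrableOn (fun s => (w s - 1) * h s) (Ioi 0) := by
  refine hh.integrable.bdd_mul (c := 1) (hw.sub_const 1).aestronglyMeasurable ?_
  refine Eventually.of_forall fun s => ?_
  rw [Real.norm_eq_abs, abs_le]
  constructor <;> linarith [(hw' s).1, (hw' s).2]

lemma offspringPgfl_mono (hh : IsOffspringDensity h) {w v : ℝ → ℝ} (hw : Measurable w)
    (hv : Measurable v) (hw' : ∀ x, w x ∈ Icc (0 : ℝ) 1) (hv' : ∀ x, v x ∈ Icc (0 : ℝ) 1)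
    (hwv : ∀ x, w x ≤ v x) (x : ℝ) : offspringPgfl h w x ≤ offspringPgfl h v x := by
  refine Real.exp_le_exp.2 (setIntegral_mono_on
    (integrableOn_sub_one_mul hh (w := fun s => w (x + s)) (by fun_prop) fun s => hw' _)
    (integrableOn_sub_one_mul hh (w := fun s => v (x + s)) (by fun_prop) fun s => hv' _)
    measurableSet_Ioi fun s hs => ?_)
  exact mul_le_mul_of_nonneg_right (by linarith [hwv (x + s)]) (hh.nonneg s (le_of_lt hs))

/-- One more generation means more factors in [0,1]. The exponents therefore increase, and the limit
over generations passes through infinite sums by monotone convergence. -/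
lemma truncPgfl_succ_le (hh : IsOffspringDensity h) {z : ℝ → ℝ} (hz : Measurable z)
    (hz' : ∀ x, z x ∈ Icc (0 : ℝ) 1) :
    ∀ n x, truncPgfl h z (n + 1) x ≤ truncPgfl h z n x
  | 0, x => mul_le_of_le_one_right (hz' x).1
      (offspringPgfl_mem hh (truncPgfl_mem hh hz' 0) x).2
  | n + 1, x => mul_le_mul_of_nonneg_left (offspringPgfl_mono hh (measurable_truncPgfl hh hz _)
      (measurable_truncPgfl hh hz _) (truncPgfl_mem hh hz' _) (truncPgfl_mem hh hz' _)
      (truncPgfl_succ_le hh hz hz' n) x) (hz' x).1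

/-- `-log` of the p.g.fl. of a cluster centred at `x`. -/
def clusterExponent (h z : ℝ → ℝ) (x : ℝ) : ℝ≥0∞ := ⨆ n, negLog (truncPgfl h z n x)

lemma measurable_clusterExponent (hh : IsOffspringDensity h) {z : ℝ → ℝ} (hz : Measurable z) :
    Measurable (clusterExponent h z) :=
  Measurable.iSup fun n => measurable_negLog.comp (measurable_truncPgfl hh hz n)

/-- Each branching step lowers n by one and raises the depth k of the last weight by one, so k must
be free in the induction. At n = 0 only the roots remain and nothing is random. -/
lemma integral_forestSum_genWeight (hh : IsOffspringDensity h) (hM : ∀ p, IsPoissonData h (M p))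
    {z : ℝ → ℝ} (hz : Measurable z) (hz' : ∀ x, z x ∈ Icc (0 : ℝ) 1) (t : ι → ℝ) (n : ℕ) :
    ∀ k, ∫ d, expNeg (forestSum (genWeight z (truncPgfl h z k) n) t d) ∂Measure.infinitePi M =
      expNeg (∑' i, negLog (truncPgfl h z (n + k) (t i))) := by
  classical
  induction n with
  | zero =>
    intro k
    have : ∀ d : ι × List ℕ → ℕ × (ℕ → ℝ), forestSum (genWeight z (truncPgfl h z k) 0) t d =
        ∑' i, negLog (truncPgfl h z (0 + k) (t i)) := by
      intro d
      rw [forestSum, ENNReal.tsum_prod']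
      refine tsum_congr fun i => ?_
      rw [tsum_eq_single []]
      · simp [Alive, time, genWeight]
      · intro u hu
        simp [genWeight, hu]
    simp [this]
  | succ n ih =>
    intro k
    rw [integral_forestSum_succ hh hM hz (measurable_truncPgfl hh hz k) hz'
      (truncPgfl_mem hh hz' k)]
    have := ih (k + 1)
    rw [show n + 1 + k = n + (k + 1) by ring, ← this]
    rfl

/-- The p.g.fl. of a forest of clusters with given centres. -/
lemma integral_expNeg_forestSum (hh : IsOffspringDensity h) (hM : ∀ p, IsPoissonData h (M p))
    {z : ℝ → ℝ} (hz : Measurable z) (hz' : ∀ x, z x ∈ Icc (0 : ℝ) 1) (t : ι → ℝ) :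
    ∫ d, expNeg (forestSum (fun _ x => negLog (z x)) t d) ∂Measure.infinitePi M =
      expNeg (∑' i, clusterExponent h z (t i)) := by
  classical
  have hmono : Monotone fun n => genWeight z z n := by
    intro m n hmn k x
    simp only [genWeight]
    split_ifs <;> first | omega | simp
  have hlim : ∀ k x, Tendsto (fun n => genWeight z z n k x) atTop (𝓝 (negLog (z x))) := by
    intro k x
    refine tendsto_const_nhds.congr' ?_
    filter_upwards [eventually_gt_atTop k] with n hn
    simp [genWeight, hn]
  have h1 : Tendsto (fun n => ∫ d, expNeg (forestSum (genWeight z z n) t d) ∂Measure.infinitePi M)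
      atTop (𝓝 (∫ d, expNeg (forestSum (fun _ x => negLog (z x)) t d) ∂Measure.infinitePi M)) := by
    refine tendsto_integral_expNeg (fun n => measurable_forestSum
      (fun k => measurable_genWeight hz hz n k) t) fun d => ?_
    refine tendsto_tsum_of_monotone (fun p m n hmn => ?_) fun p => ?_
    · dsimp only
      split_ifs
      · exact hmono hmn _ _
      · exact le_rfl
    · split_ifs
      · exact hlim _ _
      · exact tendsto_const_nhds
  have h2 : Tendsto (fun n => expNeg (∑' i, negLog (truncPgfl h z n (t i)))) atTop
      (𝓝 (expNeg (∑' i, clusterExponent h z (t i)))) := by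
    refine (continuous_expNeg.tendsto _).comp ?_
    have hm : ∀ i, Monotone fun n => negLog (truncPgfl h z n (t i)) := fun i =>
      monotone_nat_of_le_succ fun n => negLog_anti (truncPgfl_succ_le hh hz hz' n _)
    exact tendsto_tsum_of_monotone hm fun i => tendsto_atTop_iSup (hm i)
  have h3 : ∀ n, ∫ d, expNeg (forestSum (genWeight z z n) t d) ∂Measure.infinitePi M =
      expNeg (∑' i, negLog (truncPgfl h z n (t i))) := fun n =>
    integral_forestSum_genWeight hh hM hz hz' t n 0
  simp only [h3] at h1
  exact tendsto_nhds_unique h1 h2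

end forest

/-! ### Poisson satellite processes -/

section poisson

variable {h : ℝ → ℝ} {M : Measure (ℕ × (ℕ → ℝ))} [IsProbabilityMeasure M]

/-- The expected number of offspring is at most `∫ h`. -/
lemma IsPoissonData.lintegral_fst_le (hM : IsPoissonData h M) :
    ∫⁻ a, (a.1 : ℝ≥0∞) ∂M ≤ ENNReal.ofReal (∫ s in Ioi (0 : ℝ), h s) := by
  set c := ∫ s in Ioi (0 : ℝ), h s
  -- For the number K of children and a constant weight r < 1, 𝔼 r^K = exp((r-1)c), while (1 -
  -- r^K)/(1 - r) = ∑_{j<K} r^j increases to K as r ↑ 1.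
  set r : ℕ → ℝ := fun n => 1 - 1 / ((n : ℝ) + 1)
  have hr0 : ∀ n, 0 ≤ r n := fun n => by
    have : 1 / ((n : ℝ) + 1) ≤ 1 := by
      rw [div_le_one (by positivity)]; linarith [Nat.cast_nonneg (α := ℝ) n]
    simp only [r]; linarith
  have hr1 : ∀ n, r n < 1 := fun n => by
    have : 0 < 1 / ((n : ℝ) + 1) := by positivity
    simp only [r]; linarith
  have hrlim : Tendsto r atTop (𝓝 1) := by
    simpa [r] using (tendsto_const_nhds (x := (1 : ℝ))).sub tendsto_one_div_add_atTop_nhds_zero_nat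
  have hrmono : Monotone r := fun m n hmn => by
    simp only [r]
    gcongr
  have hmeas : ∀ n, Measurable fun a : ℕ × (ℕ → ℝ) => ∑ j ∈ Finset.range a.1, r n ^ j := fun n =>
    (measurable_from_nat (f := fun k => ∑ j ∈ Finset.range k, r n ^ j)).comp measurable_fst
  have hbound : ∀ n, ∫⁻ a, ENNReal.ofReal (∑ j ∈ Finset.range a.1, r n ^ j) ∂M ≤
      ENNReal.ofReal c := by
    intro n
    have h1 := hM (fun _ => r n) measurable_const fun _ => ⟨hr0 n, (hr1 n).le⟩
    have hpow : ∀ a : ℕ × (ℕ → ℝ),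
        expNeg (∫⁻ y, negLog (r n) ∂satellite a 0) = r n ^ a.1 := by
      intro a
      rw [lintegral_satellite, expNeg_sum]
      simp [expNeg_negLog ⟨hr0 n, (hr1 n).le⟩]
    simp only [hpow] at h1
    rw [integral_const_mul] at h1
    have hgeom : ∀ a : ℕ × (ℕ → ℝ),
        ∑ j ∈ Finset.range a.1, r n ^ j = (1 - r n)⁻¹ * (1 - r n ^ a.1) := by
      intro a
      rw [geom_sum_eq (hr1 n).ne]
      have : r n - 1 ≠ 0 := by linarith [hr1 n]
      have : 1 - r n ≠ 0 := by linarith [hr1 n]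
      field_simp
      ring
    have hint : Integrable (fun a : ℕ × (ℕ → ℝ) => r n ^ a.1) M := by
      refine Integrable.of_bound (C := 1) ((measurable_from_nat (f := fun k => r n ^ k)).comp
        measurable_fst).aestronglyMeasurable (Eventually.of_forall fun a => ?_)
      rw [Real.norm_of_nonneg (pow_nonneg (hr0 n) _)]
      exact pow_le_one₀ (hr0 n) (hr1 n).le
    have hint' : Integrable (fun a : ℕ × (ℕ → ℝ) => ∑ j ∈ Finset.range a.1, r n ^ j) M := by
      simp only [hgeom]
      exact ((integrable_const 1).sub hint).const_mul _
    rw [← ofReal_integral_eq_lintegral_ofReal hint' (Eventually.of_forall fun a =>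
      Finset.sum_nonneg fun j _ => pow_nonneg (hr0 n) j)]
    apply ENNReal.ofReal_le_ofReal
    simp only [hgeom]
    rw [integral_const_mul, integral_sub (integrable_const 1) hint, h1]
    -- This gives 1 - exp((r-1)c) ≤ (1-r)c, hence the bound c after division by 1 - r.
    have h2 := Real.add_one_le_exp ((r n - 1) * c)
    have h3 : 0 < 1 - r n := by linarith [hr1 n]
    rw [inv_mul_le_iff₀ h3]
    simp only [integral_const, probReal_univ, smul_eq_mul, one_mul]
    linarith
  refine le_of_tendsto' (lintegral_tendsto_of_tendsto_of_monotone
    (fun n => ((hmeas n).ennreal_ofReal).aemeasurable) (Eventually.of_forall fun a m n hmn => ?_)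
    (Eventually.of_forall fun a => ?_)) hbound
  · exact ENNReal.ofReal_le_ofReal (Finset.sum_le_sum fun j _ =>
      pow_le_pow_left₀ (hr0 m) (hrmono hmn) j)
  · have : Tendsto (fun n => ∑ j ∈ Finset.range a.1, r n ^ j) atTop
        (𝓝 (∑ j ∈ Finset.range a.1, (1 : ℝ) ^ j)) := tendsto_finsetSum _ fun j _ => hrlim.pow j
    simpa using ENNReal.tendsto_ofReal this

/-- Almost surely, no individual is born before its parent. -/
lemma IsPoissonData.ae_nonneg (hM : IsPoissonData h M) : ∀ᵐ a ∂M, ∀ j < a.1, 0 ≤ a.2 j := by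
  classical
  -- This weight vanishes at every negative delay, yet the intensity on (0,∞) does not see it. The
  -- p.g.fl. is thus 1, and a product in [0,1] with mean 1 equals 1 almost surely.
  set w : ℝ → ℝ := (Ici (0 : ℝ)).indicator 1
  have hw : Measurable w := measurable_one.indicator measurableSet_Ici
  have hw' : ∀ x, w x ∈ Icc (0 : ℝ) 1 := fun x => by
    by_cases hx : 0 ≤ x <;> simp [w, hx]
  have h1 := hM w hw hw'
  have h2 : ∫ s in Ioi (0 : ℝ), (w s - 1) * h s = 0 := by
    refine setIntegral_eq_zero_of_forall_eq_zero fun s hs => ?_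
    simp [w, le_of_lt (mem_Ioi.1 hs)]
  rw [h2, Real.exp_zero] at h1
  have hm := measurable_lintegral_satellite (measurable_negLog.comp hw) 0
  have hi := integrable_expNeg (P := M) hm
  simp only [Function.comp_apply] at hi
  have h3 : ∫ a, (1 - expNeg (∫⁻ y, negLog (w y) ∂satellite a 0)) ∂M = 0 := by
    rw [integral_sub (integrable_const 1) hi, h1]
    simp
  rw [integral_eq_zero_iff_of_nonneg (fun a => sub_nonneg.2 (expNeg_le_one _))
    ((integrable_const 1).sub hi)] at h3
  filter_upwards [h3] with a ha j hj
  have h4 : ∫⁻ y, negLog (w y) ∂satellite a 0 = 0 := by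
    apply expNeg_injective
    rw [expNeg_zero]
    simp only [Pi.zero_apply] at ha
    linarith
  rw [lintegral_satellite, Finset.sum_eq_zero_iff] at h4
  have h5 := h4 j (Finset.mem_range.2 hj)
  by_contra hneg
  simp [w, hneg, negLog] at h5

end poisson

/-! ### Size and support of a subcritical cluster -/

section totals

variable {h : ℝ → ℝ} {M : List ℕ → Measure (ℕ × (ℕ → ℝ))} [∀ u, IsProbabilityMeasure (M u)]

lemma measurable_generation_univ (t : ℝ) (n : ℕ) :
    Measurable fun d : List ℕ → ℕ × (ℕ → ℝ) => generation d t n univ := by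
  classical
  have : ∀ d : List ℕ → ℕ × (ℕ → ℝ), generation d t n univ =
      ∑' u : List ℕ, if u.length = n ∧ Alive d u then 1 else 0 := fun d => by
    rw [← lintegral_one, lintegral_generation]
  simp only [this]
  refine Measurable.tsum fun u => Measurable.ite ?_ measurable_const measurable_const
  have hp : Measurable fun (d : List ℕ → ℕ × (ℕ → ℝ)) (p : Unit × List ℕ) => d p.2 := by fun_prop
  exact (MeasurableSet.const _).inter (hp (measurableSet_alive () u))

/-- With the shorter words frozen, each individual of generation n has at most ∫ h children on
average. -/
lemma lintegral_generation_univ_succ (hM : ∀ u, IsPoissonData h (M u)) (t : ℝ) (n : ℕ) :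
    ∫⁻ d, generation d t (n + 1) univ ∂Measure.infinitePi M ≤
      ENNReal.ofReal (∫ s in Ioi (0 : ℝ), h s) *
        ∫⁻ d, generation d t n univ ∂Measure.infinitePi M := by
  classical
  rw [lintegral_splice M {u | u.length < n} (measurable_generation_univ t (n + 1)),
    ← lintegral_const_mul _ (measurable_generation_univ t n)]
  refine lintegral_mono fun a => ?_
  have hagree : ∀ (b : List ℕ → ℕ × (ℕ → ℝ)) (u : List ℕ), u.length ≤ n →
      ∀ v : List ℕ, v.length < u.length →
        splice {u : List ℕ | u.length < n} (a, b) v = a v :=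
    fun b u hu v hv => splice_of_mem (S := {u : List ℕ | u.length < n}) (hv.trans_le hu) _
  have hgen : ∀ b, generation (splice {u : List ℕ | u.length < n} (a, b)) t (n + 1) univ =
      ∑' u : List ℕ, if u.length = n ∧ Alive a u then ((b u).1 : ℝ≥0∞) else 0 := by
    intro b
    rw [generation, Measure.sum_apply _ MeasurableSet.univ]
    refine tsum_congr fun u => ?_
    by_cases hu : u.length = n
    · rw [alive_congr (hagree b u hu.le),
        splice_of_notMem (S := {u : List ℕ | u.length < n}) (i := u) (by simp [hu])]
      split_ifs
      · rw [← lintegral_one, lintegral_satellite]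
        simp
      · simp
    · simp [hu]
  simp only [hgen]
  rw [lintegral_tsum fun u => ?_]
  · rw [← lintegral_one, lintegral_generation, ← ENNReal.tsum_mul_left]
    refine ENNReal.tsum_le_tsum fun u => ?_
    split_ifs
    · rw [mul_one]
      refine le_trans (le_of_eq ?_) (hM u).lintegral_fst_le
      have hev : Measurable fun b : List ℕ → ℕ × (ℕ → ℝ) => b u := measurable_pi_apply u
      conv_rhs => rw [← Measure.infinitePi_map_eval M u]
      exact (lintegral_map (f := fun a : ℕ × (ℕ → ℝ) => (a.1 : ℝ≥0∞)) (by fun_prop) hev).symm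
    · simp
  · refine Measurable.aemeasurable ?_
    split_ifs
    · fun_prop
    · fun_prop

/-- A subcritical cluster is almost surely finite. -/
lemma ae_cluster_univ_lt_top (hh : IsOffspringDensity h) (hM : ∀ u, IsPoissonData h (M u))
    (t : ℝ) : ∀ᵐ d ∂Measure.infinitePi M, cluster d t univ < ⊤ := by
  set c := ENNReal.ofReal (∫ s in Ioi (0 : ℝ), h s)
  have hc : c < 1 := by
    rw [← ENNReal.ofReal_one]
    exact (ENNReal.ofReal_lt_ofReal_iff one_pos).2 hh.integral_lt_one
  have hn : ∀ n, ∫⁻ d, generation d t n univ ∂Measure.infinitePi M ≤ c ^ n := by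
    intro n
    induction n with
    | zero => simp [generation]
    | succ n ih =>
      refine (lintegral_generation_univ_succ hM t n).trans ?_
      rw [pow_succ']
      gcongr
  have hcl : ∀ d, cluster d t univ = ∑' n, generation d t n univ := fun d => by
    rw [cluster, Measure.sum_apply _ MeasurableSet.univ]
  simp only [hcl]
  refine ae_lt_top (Measurable.tsum fun n => measurable_generation_univ t n) ?_
  rw [lintegral_tsum fun n => (measurable_generation_univ t n).aemeasurable]
  refine ((ENNReal.tsum_le_tsum hn).trans_lt ?_).ne
  rw [ENNReal.tsum_geometric]
  exact ENNReal.inv_lt_top.2 (tsub_pos_of_lt hc)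

/-- Moving the immigrant does not change who is alive. Finiteness at one centre thus gives it
simultaneously at all centres, in particular at a random epoch. -/
lemma cluster_univ_eq (d : List ℕ → ℕ × (ℕ → ℝ)) (s t : ℝ) :
    cluster d s univ = cluster d t univ := by
  rw [← lintegral_one, lintegral_cluster, ← lintegral_one, lintegral_cluster]

lemma le_time {d : List ℕ → ℕ × (ℕ → ℝ)} (hd : ∀ u, ∀ j < (d u).1, 0 ≤ (d u).2 j) (t : ℝ) :
    ∀ u, Alive d u → t ≤ time d t u
  | [], _ => le_rfl
  | j :: u, h => (le_time hd t u h.1).trans (le_add_of_nonneg_right (hd u j h.2))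

lemma cluster_Iio_eq_zero {d : List ℕ → ℕ × (ℕ → ℝ)}
    (hd : ∀ u, ∀ j < (d u).1, 0 ≤ (d u).2 j) (t : ℝ) : cluster d t (Iio t) = 0 := by
  classical
  rw [← lintegral_indicator_one measurableSet_Iio, lintegral_cluster]
  refine ENNReal.tsum_eq_zero.2 fun u => ?_
  split_ifs with hu
  · simp [indicator, not_lt.2 (le_time hd t u hu)]
  · rfl

end totals

/-! ### The input of the renewal Hawkes process -/

/-- The partial sums of a sequence. -/
def partialSum (x : ℕ → ℝ) (n : ℕ) : ℝ := ∑ k ∈ Finset.range (n + 1), x k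

lemma epoch_eq {Ω : Type*} (T : ℕ → Ω → ℝ) (n : ℕ) (ω : Ω) :
    epoch T n ω = partialSum (fun k => T k ω) n := rfl

lemma measurable_partialSum (n : ℕ) : Measurable fun x => partialSum x n := by
  unfold partialSum
  fun_prop

lemma lintegral_centre {Ω : Type*} (T : ℕ → Ω → ℝ) (ω : Ω) (ψ : ℝ → ℝ≥0∞) :
    ∫⁻ x, ψ x ∂centre T ω = ∑' n, ψ (epoch T n ω) := by
  simp [centre]

section input

variable {Ω : Type*} [MeasurableSpace Ω] {P : Measure Ω} {f h : ℝ → ℝ}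
  {T : ℕ → Ω → ℝ} {D : ℕ × List ℕ → Ω → ℕ × (ℕ → ℝ)}

lemma IsInput.map_wait (hTD : IsInput P f h T D) :
    P.map (fun ω n => T n ω) = Measure.infinitePi fun n => P.map (T n) :=
  hTD.indep_wait.map_fun_eq_infinitePi_map hTD.measurable_wait

lemma IsInput.map_data (hTD : IsInput P f h T D) :
    P.map (fun ω p => D p ω) = Measure.infinitePi fun p => P.map (D p) :=
  hTD.indep_data.map_fun_eq_infinitePi_map hTD.measurable_data

lemma IsInput.map_data_comp (hTD : IsInput P f h T D) {κ : Type*} {e : κ → ℕ × List ℕ}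
    (he : Function.Injective e) :
    P.map (fun ω k => D (e k) ω) = Measure.infinitePi fun k => P.map (D (e k)) :=
  (hTD.indep_data.precomp he).map_fun_eq_infinitePi_map fun k => hTD.measurable_data (e k)

variable [IsProbabilityMeasure P]

/-- The p.g.fl. of a satellite process extends from `Ξ` to all measurable `w : ℝ → [0,1]`. -/
lemma IsInput.isPoissonData (hTD : IsInput P f h T D) (hh : IsOffspringDensity h) (p : ℕ × List ℕ) :
    IsPoissonData h (P.map (D p)) := by
  classical
  intro w hw hw'
  -- A function in `Xi` equals 1 off a bounded set, so `w` is cut off to [-n,n] and n → ∞. Constants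
  -- and the indicator of a half line become admissible weights.
  set v : ℕ → ℝ → ℝ := fun n x => if |x| ≤ n then w x else 1
  have hset : ∀ n : ℕ, MeasurableSet {x : ℝ | |x| ≤ n} := fun n =>
    measurableSet_le (by fun_prop) measurable_const
  have hv : ∀ n, Measurable (v n) := fun n => Measurable.ite (hset n) hw measurable_const
  have hv' : ∀ n x, v n x ∈ Icc (0 : ℝ) 1 := fun n x => by
    simp only [v]
    split_ifs
    · exact hw' x
    · simp
  have hvXi : ∀ n, v n ∈ Xi := fun n => by
    refine ⟨hv n, hv' n, Metric.closedBall 0 n, Metric.isBounded_closedBall, fun x hx => ?_⟩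
    simp only [Metric.mem_closedBall, dist_zero_right, Real.norm_eq_abs] at hx
    simp [v, hx]
  have hvlim : ∀ x, ∀ᶠ n in atTop, v n x = w x := fun x => by
    obtain ⟨N, hN⟩ := exists_nat_ge |x|
    filter_upwards [eventually_ge_atTop N] with n hn
    simp [v, hN.trans (Nat.cast_le.2 hn)]
  have hmeas : Measurable fun a => expNeg (∫⁻ y, negLog (w y) ∂satellite a 0) :=
    measurable_expNeg.comp (measurable_lintegral_satellite (measurable_negLog.comp hw) 0)
  rw [integral_map_of_stronglyMeasurable (hTD.measurable_data p) hmeas.stronglyMeasurable]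
  have h1 : Tendsto (fun n => ∫ ω, expNeg (∫⁻ y, negLog (v n y) ∂satellite (D p ω) 0) ∂P) atTop
      (𝓝 (∫ ω, expNeg (∫⁻ y, negLog (w y) ∂satellite (D p ω) 0) ∂P)) := by
    refine tendsto_integral_expNeg (fun n => (measurable_lintegral_satellite
      (measurable_negLog.comp (hv n)) 0).comp (hTD.measurable_data p)) fun ω => ?_
    simp only [lintegral_satellite]
    refine tendsto_finsetSum _ fun j _ => tendsto_const_nhds.congr' ?_
    filter_upwards [hvlim (0 + (D p ω).2 j)] with n hn
    rw [hn]
  have h2 : Tendsto (fun n => Real.exp (∫ s in Ioi (0 : ℝ), (v n s - 1) * h s)) atTop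
      (𝓝 (Real.exp (∫ s in Ioi (0 : ℝ), (w s - 1) * h s))) := by
    refine (Real.continuous_exp.tendsto _).comp ?_
    refine tendsto_integral_of_dominated_convergence (fun s => |h s|)
      (fun n => (integrableOn_sub_one_mul hh (hv n) (hv' n)).aestronglyMeasurable)
      hh.integrable.abs (fun n => Eventually.of_forall fun s => ?_)
      (Eventually.of_forall fun s => ?_)
    · rw [Real.norm_eq_abs, abs_mul]
      refine mul_le_of_le_one_left (abs_nonneg _) ?_
      rw [abs_le]
      constructor <;> linarith [(hv' n s).1, (hv' n s).2]
    · refine tendsto_const_nhds.congr' ?_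
      filter_upwards [hvlim s] with n hn
      rw [hn]
  have h3 : ∀ n, ∫ ω, expNeg (∫⁻ y, negLog (v n y) ∂satellite (D p ω) 0) ∂P =
      Real.exp (∫ s in Ioi (0 : ℝ), (v n s - 1) * h s) := fun n => hTD.poisson p _ (hvXi n)
  simp only [h3] at h1
  exact tendsto_nhds_unique h1 h2

lemma IsInput.isProbabilityMeasure_data (hTD : IsInput P f h T D) (p : ℕ × List ℕ) : IsProbabilityMeasure (P.map (D p)) :=
  Measure.isProbabilityMeasure_map (hTD.measurable_data p).aemeasurable

lemma IsInput.isProbabilityMeasure_wait (hTD : IsInput P f h T D) (n : ℕ) : IsProbabilityMeasure (P.map (T n)) :=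
  Measure.isProbabilityMeasure_map (hTD.measurable_wait n).aemeasurable

lemma IsInput.clusterPgfl_eq (hTD : IsInput P f h T D) (hh : IsOffspringDensity h) {z : ℝ → ℝ} (hz : Measurable z)
    (hz' : ∀ x, z x ∈ Icc (0 : ℝ) 1) (t : ℝ) :
    clusterPgfl P D z t = expNeg (clusterExponent h z t) := by
  have _ p := hTD.isProbabilityMeasure_data p
  have he : Function.Injective fun p : Unit × List ℕ => ((0 : ℕ), p.2) := by
    rintro ⟨_, u⟩ ⟨_, v⟩ h
    simpa using h
  have key := integral_expNeg_forestSum (ι := Unit) hh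
    (M := fun p : Unit × List ℕ => P.map (D (0, p.2)))
    (fun p => hTD.isPoissonData hh _) hz hz' (fun _ => t)
  have hm : Measurable fun d : Unit × List ℕ → ℕ × (ℕ → ℝ) =>
      expNeg (forestSum (fun _ x => negLog (z x)) (fun _ => t) d) :=
    measurable_expNeg.comp (measurable_forestSum (fun _ => measurable_negLog.comp hz) _)
  rw [← hTD.map_data_comp he, integral_map_of_stronglyMeasurable
    (measurable_pi_lambda _ fun p => hTD.measurable_data _) hm.stronglyMeasurable] at key
  simpa [clusterPgfl, pgfl, forestSum_eq_tsum_cluster] using key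

/-- Waiting times and cluster data have a product law; by Fubini the epochs may be frozen, and the
forest formula applies to them as fixed centres. -/
lemma IsInput.pgfl_process_eq (hTD : IsInput P f h T D) (hh : IsOffspringDensity h) {z : ℝ → ℝ} (hz : Measurable z)
    (hz' : ∀ x, z x ∈ Icc (0 : ℝ) 1) :
    pgfl P (process T D) z = pgfl P (centre T) (clusterPgfl P D z) := by
  have _ p := hTD.isProbabilityMeasure_data p
  have hT : Measurable fun ω n => T n ω := measurable_pi_lambda _ hTD.measurable_wait
  have hD : Measurable fun ω p => D p ω := measurable_pi_lambda _ hTD.measurable_data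
  have hmap : P.map (fun ω => ((fun n => T n ω), fun p => D p ω)) =
      (P.map fun ω n => T n ω).prod (P.map fun ω p => D p ω) :=
    (indepFun_iff_map_prod_eq_prod_map_map hT.aemeasurable hD.aemeasurable).1 hTD.indep
  have _ : IsProbabilityMeasure (P.map fun ω n => T n ω) :=
    Measure.isProbabilityMeasure_map hT.aemeasurable
  have _ : IsProbabilityMeasure (P.map fun ω p => D p ω) :=
    Measure.isProbabilityMeasure_map hD.aemeasurable
  set F : (ℕ → ℝ) × (ℕ × List ℕ → ℕ × (ℕ → ℝ)) → ℝ≥0∞ := fun q =>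
    forestSum (fun _ x => negLog (z x)) (partialSum q.1) q.2
  have hF : Measurable F := by
    have h1 : Measurable fun q : (ℕ → ℝ) × (ℕ × List ℕ → ℕ × (ℕ → ℝ)) =>
        (partialSum q.1, q.2) :=
      (measurable_pi_lambda _ fun n => (measurable_partialSum n).comp measurable_fst).prodMk
        measurable_snd
    exact (measurable_forestSum_prod (fun _ => measurable_negLog.comp hz)).comp h1
  have hL : pgfl P (process T D) z = ∫ ω, expNeg (F ((fun n => T n ω), fun p => D p ω)) ∂P := by
    simp only [pgfl, process, lintegral_sum_measure, F, forestSum_eq_tsum_cluster, epoch_eq]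
  have hR : pgfl P (centre T) (clusterPgfl P D z) =
      ∫ x, expNeg (∑' i, clusterExponent h z (partialSum x i)) ∂P.map fun ω n => T n ω := by
    have hm : Measurable fun x => expNeg (∑' i, clusterExponent h z (partialSum x i)) :=
      measurable_expNeg.comp (Measurable.tsum fun i =>
        (measurable_clusterExponent hh hz).comp (measurable_partialSum i))
    rw [integral_map_of_stronglyMeasurable hT hm.stronglyMeasurable]
    simp only [pgfl, lintegral_centre, hTD.clusterPgfl_eq hh hz hz', negLog_expNeg, epoch_eq]
  have hmain : ∫ ω, expNeg (F ((fun n => T n ω), fun p => D p ω)) ∂P =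
      ∫ q, expNeg (F q) ∂P.map (fun ω => ((fun n => T n ω), fun p => D p ω)) :=
    (integral_map_of_stronglyMeasurable (hT.prodMk hD)
      (measurable_expNeg.comp hF).stronglyMeasurable).symm
  rw [hL, hR, hmain, hmap, integral_prod _ (integrable_expNeg hF)]
  congr 1 with x
  rw [hTD.map_data]
  exact integral_expNeg_forestSum hh (fun p => hTD.isPoissonData hh p) hz hz' (partialSum x)

lemma IsInput.ae_cluster_univ_lt_top (hTD : IsInput P f h T D) (hh : IsOffspringDensity h) :
    ∀ᵐ ω ∂P, ∀ i t, cluster (fun u => D (i, u) ω) t univ < ⊤ := by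
  have _ p := hTD.isProbabilityMeasure_data p
  rw [ae_all_iff]
  intro i
  have he : Function.Injective fun u : List ℕ => (i, u) := fun u v h => by simpa using h
  have h1 := RenewalHawkes.ae_cluster_univ_lt_top hh (M := fun u => P.map (D (i, u)))
    (fun u => hTD.isPoissonData hh _) 0
  rw [← hTD.map_data_comp he] at h1
  have h2 := ae_of_ae_map
    (measurable_pi_lambda _ fun u => hTD.measurable_data (i, u)).aemeasurable h1
  filter_upwards [h2] with ω hω t
  rwa [cluster_univ_eq _ t 0]

lemma IsInput.ae_data_nonneg (hTD : IsInput P f h T D) (hh : IsOffspringDensity h) :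
    ∀ᵐ ω ∂P, ∀ p, ∀ j < (D p ω).1, 0 ≤ (D p ω).2 j := by
  have _ p := hTD.isProbabilityMeasure_data p
  rw [ae_all_iff]
  intro p
  exact ae_of_ae_map (hTD.measurable_data p).aemeasurable (hTD.isPoissonData hh p).ae_nonneg

/-- Local finiteness, given that the centres do not accumulate. -/
lemma IsInput.ae_process_lt_top (hTD : IsInput P f h T D) (hh : IsOffspringDensity h)
    (hT : ∀ᵐ ω ∂P, ∀ R : ℝ, {i | epoch T i ω ≤ R}.Finite) :
    ∀ᵐ ω ∂P, ∀ B : Set ℝ, Bornology.IsBounded B → process T D ω B < ⊤ := by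
  filter_upwards [hT, hTD.ae_cluster_univ_lt_top hh, hTD.ae_data_nonneg hh] with ω h1 h2 h3 B hB
  obtain ⟨R, hR⟩ := hB.bddAbove
  refine (measure_mono fun x hx => mem_Iic.2 (hR hx)).trans_lt (b := process T D ω (Iic R)) ?_
  -- No individual precedes its immigrant, so only the finitely many clusters centred at or before R
  -- charge (-∞,R].
  rw [process, Measure.sum_apply _ measurableSet_Iic,
    tsum_eq_sum (s := (h1 R).toFinset) fun i hi => ?_]
  · exact ENNReal.sum_lt_top.2 fun i _ => (measure_mono (subset_univ _)).trans_lt (h2 i _)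
  · have hi' : R < epoch T i ω := by simpa using hi
    exact measure_mono_null (fun x hx => lt_of_le_of_lt hx hi')
      (cluster_Iio_eq_zero (fun u => h3 (i, u)) _)

end input

/-! ### The translation operator of the waiting time distribution -/

/-- `(K χ)(t) = 𝔼[χ (t + τ)]`, where `τ` has law `ρ`. -/
def shiftOp (ρ : Measure ℝ) (χ : ℝ → ℝ≥0∞) (t : ℝ) : ℝ≥0∞ := ∫⁻ s, χ (t + s) ∂ρ

/-- The weight `t ↦ exp (-λ t)`. -/
def expWeight (l t : ℝ) : ℝ≥0∞ := ENNReal.ofReal (Real.exp (-(l * t)))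

lemma measurable_expWeight (l : ℝ) : Measurable (expWeight l) := by
  unfold expWeight
  fun_prop

lemma expWeight_add (l s t : ℝ) : expWeight l (s + t) = expWeight l s * expWeight l t := by
  rw [expWeight, expWeight, expWeight, ← ENNReal.ofReal_mul (Real.exp_nonneg _), ← Real.exp_add]
  ring_nf

lemma expWeight_ne_top (l t : ℝ) : expWeight l t ≠ ⊤ := ENNReal.ofReal_ne_top

lemma shiftOp_const_mul (ρ : Measure ℝ) (a : ℝ≥0∞) {χ : ℝ → ℝ≥0∞} (hχ : Measurable χ) :
    shiftOp ρ (fun t => a * χ t) = fun t => a * shiftOp ρ χ t :=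
  funext fun _ => lintegral_const_mul _ (by fun_prop)

/-- Exponentials are eigenfunctions of the translation operator, the eigenvalue being the Laplace
transform of ρ at l. -/
lemma iterate_shiftOp_expWeight (ρ : Measure ℝ) (l : ℝ) (n : ℕ) :
    (shiftOp ρ)^[n] (expWeight l) = fun t => (∫⁻ s, expWeight l s ∂ρ) ^ n * expWeight l t := by
  induction n with
  | zero => simp
  | succ n ih =>
    rw [Function.iterate_succ_apply', ih, shiftOp_const_mul _ _ (measurable_expWeight l)]
    funext t
    simp only [shiftOp, expWeight_add]
    rw [lintegral_const_mul _ (measurable_expWeight l), pow_succ]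
    ring

section shift

variable {ρ : Measure ℝ} [SFinite ρ]

lemma measurable_shiftOp {χ : ℝ → ℝ≥0∞} (hχ : Measurable χ) : Measurable (shiftOp ρ χ) := by
  have : Measurable fun q : ℝ × ℝ => χ (q.1 + q.2) := by fun_prop
  exact this.lintegral_prod_right'

lemma measurable_iterate_shiftOp {χ : ℝ → ℝ≥0∞} (hχ : Measurable χ) (n : ℕ) :
    Measurable ((shiftOp ρ)^[n] χ) := by
  induction n with
  | zero => exact hχ
  | succ n ih => rw [Function.iterate_succ_apply']; exact measurable_shiftOp ih

lemma shiftOp_mono (ρ : Measure ℝ) {χ ψ : ℝ → ℝ≥0∞} (h : χ ≤ ψ) : shiftOp ρ χ ≤ shiftOp ρ ψ :=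
  fun _ => lintegral_mono fun _ => h _

lemma iterate_shiftOp_mono (ρ : Measure ℝ) {χ ψ : ℝ → ℝ≥0∞} (h : χ ≤ ψ) (n : ℕ) :
    (shiftOp ρ)^[n] χ ≤ (shiftOp ρ)^[n] ψ :=
  Monotone.iterate (fun _ _ => shiftOp_mono ρ) n h

lemma iterate_shiftOp_const_mul (a : ℝ≥0∞) {χ : ℝ → ℝ≥0∞} (hχ : Measurable χ) (n : ℕ) :
    (shiftOp ρ)^[n] (fun t => a * χ t) = fun t => a * (shiftOp ρ)^[n] χ t := by
  induction n with
  | zero => rfl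
  | succ n ih =>
    rw [Function.iterate_succ_apply', ih, shiftOp_const_mul _ _ (measurable_iterate_shiftOp hχ n),
      Function.iterate_succ_apply']

end shift

/-- A probability law on `(0,∞)` without atoms. -/
structure IsWaitingLaw (ρ : Measure ℝ) : Prop where
  isProbabilityMeasure : IsProbabilityMeasure ρ
  noAtoms : NullSingletonClass ρ
  pos : ∀ᵐ s ∂ρ, 0 < s

/-- The law of the stationary delay, with density `m ρ((t,∞))`. -/
def delayLaw (m : ℝ≥0∞) (ρ : Measure ℝ) : Measure ℝ :=
  (volume.restrict (Ioi 0)).withDensity fun t => m * ρ (Ioi t)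

lemma measurable_measure_Ioi (ρ : Measure ℝ) : Measurable fun t => ρ (Ioi t) :=
  Antitone.measurable fun _ _ hst => measure_mono (Ioi_subset_Ioi hst)

lemma lintegral_delayLaw (m : ℝ≥0∞) (ρ : Measure ℝ) {χ : ℝ → ℝ≥0∞} (hχ : Measurable χ) :
    ∫⁻ t, χ t ∂delayLaw m ρ = m * ∫⁻ t in Ioi 0, ρ (Ioi t) * χ t := by
  have h1 : Measurable fun t => ρ (Ioi t) * χ t := (measurable_measure_Ioi ρ).mul hχ
  rw [delayLaw, lintegral_withDensity_eq_lintegral_mul _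
    ((measurable_measure_Ioi ρ).const_mul m) hχ, ← lintegral_const_mul _ h1]
  simp only [Pi.mul_apply, mul_assoc]

lemma delayLaw_pos (m : ℝ≥0∞) (ρ : Measure ℝ) : ∀ᵐ t ∂delayLaw m ρ, 0 < t :=
  (withDensity_absolutelyContinuous _ _).ae_le (ae_restrict_mem measurableSet_Ioi)

namespace IsWaitingLaw

variable {ρ : Measure ℝ}

/-- A point t is reached from the positive starting point t - s exactly when s < t. The resulting
density ρ((-∞,t]) complements the tail in the law of the delay. -/
lemma lintegral_shiftOp_Ioi (hρ : IsWaitingLaw ρ) {χ : ℝ → ℝ≥0∞} (hχ : Measurable χ) :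
    ∫⁻ t in Ioi 0, shiftOp ρ χ t = ∫⁻ t in Ioi 0, ρ (Iic t) * χ t := by
  have := hρ.isProbabilityMeasure
  have := hρ.noAtoms
  have hind : Measurable fun q : ℝ × ℝ => (Ioi q.2).indicator χ q.1 := by
    have : (fun q : ℝ × ℝ => (Ioi q.2).indicator χ q.1) =
        {q : ℝ × ℝ | q.2 < q.1}.indicator fun q => χ q.1 := by
      ext q; simp [indicator]
    rw [this]
    exact (hχ.comp measurable_fst).indicator (measurableSet_lt measurable_snd measurable_fst)
  calc ∫⁻ t in Ioi 0, shiftOp ρ χ t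
      = ∫⁻ s, (∫⁻ t in Ioi 0, χ (t + s)) ∂ρ :=
        lintegral_lintegral_swap (by fun_prop)
    _ = ∫⁻ s, (∫⁻ t, (Ioi s).indicator χ t) ∂ρ := by
        refine lintegral_congr fun s => ?_
        rw [← lintegral_indicator measurableSet_Ioi, ← lintegral_add_right_eq_self
          (fun t => (Ioi s).indicator χ t) s]
        refine lintegral_congr fun t => ?_
        simp [indicator]
    _ = ∫⁻ t, ∫⁻ s, (Ioi s).indicator χ t ∂ρ := (lintegral_lintegral_swap hind.aemeasurable).symm
    _ = ∫⁻ t, ρ (Iic t) * χ t := by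
        refine lintegral_congr fun t => ?_
        have : ∀ s, (Ioi s).indicator χ t = (Iio t).indicator (fun _ => χ t) s := fun s => by
          simp [indicator]
        simp only [this]
        rw [lintegral_indicator_const measurableSet_Iio, mul_comm, measure_congr Iio_ae_eq_Iic]
    _ = ∫⁻ t in Ioi 0, ρ (Iic t) * χ t := by
        rw [← lintegral_indicator measurableSet_Ioi]
        refine lintegral_congr fun t => ?_
        by_cases ht : 0 < t
        · simp [indicator, ht]
        · have : ρ (Iic t) = 0 := by
            refine measure_mono_null (fun s hs => ?_) (ae_iff.1 hρ.pos)
            simp only [mem_Iic] at hs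
            simp only [not_lt] at ht ⊢
            exact hs.trans ht
          simp [this, ht]

/-- The balance equation of the stationary delay. -/
lemma lintegral_delayLaw_add (hρ : IsWaitingLaw ρ) (m : ℝ≥0∞) {χ : ℝ → ℝ≥0∞}
    (hχ : Measurable χ) :
    ∫⁻ t, χ t ∂delayLaw m ρ + m * ∫⁻ t in Ioi 0, shiftOp ρ χ t = m * ∫⁻ t in Ioi 0, χ t := by
  have := hρ.isProbabilityMeasure
  have h1 : Measurable fun t => ρ (Ioi t) * χ t := (measurable_measure_Ioi ρ).mul hχ
  -- The two densities add up to m, because ρ((t,∞)) + ρ((-∞,t]) = 1.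
  rw [lintegral_delayLaw m ρ hχ, hρ.lintegral_shiftOp_Ioi hχ, ← mul_add, ← lintegral_add_left h1]
  congr 2 with t
  rw [← add_mul, add_comm, ← measure_union (Iic_disjoint_Ioi le_rfl) measurableSet_Ioi,
    Iic_union_Ioi, measure_univ, one_mul]

/-- The balance equation, applied to each iterate K^n χ, telescopes. -/
lemma sum_lintegral_delayLaw_add (hρ : IsWaitingLaw ρ) (m : ℝ≥0∞) {χ : ℝ → ℝ≥0∞}
    (hχ : Measurable χ) (N : ℕ) :
    ∑ n ∈ Finset.range N, ∫⁻ t, (shiftOp ρ)^[n] χ t ∂delayLaw m ρ +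
      m * ∫⁻ t in Ioi 0, (shiftOp ρ)^[N] χ t = m * ∫⁻ t in Ioi 0, χ t := by
  have := hρ.isProbabilityMeasure
  induction N with
  | zero => simp
  | succ N ih =>
    rw [Finset.sum_range_succ, add_assoc, Function.iterate_succ_apply',
      hρ.lintegral_delayLaw_add m (measurable_iterate_shiftOp hχ N), ih]

lemma lintegral_expWeight_lt_one (hρ : IsWaitingLaw ρ) {l : ℝ} (hl : 0 < l) :
    ∫⁻ s, expWeight l s ∂ρ < 1 := by
  have := hρ.isProbabilityMeasure
  have h1 : ∫⁻ s, expWeight l s ∂ρ < ∫⁻ _, 1 ∂ρ := by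
    refine lintegral_strict_mono (NeZero.ne ρ) aemeasurable_const ?_ ?_
    · refine ne_top_of_le_ne_top (b := ∫⁻ _, 1 ∂ρ) (by simp) (lintegral_mono_ae ?_)
      filter_upwards [hρ.pos] with s hs
      rw [expWeight, ← ENNReal.ofReal_one]
      exact ENNReal.ofReal_le_ofReal (Real.exp_le_one_iff.2 (by nlinarith))
    · filter_upwards [hρ.pos] with s hs
      rw [expWeight, ← ENNReal.ofReal_one]
      exact (ENNReal.ofReal_lt_ofReal_iff one_pos).2 (Real.exp_lt_one_iff.2 (by nlinarith))
  simpa using h1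

lemma exists_lintegral_expWeight_lt (hρ : IsWaitingLaw ρ) {ε : ℝ≥0∞} (hε : 0 < ε) :
    ∃ l : ℝ, 0 < l ∧ ∫⁻ s, expWeight l s ∂ρ < ε := by
  have := hρ.isProbabilityMeasure
  have h1 : Tendsto (fun n : ℕ => ∫⁻ s, expWeight n s ∂ρ) atTop (𝓝 (∫⁻ _, 0 ∂ρ)) := by
    refine tendsto_lintegral_of_dominated_convergence (fun _ => 1)
      (fun n => measurable_expWeight n) (fun n => ?_) (by simp) ?_
    · filter_upwards [hρ.pos] with s hs
      rw [expWeight, ← ENNReal.ofReal_one]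
      exact ENNReal.ofReal_le_ofReal (Real.exp_le_one_iff.2 (neg_nonpos.2 (by positivity)))
    · filter_upwards [hρ.pos] with s hs
      rw [← ENNReal.ofReal_zero]
      refine ENNReal.tendsto_ofReal (Real.tendsto_exp_neg_atTop_nhds_zero.comp ?_)
      exact tendsto_natCast_atTop_atTop.atTop_mul_const hs
  rw [lintegral_zero] at h1
  obtain ⟨n, hn, hn'⟩ := ((h1.eventually_lt_const hε).and (eventually_gt_atTop 0)).exists
  exact ⟨n, by exact_mod_cast hn', hn⟩

lemma lintegral_expWeight_Ioi_ne_top {l : ℝ} (hl : 0 < l) :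
    ∫⁻ t in Ioi 0, expWeight l t ≠ ⊤ := by
  have h := exp_neg_integrableOn_Ioi 0 hl
  have h2 := h.lintegral_lt_top
  simpa [expWeight, neg_mul] using h2.ne

/-- The renewal measure of the stationary renewal process is `m dt`. -/
lemma tsum_lintegral_delayLaw (hρ : IsWaitingLaw ρ) {m : ℝ≥0∞} (hm : m ≠ ⊤) {χ : ℝ → ℝ≥0∞}
    (hχ : Measurable χ) {l : ℝ} (hl : 0 < l) {C : ℝ≥0∞} (hC : C ≠ ⊤)
    (hb : ∀ t, χ t ≤ C * expWeight l t) :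
    ∑' n, ∫⁻ t, (shiftOp ρ)^[n] χ t ∂delayLaw m ρ = m * ∫⁻ t in Ioi 0, χ t := by
  have := hρ.isProbabilityMeasure
  set q := ∫⁻ s, expWeight l s ∂ρ
  set I := ∫⁻ t in Ioi 0, expWeight l t
  have hI : I ≠ ⊤ := lintegral_expWeight_Ioi_ne_top hl
  -- The remainder of the telescoped balance decays geometrically, since q < 1.
  have hbound : ∀ N, m * ∫⁻ t in Ioi 0, (shiftOp ρ)^[N] χ t ≤ q ^ N * (m * C * I) := by
    intro N
    have h1 : (shiftOp ρ)^[N] χ ≤ fun t => C * (q ^ N * expWeight l t) := by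
      have := iterate_shiftOp_mono ρ (show χ ≤ fun t => C * expWeight l t from hb) N
      rwa [iterate_shiftOp_const_mul C (measurable_expWeight l), iterate_shiftOp_expWeight] at this
    calc m * ∫⁻ t in Ioi 0, (shiftOp ρ)^[N] χ t
        ≤ m * ∫⁻ t in Ioi 0, C * (q ^ N * expWeight l t) := by
          gcongr with t; exact h1 t
      _ = q ^ N * (m * C * I) := by
          rw [lintegral_const_mul _ ((measurable_expWeight l).const_mul _),
            lintegral_const_mul _ (measurable_expWeight l)]
          ring
  have h0 : Tendsto (fun N => m * ∫⁻ t in Ioi 0, (shiftOp ρ)^[N] χ t) atTop (𝓝 0) := by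
    refine tendsto_of_tendsto_of_tendsto_of_le_of_le tendsto_const_nhds ?_ (fun _ => zero_le)
      hbound
    have := ENNReal.Tendsto.mul_const (b := m * C * I)
      (ENNReal.tendsto_pow_atTop_nhds_zero_of_lt_one (hρ.lintegral_expWeight_lt_one hl))
      (Or.inr (ENNReal.mul_ne_top (ENNReal.mul_ne_top hm hC) hI))
    simpa using this
  have h1 := (ENNReal.summable (f := fun n =>
    ∫⁻ t, (shiftOp ρ)^[n] χ t ∂delayLaw m ρ)).hasSum.tendsto_sum_nat.add h0
  simp only [hρ.sum_lintegral_delayLaw_add m hχ, add_zero] at h1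
  exact (tendsto_nhds_unique tendsto_const_nhds h1).symm

end IsWaitingLaw

/-! ### The alternating renewal series -/

/-- `renewalTerm ρ g k` is `b_k`, where `b_0 = 1` and `b_{k+1} = ∑_{n ≥ 1} K^n (g b_k)`. -/
def renewalTerm (ρ : Measure ℝ) (g : ℝ → ℝ≥0∞) : ℕ → ℝ → ℝ≥0∞
  | 0 => fun _ => 1
  | k + 1 => fun t => ∑' n, (shiftOp ρ)^[n + 1] (fun s => g s * renewalTerm ρ g k s) t

/-- The alternating series `∑ (-1)^k b_k`. -/
def renewalSeries (ρ : Measure ℝ) (g : ℝ → ℝ≥0∞) (t : ℝ) : ℝ :=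
  ∑' k, (-1 : ℝ) ^ k * (renewalTerm ρ g k t).toReal

lemma measurable_renewalTerm {ρ : Measure ℝ} [SFinite ρ] {g : ℝ → ℝ≥0∞} (hg : Measurable g) :
    ∀ k, Measurable (renewalTerm ρ g k)
  | 0 => measurable_const
  | k + 1 => Measurable.tsum fun n =>
      measurable_iterate_shiftOp (hg.mul (measurable_renewalTerm hg k)) (n + 1)

lemma shiftOp_tsum {ρ : Measure ℝ} {χ : ℕ → ℝ → ℝ≥0∞} (hχ : ∀ n, Measurable (χ n)) (t : ℝ) :
    shiftOp ρ (fun s => ∑' n, χ n s) t = ∑' n, shiftOp ρ (χ n) t :=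
  lintegral_tsum fun n => ((hχ n).comp (measurable_const_add t)).aemeasurable

/-- If b = ∑_{n≥1} K^n c, then b = K(c + b), by separating the first jump. Summed with alternating
signs, this is the renewal equation. -/
lemma renewalTerm_succ {ρ : Measure ℝ} [SFinite ρ] {g : ℝ → ℝ≥0∞} (hg : Measurable g) (k : ℕ)
    (t : ℝ) : renewalTerm ρ g (k + 1) t =
      ∫⁻ s, (g (t + s) * renewalTerm ρ g k (t + s) + renewalTerm ρ g (k + 1) (t + s)) ∂ρ := by
  have hm : Measurable fun s => g s * renewalTerm ρ g k s :=
    hg.mul (measurable_renewalTerm (ρ := ρ) hg k)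
  rw [lintegral_add_left (by exact hm.comp (measurable_const_add t))]
  change _ = _ + shiftOp ρ (fun s => ∑' n, (shiftOp ρ)^[n + 1] _ s) t
  rw [shiftOp_tsum fun n => measurable_iterate_shiftOp hm (n + 1), renewalTerm]
  refine (tsum_eq_zero_add' (f := fun n => (shiftOp ρ)^[n + 1]
    (fun s => g s * renewalTerm ρ g k s) t) ENNReal.summable).trans ?_
  congr 1
  refine tsum_congr fun n => ?_
  rw [Function.iterate_succ_apply' _ (n + 1)]

/-- The standing assumptions on the geometric rate of the renewal series. -/
structure IsRenewalWeight (ρ : Measure ℝ) (g : ℝ → ℝ≥0∞) (l : ℝ) (C : ℝ≥0∞) : Prop where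
  law : IsWaitingLaw ρ
  measurable : Measurable g
  le_one : ∀ t, g t ≤ 1
  le_weight : ∀ t, g t ≤ C * expWeight l t
  pos : 0 < l
  ne_top : C ≠ ⊤
  small : ∫⁻ s, expWeight l s ∂ρ < 1 / 4

namespace IsRenewalWeight

variable {ρ : Measure ℝ} {g : ℝ → ℝ≥0∞} {l : ℝ} {C : ℝ≥0∞}

/-- With q ≤ 1/4, the crude bound q^(n+1) ≤ (1/4) 2^{-n} sums to 1/2: the renewal operator halves
any exponential bound. -/
lemma tsum_iterate_le (hW : IsRenewalWeight ρ g l C) (a : ℝ≥0∞) {χ : ℝ → ℝ≥0∞}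
    (hχ : ∀ t, χ t ≤ a * expWeight l t) (t : ℝ) :
    ∑' n, (shiftOp ρ)^[n + 1] χ t ≤ 1 / 2 * a * expWeight l t := by
  have := hW.law.isProbabilityMeasure
  set q := ∫⁻ s, expWeight l s ∂ρ
  have h1 : ∀ n, (shiftOp ρ)^[n + 1] χ t ≤ a * (q ^ (n + 1) * expWeight l t) := by
    intro n
    have := iterate_shiftOp_mono ρ (show χ ≤ fun t => a * expWeight l t from hχ) (n + 1)
    rw [iterate_shiftOp_const_mul a (measurable_expWeight l), iterate_shiftOp_expWeight] at this
    exact this t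
  have hq : q ≤ 1 / 4 := hW.small.le
  have hgeo : ∑' n : ℕ, q ^ (n + 1) ≤ 1 / 2 := by
    calc ∑' n : ℕ, q ^ (n + 1) ≤ ∑' n : ℕ, 1 / 4 * 2⁻¹ ^ n := by
          refine ENNReal.tsum_le_tsum fun n => ?_
          rw [pow_succ']
          gcongr
          refine hq.trans ?_
          rw [one_div]
          exact ENNReal.inv_le_inv.2 (by norm_num)
      _ = 1 / 4 * 2 := by
          rw [ENNReal.tsum_mul_left, ENNReal.tsum_geometric, ENNReal.one_sub_inv_two, inv_inv]
      _ ≤ 1 / 2 := by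
          rw [show (1 / 4 : ℝ≥0∞) = ENNReal.ofReal (1 / 4) by
              rw [ENNReal.ofReal_div_of_pos (by norm_num)]; simp,
            show (2 : ℝ≥0∞) = ENNReal.ofReal 2 by simp,
            ← ENNReal.ofReal_mul (by norm_num), ← ENNReal.ofReal_one,
            ← ENNReal.ofReal_div_of_pos (by norm_num)]
          norm_num
  calc ∑' n, (shiftOp ρ)^[n + 1] χ t ≤ ∑' n, a * (q ^ (n + 1) * expWeight l t) :=
        ENNReal.tsum_le_tsum h1
    _ = a * ((∑' n, q ^ (n + 1)) * expWeight l t) := by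
        rw [ENNReal.tsum_mul_left, ENNReal.tsum_mul_right]
    _ ≤ a * (1 / 2 * expWeight l t) := by gcongr
    _ = 1 / 2 * a * expWeight l t := by ring

/-- Each step gains a factor 1/2, and g ≤ 1 preserves the weight. A large l thus yields absolute
convergence however long the window on which g lives. -/
lemma renewalTerm_succ_le (hW : IsRenewalWeight ρ g l C) :
    ∀ k t, renewalTerm ρ g (k + 1) t ≤ (1 / 2) ^ (k + 1) * C * expWeight l t
  | 0, t => by
      have := hW.tsum_iterate_le C (χ := fun s => g s * renewalTerm ρ g 0 s)
        (fun s => by simpa [renewalTerm] using hW.le_weight s) t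
      simpa [renewalTerm] using this
  | k + 1, t => by
      have := hW.tsum_iterate_le ((1 / 2) ^ (k + 1) * C)
        (χ := fun s => g s * renewalTerm ρ g (k + 1) s)
        (fun s => (mul_le_of_le_one_left' (hW.le_one s)).trans (hW.renewalTerm_succ_le k s)) t
      rw [renewalTerm, pow_succ' _ (k + 1)]
      refine this.trans (le_of_eq (by ring))

lemma mul_renewalTerm_le (hW : IsRenewalWeight ρ g l C) :
    ∀ k t, g t * renewalTerm ρ g k t ≤ (1 / 2) ^ k * C * expWeight l t
  | 0, t => by simpa [renewalTerm] using hW.le_weight t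
  | k + 1, t => (mul_le_of_le_one_left' (hW.le_one t)).trans (hW.renewalTerm_succ_le k t)

/-- The bound in real numbers. -/
def bound (l : ℝ) (C : ℝ≥0∞) (t : ℝ) : ℝ := C.toReal * (expWeight l t).toReal

lemma bound_nonneg (t : ℝ) : 0 ≤ bound l C t := by
  unfold bound
  positivity

lemma toReal_le (hW : IsRenewalWeight ρ g l C) {x : ℝ≥0∞} {k : ℕ} {t : ℝ}
    (h : x ≤ (1 / 2) ^ k * C * expWeight l t) :
    x ≠ ⊤ ∧ x.toReal ≤ (1 / 2) ^ k * bound l C t := by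
  have hne : (1 / 2) ^ k * C * expWeight l t ≠ ⊤ := by
    refine ENNReal.mul_ne_top (ENNReal.mul_ne_top (ENNReal.pow_ne_top ?_) hW.ne_top)
      (expWeight_ne_top _ _)
    simp
  refine ⟨ne_top_of_le_ne_top hne h, ?_⟩
  have := ENNReal.toReal_mono hne h
  simpa [bound, mul_assoc] using this

lemma renewalTerm_ne_top (hW : IsRenewalWeight ρ g l C) : ∀ k t, renewalTerm ρ g k t ≠ ⊤
  | 0, _ => ENNReal.one_ne_top
  | k + 1, t => (hW.toReal_le (hW.renewalTerm_succ_le k t)).1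

lemma summable_toReal (hW : IsRenewalWeight ρ g l C) (t : ℝ) :
    Summable fun k => (-1 : ℝ) ^ k * (renewalTerm ρ g k t).toReal := by
  rw [← summable_nat_add_iff 1]
  refine Summable.of_norm_bounded (g := fun k => (1 / 2 : ℝ) ^ (k + 1) * bound l C t)
    (((summable_nat_add_iff 1).2 summable_geometric_two).mul_right _) fun k => ?_
  rw [norm_mul, norm_pow, norm_neg, norm_one, one_pow, one_mul,
    Real.norm_of_nonneg ENNReal.toReal_nonneg]
  exact (hW.toReal_le (hW.renewalTerm_succ_le k t)).2

lemma hasSum_succ (hW : IsRenewalWeight ρ g l C) (t : ℝ) :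
    HasSum (fun k => (-1 : ℝ) ^ (k + 1) * (renewalTerm ρ g (k + 1) t).toReal)
      (renewalSeries ρ g t - 1) := by
  have h := (hasSum_nat_add_iff' 1).2 (hW.summable_toReal t).hasSum
  simpa [renewalTerm, renewalSeries] using h

lemma abs_renewalSeries_sub_le (hW : IsRenewalWeight ρ g l C) (t : ℝ) :
    |renewalSeries ρ g t - 1| ≤ bound l C t := by
  rw [← (hW.hasSum_succ t).tsum_eq, ← Real.norm_eq_abs]
  have hs : HasSum (fun k => (1 / 2 : ℝ) ^ (k + 1) * bound l C t) (bound l C t) := by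
    have h2 : HasSum (fun k => (1 / 2 : ℝ) ^ (k + 1)) 1 := by
      have h3 := hasSum_geometric_two.mul_left (1 / 2 : ℝ)
      simp only [← pow_succ'] at h3
      simpa using h3
    simpa using h2.mul_right (bound l C t)
  refine tsum_of_norm_bounded hs fun k => ?_
  rw [norm_mul, norm_pow, norm_neg, norm_one, one_pow, one_mul,
    Real.norm_of_nonneg ENNReal.toReal_nonneg]
  exact (hW.toReal_le (hW.renewalTerm_succ_le k t)).2

lemma measurable_renewalSeries (hW : IsRenewalWeight ρ g l C) :
    Measurable (renewalSeries ρ g) := by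
  have := hW.law.isProbabilityMeasure
  refine measurable_of_tendsto_metrizable (f := fun N t => ∑ k ∈ Finset.range N,
    (-1 : ℝ) ^ k * (renewalTerm ρ g k t).toReal) (fun N => Finset.measurable_fun_sum _ fun k _ =>
    (measurable_renewalTerm hW.measurable k).ennreal_toReal.const_mul _) ?_
  rw [tendsto_pi_nhds]
  exact fun t => (hW.summable_toReal t).hasSum.tendsto_sum_nat

/-- Integration of the renewal series against a finite measure. -/
lemma hasSum_lintegral (hW : IsRenewalWeight ρ g l C) {ν : Measure ℝ} [IsProbabilityMeasure ν]
    (hν : ∫⁻ t, expWeight l t ∂ν ≠ ⊤) :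
    HasSum (fun n => (-1 : ℝ) ^ (n + 1) *
        (∫⁻ t, (g t * renewalTerm ρ g n t + renewalTerm ρ g (n + 1) t) ∂ν).toReal)
      (∫ t, (1 - (g t).toReal) * renewalSeries ρ g t ∂ν - 1) := by
  have := hW.law.isProbabilityMeasure
  have hbound : Integrable (bound l C) ν := by
    refine Integrable.const_mul ?_ _
    exact integrable_toReal_of_lintegral_ne_top (measurable_expWeight l).aemeasurable hν
  set F : ℕ → ℝ → ℝ := fun n t => (-1 : ℝ) ^ (n + 1) *
    (g t * renewalTerm ρ g n t + renewalTerm ρ g (n + 1) t).toReal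
  have hmeas : ∀ n, Measurable fun t => g t * renewalTerm ρ g n t + renewalTerm ρ g (n + 1) t :=
    fun n => (hW.measurable.mul (measurable_renewalTerm hW.measurable n)).add
      (measurable_renewalTerm hW.measurable (n + 1))
  have hsplit : ∀ n t, (g t * renewalTerm ρ g n t + renewalTerm ρ g (n + 1) t).toReal =
      (g t).toReal * (renewalTerm ρ g n t).toReal + (renewalTerm ρ g (n + 1) t).toReal := by
    intro n t
    rw [ENNReal.toReal_add (hW.toReal_le (hW.mul_renewalTerm_le n t)).1
      (hW.renewalTerm_ne_top _ _), ENNReal.toReal_mul]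
  have hFle : ∀ n t, ‖F n t‖ ≤ (1 / 2) ^ n * (2 * bound l C t) := by
    intro n t
    simp only [F, hsplit]
    rw [norm_mul, norm_pow, norm_neg, norm_one, one_pow, one_mul,
      Real.norm_of_nonneg (by positivity), ← ENNReal.toReal_mul]
    have h1 := (hW.toReal_le (hW.mul_renewalTerm_le n t)).2
    have h2 := (hW.toReal_le (hW.renewalTerm_succ_le n t)).2
    have h3 : (1 / 2 : ℝ) ^ (n + 1) * bound l C t ≤ (1 / 2) ^ n * bound l C t := by
      refine mul_le_mul_of_nonneg_right ?_ (bound_nonneg t)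
      exact pow_le_pow_of_le_one (by norm_num) (by norm_num) (Nat.le_succ n)
    linarith
  have hFint : ∀ n, Integrable (F n) ν := fun n =>
    ((hbound.const_mul 2).const_mul _).mono' ((hmeas n).ennreal_toReal.const_mul _
      |>.aestronglyMeasurable) (Eventually.of_forall (hFle n))
  have hsum : Summable fun n => ∫ t, ‖F n t‖ ∂ν := by
    refine Summable.of_nonneg_of_le (fun n => integral_nonneg fun t => norm_nonneg _)
      (fun n => integral_mono (hFint n).norm ((hbound.const_mul 2).const_mul _) (hFle n)) ?_
    simp only [integral_const_mul]
    exact summable_geometric_two.mul_right _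
  -- With B = ∑ (-1)^k b_k, the sum of (-1)^(n+1) (g b_n + b_{n+1}) is -gB + (B - 1).
  have hpt : ∀ t, ∑' n, F n t = (1 - (g t).toReal) * renewalSeries ρ g t - 1 := by
    intro t
    have h1 := (hW.summable_toReal t).hasSum.mul_left (-(g t).toReal)
    have h2 := h1.add (hW.hasSum_succ t)
    have h3 : HasSum (fun n => F n t)
        (-(g t).toReal * renewalSeries ρ g t + (renewalSeries ρ g t - 1)) := by
      refine (congrArg (fun u => HasSum u _) (funext fun n => ?_)).mp h2
      simp only [F, hsplit]
      ring
    rw [h3.tsum_eq]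
    ring
  have hB : Integrable (fun t => (1 - (g t).toReal) * renewalSeries ρ g t) ν := by
    refine ((integrable_const 1).add hbound).mono'
      (((hW.measurable.ennreal_toReal.const_sub 1).mul
        hW.measurable_renewalSeries).aestronglyMeasurable) (Eventually.of_forall fun t => ?_)
    have h1 : (g t).toReal ≤ 1 := ENNReal.toReal_le_of_le_ofReal zero_le_one
      (by simpa using hW.le_one t)
    have h2 := abs_le.1 (hW.abs_renewalSeries_sub_le t)
    have h3 : ‖1 - (g t).toReal‖ ≤ 1 := by
      rw [Real.norm_of_nonneg (by linarith)]
      linarith [(g t).toReal_nonneg]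
    rw [norm_mul]
    refine (mul_le_of_le_one_left (norm_nonneg _) h3).trans ?_
    simp only [Pi.add_apply, Real.norm_eq_abs]
    rw [abs_le]
    constructor <;> linarith
  have key := hasSum_integral_of_summable_integral_norm hFint hsum
  simp only [hpt] at key
  rw [integral_sub hB (integrable_const 1)] at key
  simp only [integral_const, probReal_univ, smul_eq_mul, mul_one] at key
  refine (congrArg (fun u => HasSum u _) (funext fun n => ?_)).mp key
  simp only [F]
  rw [integral_const_mul, integral_toReal (hmeas n).aemeasurable (Eventually.of_forall fun t =>
    ENNReal.add_lt_top.2 ⟨(hW.toReal_le (hW.mul_renewalTerm_le n t)).1.lt_top,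
      (hW.renewalTerm_ne_top _ t).lt_top⟩)]

end IsRenewalWeight

/-! ### The random walk of the renewal epochs -/

section walk

variable {M : ℕ → Measure ℝ} [∀ n, IsProbabilityMeasure (M n)] {ρ : Measure ℝ}

lemma partialSum_succ (x : ℕ → ℝ) (n : ℕ) : partialSum x (n + 1) = partialSum x n + x (n + 1) :=
  Finset.sum_range_succ _ _

lemma partialSum_congr {x y : ℕ → ℝ} {n : ℕ} (h : ∀ k ≤ n, x k = y k) :
    partialSum x n = partialSum y n :=
  Finset.sum_congr rfl fun k hk => h k (Nat.lt_succ_iff.1 (Finset.mem_range.1 hk))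

lemma partialSum_splice {n j : ℕ} (hj : j ≤ n) (q : (ℕ → ℝ) × (ℕ → ℝ)) :
    partialSum (splice {k | k ≤ n} q) j = partialSum q.1 j :=
  partialSum_congr fun _ hk => splice_of_mem (S := {i | i ≤ n}) (hk.trans hj) q

/-- The last waiting time is independent of the previous epoch. -/
lemma lintegral_partialSum_prod (hM : ∀ n, M (n + 1) = ρ) {Φ : ℝ × ℝ → ℝ≥0∞} (hΦ : Measurable Φ)
    (n : ℕ) :
    ∫⁻ x, Φ (partialSum x n, x (n + 1)) ∂Measure.infinitePi M =
      ∫⁻ x, ∫⁻ s, Φ (partialSum x n, s) ∂ρ ∂Measure.infinitePi M := by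
  have hm : Measurable fun x : ℕ → ℝ => Φ (partialSum x n, x (n + 1)) :=
    hΦ.comp ((measurable_partialSum n).prodMk (measurable_pi_apply _))
  rw [lintegral_splice M {k | k ≤ n} hm]
  refine lintegral_congr fun a => ?_
  have hev : Measurable fun b : ℕ → ℝ => b (n + 1) := measurable_pi_apply _
  have hs : ∀ b : ℕ → ℝ, splice {k | k ≤ n} (a, b) (n + 1) = b (n + 1) := fun b =>
    splice_of_notMem (S := {k | k ≤ n}) (by simp) _
  simp only [partialSum_splice le_rfl, hs]
  rw [← hM n, ← Measure.infinitePi_map_eval M (n + 1)]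
  exact (lintegral_map (f := fun s => Φ (partialSum a n, s)) (by fun_prop) hev).symm

/-- Integrating out the last waiting time applies the translation operator once. -/
lemma lintegral_partialSum (hM : ∀ n, M (n + 1) = ρ) {χ : ℝ → ℝ≥0∞} (hχ : Measurable χ) (n : ℕ) :
    ∫⁻ x, χ (partialSum x n) ∂Measure.infinitePi M = ∫⁻ t, (shiftOp ρ)^[n] χ t ∂M 0 := by
  have : IsProbabilityMeasure ρ := hM 0 ▸ inferInstance
  induction n generalizing χ with
  | zero =>
    have hev : Measurable fun b : ℕ → ℝ => b 0 := measurable_pi_apply _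
    simp only [partialSum, zero_add, Finset.sum_range_one, Function.iterate_zero, id_eq]
    conv_rhs => rw [← Measure.infinitePi_map_eval M 0]
    exact (lintegral_map hχ hev).symm
  | succ n ih =>
    simp only [partialSum_succ]
    rw [lintegral_partialSum_prod hM (Φ := fun q => χ (q.1 + q.2)) (by fun_prop) n,
      Function.iterate_succ_apply, ← ih (measurable_shiftOp hχ)]
    rfl

lemma ae_pos_of_law (hM : ∀ n, ∀ᵐ s ∂M n, 0 < s) : ∀ᵐ x ∂Measure.infinitePi M, ∀ n, 0 < x n := by
  rw [ae_all_iff]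
  intro n
  have := hM n
  rw [← Measure.infinitePi_map_eval M n] at this
  exact ae_of_ae_map (measurable_pi_apply n).aemeasurable this

lemma partialSum_pos {x : ℕ → ℝ} (hx : ∀ n, 0 < x n) (n : ℕ) : 0 < partialSum x n :=
  Finset.sum_pos (fun k _ => hx k) (by simp)

/-- The mean of ∑ exp(-S_n) is at most ∑ q^n < ∞, so exp(-S_n) → 0 almost surely. No moment of ρ
enters. -/
lemma ae_tendsto_partialSum (hM : ∀ n, M (n + 1) = ρ) (hρ : IsWaitingLaw ρ)
    (h0 : ∀ᵐ s ∂M 0, 0 < s) :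
    ∀ᵐ x ∂Measure.infinitePi M, Tendsto (partialSum x) atTop atTop := by
  have := hρ.isProbabilityMeasure
  set q := ∫⁻ s, expWeight 1 s ∂ρ
  have hq : q < 1 := hρ.lintegral_expWeight_lt_one one_pos
  have h1 : ∀ n, ∫⁻ x, expWeight 1 (partialSum x n) ∂Measure.infinitePi M ≤ q ^ n := by
    intro n
    rw [lintegral_partialSum hM (measurable_expWeight 1), iterate_shiftOp_expWeight,
      lintegral_const_mul _ (measurable_expWeight 1)]
    refine mul_le_of_le_one_right' ((lintegral_mono_ae (g := fun _ => 1) ?_).trans (by simp))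
    filter_upwards [h0] with s hs
    rw [expWeight, ← ENNReal.ofReal_one]
    exact ENNReal.ofReal_le_ofReal (Real.exp_le_one_iff.2 (by linarith))
  have h2 : ∀ᵐ x ∂Measure.infinitePi M, ∑' n, expWeight 1 (partialSum x n) < ⊤ := by
    have hm : ∀ n, Measurable fun x => expWeight 1 (partialSum x n) := fun n =>
      (measurable_expWeight 1).comp (measurable_partialSum n)
    refine ae_lt_top (Measurable.tsum hm) ?_
    rw [lintegral_tsum fun n => (hm n).aemeasurable]
    refine ((ENNReal.tsum_le_tsum h1).trans_lt ?_).ne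
    rw [ENNReal.tsum_geometric]
    exact ENNReal.inv_lt_top.2 (tsub_pos_of_lt hq)
  filter_upwards [h2] with x hx
  have h3 := ENNReal.tendsto_atTop_zero_of_tsum_ne_top hx.ne
  have h4 : Tendsto (fun n => Real.exp (-(1 * partialSum x n))) atTop (𝓝 0) := by
    have := (ENNReal.tendsto_toReal ENNReal.zero_ne_top).comp h3
    simpa [Function.comp_def, expWeight, ENNReal.toReal_ofReal (Real.exp_nonneg _)] using this
  have h5 := Real.tendsto_exp_comp_nhds_zero.1 h4
  exact (tendsto_neg_atBot_atTop.comp h5).congr fun n => by simp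

/-- The product of `v` over the epochs has mean `∫ v B dM₀` when `B` solves the renewal equation
`B = K (v B)` and is eventually `1`. -/
lemma integral_expNeg_walk (hM : ∀ n, M (n + 1) = ρ) (hρ : IsWaitingLaw ρ)
    (h0 : ∀ᵐ s ∂M 0, 0 < s) {v B : ℝ → ℝ} (hv : Measurable v) (hv' : ∀ t, v t ∈ Icc (0 : ℝ) 1)
    (hB : Measurable B) {C : ℝ} (hBC : ∀ t, 0 < t → |B t| ≤ C) {R : ℝ} (hBR : ∀ t, R < t → B t = 1)
    (heq : ∀ t, 0 < t → B t = ∫ s, v (t + s) * B (t + s) ∂ρ) :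
    ∫ x, expNeg (∑' n, negLog (v (partialSum x n))) ∂Measure.infinitePi M =
      ∫ t, v t * B t ∂M 0 := by
  have := hρ.isProbabilityMeasure
  have hpos : ∀ᵐ x ∂Measure.infinitePi M, ∀ n, 0 < x n := ae_pos_of_law fun n => by
    cases n with
    | zero => exact h0
    | succ n => rw [hM]; exact hρ.pos
  set Q : ℕ → (ℕ → ℝ) → ℝ≥0∞ := fun N x => ∑ n ∈ Finset.range N, negLog (v (partialSum x n))
  have hQ : ∀ N, Measurable (Q N) := fun N => Finset.measurable_fun_sum _ fun n _ =>
    measurable_negLog.comp (hv.comp (measurable_partialSum n))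
  have hFm : ∀ N k, Measurable fun x => expNeg (Q N x) * B (partialSum x k) := fun N k =>
    (measurable_expNeg.comp (hQ N)).mul (hB.comp (measurable_partialSum k))
  have hFb : ∀ N k, ∀ᵐ x ∂Measure.infinitePi M, ‖expNeg (Q N x) * B (partialSum x k)‖ ≤ C := by
    intro N k
    filter_upwards [hpos] with x hx
    rw [norm_mul, Real.norm_of_nonneg (expNeg_nonneg _)]
    exact (mul_le_of_le_one_left (norm_nonneg _) (expNeg_le_one _)).trans
      (hBC _ (partialSum_pos hx k))
  have hFi : ∀ N k, Integrable (fun x => expNeg (Q N x) * B (partialSum x k))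
      (Measure.infinitePi M) := fun N k =>
    Integrable.of_bound (hFm N k).aestronglyMeasurable C (hFb N k)
  -- The variables v(S_0) ⋯ v(S_N) B(S_N) form a martingale: the next waiting time is averaged out
  -- by the renewal equation. `Q (N + 1)` covers the epochs 0, …, N.
  have hstep : ∀ N, ∫ x, expNeg (Q (N + 2) x) * B (partialSum x (N + 1)) ∂Measure.infinitePi M =
      ∫ x, expNeg (Q (N + 1) x) * B (partialSum x N) ∂Measure.infinitePi M := by
    intro N
    rw [integral_splice M {k | k ≤ N} (hFm _ _) (hFi _ _)]
    refine integral_congr_ae ?_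
    filter_upwards [hpos] with a ha
    have hs : ∀ b : ℕ → ℝ, splice {k | k ≤ N} (a, b) (N + 1) = b (N + 1) := fun b =>
      splice_of_notMem (S := {k | k ≤ N}) (by simp) _
    have hQs : ∀ b, Q (N + 1) (splice {k | k ≤ N} (a, b)) = Q (N + 1) a := fun b =>
      Finset.sum_congr rfl fun n hn => by
        rw [partialSum_splice (Nat.lt_succ_iff.1 (Finset.mem_range.1 hn))]
    have hexp : ∀ b, expNeg (Q (N + 2) (splice {k | k ≤ N} (a, b))) *
        B (partialSum (splice {k | k ≤ N} (a, b)) (N + 1)) = expNeg (Q (N + 1) a) *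
          (v (partialSum a N + b (N + 1)) * B (partialSum a N + b (N + 1))) := by
      intro b
      have h2 : Q (N + 2) (splice {k | k ≤ N} (a, b)) = Q (N + 1) a +
          negLog (v (partialSum a N + b (N + 1))) := by
        rw [← hQs b, ← hs b, ← partialSum_splice le_rfl (a, b), ← partialSum_succ]
        exact Finset.sum_range_succ _ _
      rw [h2, expNeg_add, expNeg_negLog (hv' _), partialSum_succ, partialSum_splice le_rfl, hs,
        mul_assoc]
    simp only [hexp]
    rw [integral_const_mul, heq _ (partialSum_pos ha N)]
    congr 1
    have hev : Measurable fun b : ℕ → ℝ => b (N + 1) := measurable_pi_apply _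
    have hm : Measurable fun s => v (partialSum a N + s) * B (partialSum a N + s) := by fun_prop
    rw [← hM N, ← Measure.infinitePi_map_eval M (N + 1)]
    exact (integral_map_of_stronglyMeasurable hev hm.stronglyMeasurable).symm
  have hconst : ∀ N, ∫ x, expNeg (Q (N + 1) x) * B (partialSum x N) ∂Measure.infinitePi M =
      ∫ t, v t * B t ∂M 0 := by
    intro N
    induction N with
    | zero =>
      have hev : Measurable fun b : ℕ → ℝ => b 0 := measurable_pi_apply _
      have hm : Measurable fun s => v s * B s := hv.mul hB
      have h1 : ∀ x : ℕ → ℝ, expNeg (Q 1 x) * B (partialSum x 0) = v (x 0) * B (x 0) := by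
        intro x
        simp only [Q, Finset.sum_range_one, partialSum, zero_add]
        rw [expNeg_negLog (hv' _)]
      simp only [zero_add, h1]
      conv_rhs => rw [← Measure.infinitePi_map_eval M 0]
      exact (integral_map_of_stronglyMeasurable hev hm.stronglyMeasurable).symm
    | succ N ih => rw [hstep, ih]
  -- The epochs eventually exceed R, where B = 1, so the bounded martingale converges to the full
  -- product.
  have hlim : Tendsto (fun N => ∫ x, expNeg (Q (N + 1) x) * B (partialSum x N)
      ∂Measure.infinitePi M) atTop
      (𝓝 (∫ x, expNeg (∑' n, negLog (v (partialSum x n))) ∂Measure.infinitePi M)) := by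
    refine tendsto_integral_of_dominated_convergence (fun _ => C)
      (fun N => (hFm _ _).aestronglyMeasurable) (integrable_const C) (fun N => hFb _ _) ?_
    filter_upwards [ae_tendsto_partialSum hM hρ h0] with x hx
    have h1 : Tendsto (fun N => expNeg (Q (N + 1) x)) atTop
        (𝓝 (expNeg (∑' n, negLog (v (partialSum x n))))) :=
      ((continuous_expNeg.tendsto _).comp ENNReal.summable.hasSum.tendsto_sum_nat).comp
        (tendsto_add_atTop_nat 1)
    have h2 : Tendsto (fun N => B (partialSum x N)) atTop (𝓝 1) := by
      refine tendsto_const_nhds.congr' ?_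
      filter_upwards [hx.eventually_gt_atTop R] with N hN
      rw [hBR _ hN]
    simpa using h1.mul h2
  simp only [hconst] at hlim
  exact tendsto_nhds_unique hlim tendsto_const_nhds

end walk

/-! ### Stationarity of the renewal process -/

section stationary

/-- The point process of the partial sums of a sequence. -/
def epochMeasure (x : ℕ → ℝ) : Measure ℝ := Measure.sum fun n => Measure.dirac (partialSum x n)

lemma measurable_epochMeasure : Measurable epochMeasure := by
  refine Measure.measurable_of_measurable_coe _ fun A hA => ?_
  simp only [epochMeasure, Measure.sum_apply _ hA, Measure.dirac_apply' _ hA]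
  exact Measurable.tsum fun n => (measurable_one.indicator hA).comp (measurable_partialSum n)

/-- The process of the points after time `s`, seen from `s`. -/
def shiftMeasure (s : ℝ) (N : Measure ℝ) : Measure ℝ := (N.map fun x => x - s).restrict (Ici 0)

lemma measurable_shiftMeasure (s : ℝ) : Measurable (shiftMeasure s) := by
  refine Measure.measurable_of_measurable_coe _ fun A hA => ?_
  have hsub : Measurable fun x : ℝ => x - s := measurable_sub_const s
  have : ∀ N : Measure ℝ, shiftMeasure s N A = N ((fun x => x - s) ⁻¹' (A ∩ Ici 0)) := fun N => by
    rw [shiftMeasure, Measure.restrict_apply hA, Measure.map_apply hsub (hA.inter measurableSet_Ici)]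
  simp only [this]
  exact Measure.measurable_coe (hsub (hA.inter measurableSet_Ici))

lemma partialSum_strictMono {x : ℕ → ℝ} (hx : ∀ n, 0 < x n) : StrictMono (partialSum x) :=
  strictMono_nat_of_lt_succ fun n => by
    rw [partialSum_succ]
    exact lt_add_of_pos_right _ (hx _)

/-- The `n`-th epoch is the first one not before `s`. -/
def Crossing (s : ℝ) (x : ℕ → ℝ) : ℕ → Prop
  | 0 => s ≤ partialSum x 0
  | n + 1 => partialSum x n < s ∧ s ≤ partialSum x (n + 1)

lemma measurableSet_crossing (s : ℝ) : ∀ n, MeasurableSet {x : ℕ → ℝ | Crossing s x n}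
  | 0 => measurableSet_le measurable_const (measurable_partialSum 0)
  | n + 1 => (measurableSet_lt (measurable_partialSum n) measurable_const).inter
      (measurableSet_le measurable_const (measurable_partialSum (n + 1)))

lemma crossing_le {s : ℝ} {x : ℕ → ℝ} : ∀ {n}, Crossing s x n → s ≤ partialSum x n
  | 0, h => h
  | _ + 1, h => h.2

lemma crossing_lt {s : ℝ} {x : ℕ → ℝ} (hx : StrictMono (partialSum x)) :
    ∀ {n}, Crossing s x n → ∀ j < n, partialSum x j < s
  | 0, _, j, hj => absurd hj (Nat.not_lt_zero j)
  | _ + 1, h, _, hj => (hx.monotone (Nat.lt_succ_iff.1 hj)).trans_lt h.1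

lemma existsUnique_crossing {s : ℝ} {x : ℕ → ℝ} (hx : StrictMono (partialSum x))
    (hlim : Tendsto (partialSum x) atTop atTop) : ∃! n, Crossing s x n := by
  classical
  have hex : ∃ n, s ≤ partialSum x n := (hlim.eventually_ge_atTop s).exists
  refine ⟨Nat.find hex, ?_, fun n hn => ?_⟩
  · have h1 := Nat.find_spec hex
    have h2 : ∀ m < Nat.find hex, ¬ s ≤ partialSum x m := fun m hm => Nat.find_min hex hm
    dsimp only
    generalize Nat.find hex = n at h1 h2
    cases n with
    | zero => exact h1
    | succ n => exact ⟨not_le.1 (h2 n (Nat.lt_succ_self n)), h1⟩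
  · refine ((Nat.find_eq_iff hex).2 ⟨crossing_le hn, fun m hm => ?_⟩).symm
    exact not_le.2 (crossing_lt hx hn m hm)

/-- The waiting times seen from `s`, when the `n`-th epoch is the first one not before `s`. -/
def restart (y : ℝ) (n : ℕ) (x : ℕ → ℝ) : ℕ → ℝ
  | 0 => y
  | k + 1 => x (n + 1 + k)

lemma measurable_restart (n : ℕ) : Measurable fun q : ℝ × (ℕ → ℝ) => restart q.1 n q.2 := by
  refine measurable_pi_lambda _ fun k => ?_
  cases k with
  | zero => exact measurable_fst
  | succ k => exact (measurable_pi_apply (n + 1 + k)).comp measurable_snd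

lemma partialSum_restart (s : ℝ) (n : ℕ) (x : ℕ → ℝ) (j : ℕ) :
    partialSum (restart (partialSum x n - s) n x) j = partialSum x (n + j) - s := by
  induction j with
  | zero => simp [partialSum, restart]
  | succ j ih =>
    rw [partialSum_succ, ih, ← add_assoc, partialSum_succ]
    simp only [restart]
    rw [show n + 1 + j = n + j + 1 by ring]
    ring

/-- Epochs of index below n lie before s and are discarded; the others are kept and re-indexed by j
↦ n + j. -/
lemma shiftMeasure_epochMeasure {s : ℝ} {x : ℕ → ℝ} (hx : StrictMono (partialSum x)) {n : ℕ}
    (hn : Crossing s x n) :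
    shiftMeasure s (epochMeasure x) = epochMeasure (restart (partialSum x n - s) n x) := by
  have hsub : Measurable fun x : ℝ => x - s := measurable_sub_const s
  refine Measure.ext fun A hA => ?_
  rw [shiftMeasure, Measure.restrict_apply hA, Measure.map_apply hsub (hA.inter measurableSet_Ici),
    epochMeasure, epochMeasure, Measure.sum_apply _ (hsub (hA.inter measurableSet_Ici)),
    Measure.sum_apply _ hA]
  simp only [Measure.dirac_apply' _ hA,
    Measure.dirac_apply' _ (hsub (hA.inter measurableSet_Ici)), partialSum_restart]
  rw [← (add_right_injective n).tsum_eq]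
  · refine tsum_congr fun j => ?_
    have h1 : s ≤ partialSum x (n + j) :=
      (crossing_le hn).trans (hx.monotone (Nat.le_add_right n j))
    have h2 : partialSum x (n + j) ∈ (fun x => x - s) ⁻¹' (A ∩ Ici 0) ↔
        partialSum x (n + j) - s ∈ A :=
      ⟨fun h => h.1, fun h => ⟨h, sub_nonneg.2 h1⟩⟩
    by_cases h3 : partialSum x (n + j) - s ∈ A
    · rw [indicator_of_mem (h2.2 h3), indicator_of_mem h3]
      rfl
    · rw [indicator_of_notMem (mt h2.1 h3), indicator_of_notMem h3]
  · intro k hk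
    by_contra hk'
    have hkn : k < n := by
      by_contra hle
      exact hk' ⟨k - n, Nat.add_sub_cancel' (not_lt.1 hle)⟩
    have := crossing_lt hx hn k hkn
    simp [indicator, not_le.2 this] at hk

/-! ### Law of the forward recurrence time, and restarting at the crossing -/

variable {M : ℕ → Measure ℝ} [∀ n, IsProbabilityMeasure (M n)] {ρ : Measure ℝ} {m : ℝ≥0∞}

open Classical in
/-- The position of the first epoch not before `s`, seen from `s`. -/
def recurrenceLaw (M : ℕ → Measure ℝ) [∀ n, IsProbabilityMeasure (M n)] (s : ℝ) : Measure ℝ :=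
  Measure.sum fun n => ((Measure.infinitePi M).restrict {x | Crossing s x n}).map
    fun x => partialSum x n - s

lemma lintegral_recurrenceLaw (M : ℕ → Measure ℝ) [∀ n, IsProbabilityMeasure (M n)] (s : ℝ)
    {χ : ℝ → ℝ≥0∞} (hχ : Measurable χ) :
    ∫⁻ y, χ y ∂recurrenceLaw M s = ∑' n, ∫⁻ x in {x | Crossing s x n}, χ (partialSum x n - s)
      ∂Measure.infinitePi M := by
  rw [recurrenceLaw, lintegral_sum_measure]
  refine tsum_congr fun n => ?_
  exact lintegral_map hχ ((measurable_partialSum n).sub_const s)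

/-- Mass balance for a function with support in `[0,c]`. -/
lemma lintegral_recurrenceLaw_eq (hM : ∀ n, M (n + 1) = ρ) (hρ : IsWaitingLaw ρ) (hm : m ≠ ⊤)
    (h0 : M 0 = delayLaw m ρ) {s : ℝ} (hs : 0 ≤ s) {χ : ℝ → ℝ≥0∞} (hχ : Measurable χ) {c : ℝ}
    (hχ1 : ∀ t, χ t ≤ (Icc 0 c).indicator 1 t) :
    ∫⁻ y, χ y ∂recurrenceLaw M s = ∫⁻ y, χ y ∂delayLaw m ρ := by
  have := hρ.isProbabilityMeasure
  have hχneg : ∀ t, t < 0 → χ t = 0 := fun t ht => by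
    have := hχ1 t
    simpa [indicator, not_le.2 ht] using this
  have hχle : ∀ t, χ t ≤ 1 := fun t => (hχ1 t).trans (by
    by_cases h : t ∈ Icc 0 c <;> simp [h])
  -- `a` evaluates χ at the overshoot over s. Below, ψ(t) is its mean after one jump from t < s; the
  -- vanishing of χ on negatives discards jumps that do not cross s.
  set a : ℝ → ℝ≥0∞ := fun x => χ (x - s)
  have ha : Measurable a := hχ.comp (measurable_sub_const s)
  set ψ : ℝ → ℝ≥0∞ := (Iio s).indicator (shiftOp ρ a)
  have hKa : Measurable (shiftOp ρ a) := measurable_shiftOp ha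
  have hψ : Measurable ψ := hKa.indicator measurableSet_Iio
  -- the terms of the sum
  have hzero : ∫⁻ x in {x | Crossing s x 0}, χ (partialSum x 0 - s) ∂Measure.infinitePi M =
      ∫⁻ t, a t ∂delayLaw m ρ := by
    rw [← lintegral_indicator (measurableSet_crossing s 0), ← h0]
    have h1 := lintegral_partialSum hM ha 0
    simp only [Function.iterate_zero, id_eq] at h1
    rw [← h1]
    refine lintegral_congr fun x => ?_
    by_cases hx : s ≤ partialSum x 0
    · simp [indicator, Crossing, hx, a]
    · simp [indicator, Crossing, hx, a, hχneg _ (sub_neg.2 (not_le.1 hx))]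
  have hsucc : ∀ n, ∫⁻ x in {x | Crossing s x (n + 1)}, χ (partialSum x (n + 1) - s)
      ∂Measure.infinitePi M = ∫⁻ t, (shiftOp ρ)^[n] ψ t ∂delayLaw m ρ := by
    intro n
    have hΦ : Measurable fun q : ℝ × ℝ => (Iio s).indicator (fun _ => a (q.1 + q.2)) q.1 := by
      have : (fun q : ℝ × ℝ => (Iio s).indicator (fun _ => a (q.1 + q.2)) q.1) =
          {q : ℝ × ℝ | q.1 < s}.indicator fun q => a (q.1 + q.2) := by
        ext q; simp [indicator]
      rw [this]
      exact Measurable.indicator (by fun_prop) (measurableSet_lt measurable_fst measurable_const)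
    rw [← lintegral_indicator (measurableSet_crossing s (n + 1)), ← h0,
      ← lintegral_partialSum hM hψ n]
    have h1 := lintegral_partialSum_prod hM hΦ n
    have h2 : ∀ t, ∫⁻ r, (Iio s).indicator (fun _ => a (t + r)) t ∂ρ = ψ t := by
      intro t
      by_cases ht : t < s <;> simp [ψ, indicator, ht, shiftOp]
    simp only [h2] at h1
    rw [← h1]
    refine lintegral_congr fun x => ?_
    rw [← partialSum_succ]
    by_cases hx : partialSum x n < s
    · by_cases hx' : s ≤ partialSum x (n + 1)
      · simp [indicator, Crossing, hx, hx', a]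
      · simp [indicator, Crossing, hx, hx', a, hχneg _ (sub_neg.2 (not_le.1 hx'))]
    · simp [indicator, Crossing, hx]
  -- the balance
  have hψsum : ∑' n, ∫⁻ t, (shiftOp ρ)^[n] ψ t ∂delayLaw m ρ = m * ∫⁻ t in Ioi 0, ψ t := by
    -- ψ is at most 1 and vanishes from s on, so e^s e^{-t} dominates it.
    refine hρ.tsum_lintegral_delayLaw hm hψ one_pos (C := ENNReal.ofReal (Real.exp s))
      ENNReal.ofReal_ne_top fun t => ?_
    by_cases ht : t < s
    · have h1 : ψ t ≤ 1 := by
        simp only [ψ, indicator, mem_Iio, ht, if_true]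
        exact (lintegral_mono fun r => hχle _).trans (by simp)
      refine h1.trans ?_
      rw [expWeight, ← ENNReal.ofReal_mul (Real.exp_nonneg _), ← Real.exp_add,
        ← ENNReal.ofReal_one]
      exact ENNReal.ofReal_le_ofReal (Real.one_le_exp (by linarith))
    · simp [ψ, ht]
  have e1 := hρ.lintegral_delayLaw_add m ha
  have e2 := hρ.lintegral_delayLaw_add m hχ
  have htrans : ∀ {b : ℝ → ℝ≥0∞}, ∫⁻ t in Ioi s, b (t - s) = ∫⁻ t in Ioi 0, b t := by
    intro b
    rw [← lintegral_indicator measurableSet_Ioi, ← lintegral_indicator measurableSet_Ioi,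
      ← lintegral_sub_right_eq_self ((Ioi 0).indicator b) s]
    refine lintegral_congr fun t => ?_
    by_cases ht : s < t <;> simp [indicator, ht]
  have e3 : ∫⁻ t in Ioi 0, a t = ∫⁻ t in Ioi 0, χ t := by
    rw [← htrans (b := χ), ← lintegral_indicator measurableSet_Ioi,
      ← lintegral_indicator measurableSet_Ioi]
    refine lintegral_congr_ae ?_
    filter_upwards [compl_mem_ae_iff.2 (measure_singleton s)] with t ht
    rcases lt_or_gt_of_ne (show t ≠ s from ht) with h | h
    · simp [indicator, a, not_lt.2 h.le, hχneg _ (sub_neg.2 h)]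
    · simp [indicator, a, h, hs.trans_lt h]
  have e4 : ∫⁻ t in Ioi 0, shiftOp ρ a t =
      (∫⁻ t in Ioi 0, ψ t) + ∫⁻ t in Ioi 0, shiftOp ρ χ t := by
    rw [← htrans (b := shiftOp ρ χ), ← lintegral_indicator measurableSet_Ioi,
      ← lintegral_indicator measurableSet_Ioi, ← lintegral_indicator measurableSet_Ioi,
      ← lintegral_add_left (hψ.indicator measurableSet_Ioi)]
    refine lintegral_congr_ae ?_
    filter_upwards [compl_mem_ae_iff.2 (measure_singleton s)] with t ht
    have hK : shiftOp ρ χ (t - s) = shiftOp ρ a t := by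
      refine lintegral_congr fun r => ?_
      simp only [a]
      congr 1
      ring
    rcases lt_or_gt_of_ne (show t ≠ s from ht) with h | h
    · simp [indicator, ψ, not_lt.2 h.le, h]
    · simp [indicator, ψ, h, hs.trans_lt h, not_lt.2 h.le, hK]
  -- The bounded support of χ makes this term finite, so it can be cancelled in [0,∞].
  have hfin : m * ∫⁻ t in Ioi 0, shiftOp ρ χ t ≠ ⊤ := by
    refine ENNReal.mul_ne_top hm (ne_top_of_le_ne_top (b := ∫⁻ t, (Icc 0 c).indicator 1 t) ?_ ?_)
    · rw [lintegral_indicator_one measurableSet_Icc]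
      simp
    · rw [hρ.lintegral_shiftOp_Ioi hχ]
      refine (lintegral_mono fun t => ?_).trans (setLIntegral_le_lintegral (Ioi 0) _)
      exact (mul_le_of_le_one_left' prob_le_one).trans (hχ1 t)
  rw [lintegral_recurrenceLaw M s hχ, tsum_eq_zero_add' ENNReal.summable, hzero]
  simp only [hsucc]
  -- With integrals over (0,∞) and δ the law of the delay: ∫ a dδ + m∫ψ + m∫Kχ = ∫ a dδ + m∫Ka = m∫a
  -- = m∫χ = ∫ χ dδ + m∫Kχ.
  rw [hψsum, ← ENNReal.add_left_inj hfin, e2, ← e3, ← e1, e4, mul_add, add_assoc]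

/-- The forward recurrence time at `s` of the stationary renewal process has the law of the
delay. -/
lemma recurrenceLaw_eq (hM : ∀ n, M (n + 1) = ρ) (hρ : IsWaitingLaw ρ) (hm : m ≠ ⊤)
    (h0 : M 0 = delayLaw m ρ) {s : ℝ} (hs : 0 ≤ s) : recurrenceLaw M s = delayLaw m ρ := by
  have hneg1 : recurrenceLaw M s (Iio 0) = 0 := by
    rw [← lintegral_indicator_one measurableSet_Iio, lintegral_recurrenceLaw M s
      (measurable_one.indicator measurableSet_Iio)]
    refine ENNReal.tsum_eq_zero.2 fun n => ?_
    rw [setLIntegral_congr_fun (g := fun _ => 0) (measurableSet_crossing s n)]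
    · simp
    · intro x hx
      simp [indicator, crossing_le hx]
  have hneg2 : delayLaw m ρ (Iio 0) = 0 :=
    measure_mono_null (fun t ht => not_lt.2 (le_of_lt (mem_Iio.1 ht)))
      (ae_iff.1 (delayLaw_pos m ρ))
  have hsplit : ∀ (ν : Measure ℝ) (A : Set ℝ), ν (Iio 0) = 0 → ν A = ν (A ∩ Ici 0) := by
    intro ν A hν
    have h1 : ν (A \ Ici 0) = 0 := 
      measure_mono_null (fun t ht => mem_Iio.2 (not_le.1 ht.2)) hν
    rw [← measure_inter_add_sdiff A measurableSet_Ici, h1, add_zero]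
  -- The mass balance needs bounded support: the laws are compared on each (-∞,n], both being null
  -- on the negatives.
  refine (Measure.ext_iff_of_iUnion_eq_univ (iUnion_Iic_of_not_bddAbove_range
    (f := fun n : ℕ => (n : ℝ)) ?_)).2 fun n => Measure.ext fun A hA => ?_
  · rintro ⟨b, hb⟩
    obtain ⟨k, hk⟩ := exists_nat_gt b
    exact absurd (hb ⟨k, rfl⟩) (not_le.2 hk)
  · rw [Measure.restrict_apply hA, Measure.restrict_apply hA, hsplit _ _ hneg1,
      hsplit (delayLaw m ρ) _ hneg2]
    have hmeas : MeasurableSet (A ∩ Iic (n : ℝ) ∩ Ici 0) :=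
      (hA.inter measurableSet_Iic).inter measurableSet_Ici
    rw [← lintegral_indicator_one hmeas, ← lintegral_indicator_one hmeas]
    refine lintegral_recurrenceLaw_eq hM hρ hm h0 hs (c := n)
      (measurable_one.indicator hmeas) fun t => ?_
    have hsub : A ∩ Iic (n : ℝ) ∩ Ici 0 ⊆ Icc 0 (n : ℝ) := fun t ht => ⟨ht.2, ht.1.2⟩
    exact indicator_le_indicator_of_subset hsub (fun _ => zero_le) t

/-- The renewal process restarted at the `n`-th epoch. -/
lemma lintegral_restart (hM : ∀ n, M (n + 1) = ρ) {F : (ℕ → ℝ) → ℝ≥0∞} (hF : Measurable F)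
    (n : ℕ) (y : ℝ) :
    ∫⁻ b, F (restart y n b) ∂Measure.infinitePi M =
      ∫⁻ b, F (restart y 0 b) ∂Measure.infinitePi M := by
  -- Both sides are compared with one i.i.d. sequence c of law ρ. The index k - 1 makes entry k + 1
  -- of `restart y 0` read c k.
  have key : ∀ n, ∫⁻ b, F (restart y n b) ∂Measure.infinitePi M =
      ∫⁻ c, F (restart y 0 (fun k => c (k - 1))) ∂Measure.infinitePi fun _ : ℕ => ρ := by
    intro n
    have hinj : Function.Injective fun k : ℕ => n + 1 + k := add_right_injective _
    have hmap := Measure.map_infinitePi_infinitePi_of_inj (P := M) hinj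
    have he : (fun k => M (n + 1 + k)) = fun _ : ℕ => ρ := by
      funext k
      rw [show n + 1 + k = (n + k) + 1 by ring, hM]
    have hR : Measurable fun c : ℕ → ℝ => F (restart y 0 (fun k => c (k - 1))) := by
      have h1 : Measurable fun c : ℕ → ℝ => (y, fun k => c (k - 1)) := by fun_prop
      exact hF.comp ((measurable_restart 0).comp h1)
    have hev : Measurable fun (b : ℕ → ℝ) (k : ℕ) => b (n + 1 + k) := by fun_prop
    have hmap' : Measure.infinitePi (fun _ : ℕ => ρ) =
        (Measure.infinitePi M).map fun b k => b (n + 1 + k) := by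
      rw [hmap]
      congr 1
      exact he.symm
    rw [hmap', lintegral_map hR hev]
    refine lintegral_congr fun b => ?_
    congr 1
    funext k
    cases k with
    | zero => rfl
    | succ k => simp [restart]
  rw [key n, key 0]

/-- The delayed renewal process whose delay has density `m (1 - F)` is stationary. -/
theorem map_shiftMeasure_epochMeasure (hM : ∀ n, M (n + 1) = ρ) (hρ : IsWaitingLaw ρ) (hm : m ≠ ⊤)
    (h0 : M 0 = delayLaw m ρ) {s : ℝ} (hs : 0 ≤ s) :
    (Measure.infinitePi M).map (fun x => shiftMeasure s (epochMeasure x)) =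
      (Measure.infinitePi M).map epochMeasure := by
  classical
  have hpos0 : ∀ᵐ t ∂M 0, 0 < t := h0 ▸ delayLaw_pos m ρ
  have hpos : ∀ᵐ x ∂Measure.infinitePi M, ∀ n, 0 < x n := ae_pos_of_law fun n => by
    cases n with
    | zero => exact hpos0
    | succ n => rw [hM]; exact hρ.pos
  refine Measure.ext fun A hA => ?_
  have hΘ : Measurable fun x => shiftMeasure s (epochMeasure x) :=
    (measurable_shiftMeasure s).comp measurable_epochMeasure
  rw [Measure.map_apply hΘ hA, Measure.map_apply measurable_epochMeasure hA]
  set F : (ℕ → ℝ) → ℝ≥0∞ := fun x => A.indicator 1 (epochMeasure x)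
  have hF : Measurable F := (measurable_one.indicator hA).comp measurable_epochMeasure
  -- χ(y) is the probability of A for a fresh renewal process with first point y. Both probabilities
  -- become integrals of χ, against the law of the delay and that of the overshoot, which agree.
  set χ : ℝ → ℝ≥0∞ := fun y => ∫⁻ b, F (restart y 0 b) ∂Measure.infinitePi M
  have hχ : Measurable χ := (hF.comp (measurable_restart 0)).lintegral_prod_right'
  have hR : ∫⁻ x, F x ∂Measure.infinitePi M = ∫⁻ t, χ t ∂M 0 := by
    rw [lintegral_splice M {k | k ≤ 0} hF]
    have hev : Measurable fun b : ℕ → ℝ => b 0 := measurable_pi_apply _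
    conv_rhs => rw [← Measure.infinitePi_map_eval M 0]
    refine Eq.trans ?_ (lintegral_map hχ hev).symm
    refine lintegral_congr fun a => lintegral_congr fun b => ?_
    congr 1
    funext k
    cases k with
    | zero => exact splice_of_mem (S := {k | k ≤ 0}) (i := 0) (le_refl 0) (a, b)
    | succ k =>
      rw [splice_of_notMem (S := {k | k ≤ 0}) (by simp)]
      simp [restart, add_comm]
  have hL : ∫⁻ x, A.indicator 1 (shiftMeasure s (epochMeasure x)) ∂Measure.infinitePi M =
      ∑' n, ∫⁻ x in {x | Crossing s x n}, F (restart (partialSum x n - s) n x)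
        ∂Measure.infinitePi M := by
    have hm1 : ∀ n, Measurable ({x | Crossing s x n}.indicator
        fun x => F (restart (partialSum x n - s) n x)) := fun n =>
      (hF.comp ((measurable_restart n).comp
        (((measurable_partialSum n).sub_const s).prodMk measurable_id))).indicator
        (measurableSet_crossing s n)
    have h1 : ∀ n, ∫⁻ x in {x | Crossing s x n}, F (restart (partialSum x n - s) n x)
        ∂Measure.infinitePi M = ∫⁻ x, {x | Crossing s x n}.indicator
          (fun x => F (restart (partialSum x n - s) n x)) x ∂Measure.infinitePi M := fun n =>
      (lintegral_indicator (measurableSet_crossing s n) _).symm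
    simp only [h1]
    rw [← lintegral_tsum fun n => (hm1 n).aemeasurable]
    refine lintegral_congr_ae ?_
    filter_upwards [hpos, ae_tendsto_partialSum hM hρ hpos0] with x hx hx'
    have hmono := partialSum_strictMono hx
    obtain ⟨n, hn, huniq⟩ := existsUnique_crossing (s := s) hmono hx'
    rw [tsum_eq_single n]
    · rw [indicator_of_mem (show x ∈ {x | Crossing s x n} from hn),
        shiftMeasure_epochMeasure hmono hn]
    · intro k hk
      rw [indicator_of_notMem (show x ∉ {x | Crossing s x k} from fun h => hk (huniq k h))]
  -- The crossing event and the overshoot read the coordinates up to n, the later waiting times only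
  -- those beyond n; the latter may be resampled.
  have hterm : ∀ n, ∫⁻ x in {x | Crossing s x n}, F (restart (partialSum x n - s) n x)
        ∂Measure.infinitePi M =
      ∫⁻ x in {x | Crossing s x n}, χ (partialSum x n - s) ∂Measure.infinitePi M := by
    intro n
    have hm1 : Measurable ({x | Crossing s x n}.indicator
        fun x => F (restart (partialSum x n - s) n x)) :=
      (hF.comp ((measurable_restart n).comp
        (((measurable_partialSum n).sub_const s).prodMk measurable_id))).indicator
        (measurableSet_crossing s n)
    rw [← lintegral_indicator (measurableSet_crossing s n),
      ← lintegral_indicator (measurableSet_crossing s n), lintegral_splice M {k | k ≤ n} hm1]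
    refine lintegral_congr fun a => ?_
    have hcr : ∀ b, Crossing s (splice {k | k ≤ n} (a, b)) n ↔ Crossing s a n := by
      intro b
      cases n with
      | zero => simp only [Crossing, partialSum_splice le_rfl]
      | succ n => simp only [Crossing, partialSum_splice le_rfl, partialSum_splice (Nat.le_succ n)]
    have hre : ∀ b, restart (partialSum a n - s) n (splice {k | k ≤ n} (a, b)) =
        restart (partialSum a n - s) n b := by
      intro b
      funext k
      cases k with
      | zero => rfl
      | succ k => exact splice_of_notMem (S := {k | k ≤ n}) (by simp; omega) (a, b)
    by_cases ha : Crossing s a n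
    · simp only [indicator, mem_ofPred_eq, hcr, ha, if_true, partialSum_splice le_rfl, hre]
      exact lintegral_restart hM hF n _
    · simp [indicator, hcr, ha]
  have hfinal : ∫⁻ x, A.indicator 1 (shiftMeasure s (epochMeasure x)) ∂Measure.infinitePi M =
      ∫⁻ x, F x ∂Measure.infinitePi M := by
    rw [hL, hR, h0, ← recurrenceLaw_eq hM hρ hm h0 hs, lintegral_recurrenceLaw M s hχ]
    exact tsum_congr hterm
  have hind1 : ∀ x, A.indicator (1 : Measure ℝ → ℝ≥0∞) (shiftMeasure s (epochMeasure x)) =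
      ((fun x => shiftMeasure s (epochMeasure x)) ⁻¹' A).indicator 1 x := fun x => rfl
  have hind2 : ∀ x, F x = (epochMeasure ⁻¹' A).indicator 1 x := fun x => rfl
  simp only [hind1, hind2] at hfinal
  rw [lintegral_indicator_one (hΘ hA),
    lintegral_indicator_one (measurable_epochMeasure hA)] at hfinal
  exact hfinal

end stationary

/-! ### Waiting times with a density -/

/-- The law with density `f` on `(0,∞)`. -/
def waitLaw (f : ℝ → ℝ) : Measure ℝ :=
  (volume.restrict (Ioi 0)).withDensity fun t => ENNReal.ofReal (f t)

instance (f : ℝ → ℝ) : SFinite (waitLaw f) := by unfold waitLaw; infer_instance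

lemma lintegral_waitLaw {f : ℝ → ℝ} (hf : Measurable f) {χ : ℝ → ℝ≥0∞} (hχ : Measurable χ) :
    ∫⁻ s, χ s ∂waitLaw f = ∫⁻ s in Ioi 0, ENNReal.ofReal (f s) * χ s :=
  lintegral_withDensity_eq_lintegral_mul _ hf.ennreal_ofReal hχ

namespace IsWaitingDensity

variable {f : ℝ → ℝ}

lemma integrableOn (hf : IsWaitingDensity f) : IntegrableOn f (Ioi 0) := by
  by_contra h
  have := hf.integral_eq_one
  rw [integral_undef h] at this
  exact zero_ne_one this

lemma ae_nonneg (hf : IsWaitingDensity f) : 0 ≤ᵐ[volume.restrict (Ioi 0)] f := by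
  filter_upwards [ae_restrict_mem measurableSet_Ioi] with t ht
  exact hf.nonneg t (le_of_lt ht)

lemma isWaitingLaw (hf : IsWaitingDensity f) : IsWaitingLaw (waitLaw f) where
  isProbabilityMeasure := ⟨by
    rw [waitLaw, withDensity_apply _ MeasurableSet.univ, Measure.restrict_univ,
      ← ofReal_integral_eq_lintegral_ofReal hf.integrableOn hf.ae_nonneg, hf.integral_eq_one,
      ENNReal.ofReal_one]⟩
  noAtoms := ⟨fun x => withDensity_absolutelyContinuous _ _ (measure_singleton x)⟩
  pos := (withDensity_absolutelyContinuous _ _).ae_le (ae_restrict_mem measurableSet_Ioi)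

lemma waitLaw_Ioi (hf : IsWaitingDensity f) {t : ℝ} (ht : 0 < t) :
    waitLaw f (Ioi t) = ENNReal.ofReal (1 - cdfOf f t) := by
  have hsub : Ioi t ⊆ Ioi 0 := Ioi_subset_Ioi ht.le
  have hint := hf.integrableOn.mono_set hsub
  have hnn : 0 ≤ᵐ[volume.restrict (Ioi t)] f := by
    filter_upwards [ae_restrict_mem measurableSet_Ioi] with s hs
    exact hf.nonneg s (ht.le.trans (le_of_lt hs))
  rw [waitLaw, withDensity_apply _ measurableSet_Ioi, Measure.restrict_restrict measurableSet_Ioi,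
    inter_eq_left.2 hsub, ← ofReal_integral_eq_lintegral_ofReal hint hnn]
  congr 1
  have := intervalIntegral.integral_interval_add_Ioi hf.integrableOn hint
  rw [hf.integral_eq_one] at this
  rw [cdfOf]
  linarith

lemma rate_nonneg (hf : IsWaitingDensity f) : 0 ≤ rate f :=
  inv_nonneg.2 (setIntegral_nonneg measurableSet_Ioi fun t ht =>
    mul_nonneg (le_of_lt ht) (hf.nonneg t (le_of_lt ht)))

lemma delayLaw_eq (hf : IsWaitingDensity f) :
    (volume.restrict (Ioi 0)).withDensity (fun t => ENNReal.ofReal (rate f * (1 - cdfOf f t))) =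
      delayLaw (ENNReal.ofReal (rate f)) (waitLaw f) := by
  refine withDensity_congr_ae ?_
  filter_upwards [ae_restrict_mem measurableSet_Ioi] with t ht
  rw [hf.waitLaw_Ioi ht, ENNReal.ofReal_mul hf.rate_nonneg]

lemma measurable_convPow (hf : IsWaitingDensity f) : ∀ n, Measurable (convPow f n)
  | 0 => hf.measurable.ennreal_ofReal
  | n + 1 => by
      have h1 : Measurable fun q : ℝ × ℝ => {q : ℝ × ℝ | q.2 ∈ Ioo 0 q.1}.indicator
          (fun q => convPow f n (q.1 - q.2) * ENNReal.ofReal (f q.2)) q := by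
        refine Measurable.indicator ?_ ?_
        · have := hf.measurable_convPow n
          have := hf.measurable
          fun_prop
        · exact (measurableSet_lt measurable_const measurable_snd).inter
            (measurableSet_lt measurable_snd measurable_fst)
      have h2 : convPow f (n + 1) = fun t => ∫⁻ s, {q : ℝ × ℝ | q.2 ∈ Ioo 0 q.1}.indicator
          (fun q => convPow f n (q.1 - q.2) * ENNReal.ofReal (f q.2)) (t, s) := by
        funext t
        change ∫⁻ s in Ioo 0 t, convPow f n (t - s) * ENNReal.ofReal (f s) = _
        rw [← lintegral_indicator measurableSet_Ioo]
        rfl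
      rw [h2]
      exact h1.lintegral_prod_right'

lemma measurable_renewalDensity (hf : IsWaitingDensity f) : Measurable (renewalDensity f) :=
  Measurable.tsum fun n => hf.measurable_convPow n

/-- The iterates of the translation operator have the convolution powers as kernels. -/
lemma iterate_shiftOp_waitLaw (hf : IsWaitingDensity f) (n : ℕ) {χ : ℝ → ℝ≥0∞}
    (hχ : Measurable χ) (t : ℝ) :
    (shiftOp (waitLaw f))^[n + 1] χ t = ∫⁻ s in Ioi 0, convPow f n s * χ (t + s) := by
  induction n generalizing χ with
  | zero => exact lintegral_waitLaw hf.measurable (by fun_prop)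
  | succ n ih =>
    have hp := hf.measurable_convPow n
    have hfm := hf.measurable
    rw [Function.iterate_succ_apply, ih (measurable_shiftOp hχ)]
    have hK : Measurable fun q : ℝ × ℝ => (Ioi (0 : ℝ)).indicator
        (fun r => (Ioi (0 : ℝ)).indicator (convPow f n) (q.2 - r) * ENNReal.ofReal (f r) *
          χ (t + q.2)) q.1 := by
      have h0 : Measurable ((Ioi (0 : ℝ)).indicator (convPow f n)) := hp.indicator measurableSet_Ioi
      have h1 : (fun q : ℝ × ℝ => (Ioi (0 : ℝ)).indicator
          (fun r => (Ioi (0 : ℝ)).indicator (convPow f n) (q.2 - r) * ENNReal.ofReal (f r) *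
            χ (t + q.2)) q.1) = {q : ℝ × ℝ | 0 < q.1}.indicator
          fun q => (Ioi (0 : ℝ)).indicator (convPow f n) (q.2 - q.1) * ENNReal.ofReal (f q.1) *
            χ (t + q.2) := by
        ext q; rfl
      rw [h1]
      exact Measurable.indicator (by fun_prop) (measurableSet_lt measurable_const measurable_fst)
    calc ∫⁻ s in Ioi 0, convPow f n s * shiftOp (waitLaw f) χ (t + s)
        = ∫⁻ s in Ioi 0, ∫⁻ r in Ioi 0,
            convPow f n s * (ENNReal.ofReal (f r) * χ (t + s + r)) := by
          refine lintegral_congr fun s => ?_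
          have h1 : Measurable fun r => ENNReal.ofReal (f r) * χ (t + s + r) := by fun_prop
          have h2 : shiftOp (waitLaw f) χ (t + s) =
              ∫⁻ r in Ioi 0, ENNReal.ofReal (f r) * χ (t + s + r) :=
            lintegral_waitLaw hf.measurable (by fun_prop)
          rw [h2, lintegral_const_mul _ h1]
      _ = ∫⁻ r in Ioi 0, ∫⁻ s in Ioi 0,
            convPow f n s * (ENNReal.ofReal (f r) * χ (t + s + r)) :=
          lintegral_lintegral_swap (by fun_prop)
      -- Substitution u = s + r. The indicator records s > 0; after the swap it confines r to (0,u),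
      -- the domain of integration in `convPow`.
      _ = ∫⁻ r in Ioi 0, ∫⁻ u, (Ioi (0 : ℝ)).indicator (convPow f n) (u - r) *
            ENNReal.ofReal (f r) * χ (t + u) := by
          refine lintegral_congr fun r => ?_
          rw [← lintegral_indicator measurableSet_Ioi, ← lintegral_sub_right_eq_self _ r]
          refine lintegral_congr fun u => ?_
          by_cases hu : r < u
          · simp [indicator, hu, mul_assoc, add_assoc]
          · simp [indicator, hu]
      _ = ∫⁻ r, ∫⁻ u, (Ioi (0 : ℝ)).indicator
            (fun r => (Ioi (0 : ℝ)).indicator (convPow f n) (u - r) * ENNReal.ofReal (f r) *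
              χ (t + u)) r := by
          rw [← lintegral_indicator measurableSet_Ioi]
          refine lintegral_congr fun r => ?_
          by_cases hr : 0 < r <;> simp [indicator, hr]
      _ = ∫⁻ u, ∫⁻ r, (Ioi (0 : ℝ)).indicator
            (fun r => (Ioi (0 : ℝ)).indicator (convPow f n) (u - r) * ENNReal.ofReal (f r) *
              χ (t + u)) r := lintegral_lintegral_swap hK.aemeasurable
      _ = ∫⁻ u in Ioi 0, convPow f (n + 1) u * χ (t + u) := by
          rw [← lintegral_indicator measurableSet_Ioi]
          refine lintegral_congr fun u => ?_
          have h1 : Measurable fun r => (Ioo 0 u).indicator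
              (fun r => convPow f n (u - r) * ENNReal.ofReal (f r)) r :=
            Measurable.indicator (by fun_prop) measurableSet_Ioo
          have h2 : ∀ r, (Ioi (0 : ℝ)).indicator
              (fun r => (Ioi (0 : ℝ)).indicator (convPow f n) (u - r) * ENNReal.ofReal (f r) *
                χ (t + u)) r = (Ioo 0 u).indicator
                (fun r => convPow f n (u - r) * ENNReal.ofReal (f r)) r * χ (t + u) := by
            intro r
            by_cases hr : 0 < r <;> by_cases hr' : r < u <;> simp [indicator, hr, hr']
          simp only [h2]
          rw [lintegral_mul_const _ h1, lintegral_indicator measurableSet_Ioo]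
          by_cases hu : 0 < u
          · simp [indicator, hu, convPow]
          · simp [indicator, hu]

lemma tsum_iterate_shiftOp_waitLaw (hf : IsWaitingDensity f) {χ : ℝ → ℝ≥0∞}
    (hχ : Measurable χ) (t : ℝ) :
    ∑' n, (shiftOp (waitLaw f))^[n + 1] χ t = ∫⁻ s in Ioi 0, renewalDensity f s * χ (t + s) := by
  simp only [hf.iterate_shiftOp_waitLaw _ hχ]
  have hm : ∀ n, Measurable fun s => convPow f n s * χ (t + s) := fun n =>
    (hf.measurable_convPow n).mul (by fun_prop)
  rw [← lintegral_tsum fun n => (hm n).aemeasurable]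
  refine lintegral_congr fun s => ?_
  rw [ENNReal.tsum_mul_right, renewalDensity]

/-- Against e^{-s} the renewal density integrates to the convergent series ∑_{n≥1} q^n, with q = 𝔼
e^{-τ} < 1. -/
lemma ae_renewalDensity_lt_top (hf : IsWaitingDensity f) :
    ∀ᵐ s ∂volume.restrict (Ioi 0), renewalDensity f s < ⊤ := by
  have h1 := hf.tsum_iterate_shiftOp_waitLaw (measurable_expWeight 1) 0
  simp only [iterate_shiftOp_expWeight, ENNReal.tsum_mul_right, zero_add] at h1
  have h2 : ∫⁻ s in Ioi 0, renewalDensity f s * expWeight 1 s ≠ ⊤ := by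
    rw [← h1]
    refine ENNReal.mul_ne_top ?_ (expWeight_ne_top _ _)
    have hq := hf.isWaitingLaw.lintegral_expWeight_lt_one one_pos
    have h3 : ∑' n : ℕ, (∫⁻ s, expWeight 1 s ∂waitLaw f) ^ (n + 1) ≤
        ∑' n : ℕ, (∫⁻ s, expWeight 1 s ∂waitLaw f) ^ n :=
      ENNReal.tsum_le_tsum fun n => pow_le_pow_right_of_le_one' hq.le (Nat.le_succ n)
    refine ne_top_of_le_ne_top ?_ h3
    rw [ENNReal.tsum_geometric]
    exact (ENNReal.inv_lt_top.2 (tsub_pos_of_lt hq)).ne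
  have hm : Measurable fun s => renewalDensity f s * expWeight 1 s :=
    hf.measurable_renewalDensity.mul (measurable_expWeight 1)
  filter_upwards [ae_lt_top hm h2] with s hs
  refine lt_top_iff_ne_top.2 fun htop => ?_
  rw [htop, ENNReal.top_mul] at hs
  · exact lt_irrefl _ hs
  · rw [expWeight]
    exact (ENNReal.ofReal_pos.2 (Real.exp_pos _)).ne'

end IsWaitingDensity

/-! ### Integrals over the chamber -/

/-- The renewal density on `(0,∞)`, as a finite function on the line. -/
def finiteDensity (f : ℝ → ℝ) (s : ℝ) : ℝ≥0∞ :=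
  (Ioi (0 : ℝ)).indicator (fun s => ENNReal.ofReal (renewalDensity f s).toReal) s

lemma finiteDensity_ne_top (f : ℝ → ℝ) (s : ℝ) : finiteDensity f s ≠ ⊤ := by
  unfold finiteDensity indicator
  split_ifs <;> simp

lemma IsWaitingDensity.measurable_finiteDensity {f : ℝ → ℝ} (hf : IsWaitingDensity f) :
    Measurable (finiteDensity f) :=
  hf.measurable_renewalDensity.ennreal_toReal.ennreal_ofReal.indicator measurableSet_Ioi

/-- The absolute value of the integrand, with `g = |G - 1|`, extended by zero. -/
def chamberWeight (f : ℝ → ℝ) (g : ℝ → ℝ≥0∞) (n : ℕ) (t : Fin (n + 1) → ℝ) : ℝ≥0∞ :=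
  (∏ i, g (t i)) * ∏ i : Fin n, finiteDensity f (t i.succ - t i.castSucc)

lemma chamberWeight_cons (f : ℝ → ℝ) (g : ℝ → ℝ≥0∞) (n : ℕ) (x : ℝ) (t : Fin (n + 1) → ℝ) :
    chamberWeight f g (n + 1) (Fin.cons x t : Fin (n + 2) → ℝ) =
      g x * (finiteDensity f (t 0 - x) * chamberWeight f g n t) := by
  rw [chamberWeight, chamberWeight, Fin.prod_univ_succ, Fin.prod_univ_succ fun i : Fin (n + 1) =>
    finiteDensity f ((Fin.cons x t : Fin (n + 2) → ℝ) i.succ -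
      (Fin.cons x t : Fin (n + 2) → ℝ) i.castSucc)]
  have h1 : (Fin.cons x t : Fin (n + 2) → ℝ) (Fin.succ 0) = t 0 := Fin.cons_succ _ _ _
  have h2 : ∀ i : Fin n, (Fin.cons x t : Fin (n + 2) → ℝ) (Fin.castSucc i.succ) =
      t i.castSucc := fun i => by
    rw [← Fin.succ_castSucc, Fin.cons_succ]
  simp only [Fin.cons_zero, Fin.cons_succ, Fin.castSucc_zero, h2]
  ring

section chamberIntegral

variable {f : ℝ → ℝ} {g : ℝ → ℝ≥0∞}

lemma measurable_chamberWeight (hf : IsWaitingDensity f) (hg : Measurable g) (n : ℕ) :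
    Measurable (chamberWeight f g n) := by
  have := hf.measurable_finiteDensity
  unfold chamberWeight
  fun_prop

/-- The renewal density is the kernel of ∑_{n≥1} K^n. Passing to `finiteDensity` alters it on (0,∞)
only where it is infinite, a null set. -/
lemma renewalTerm_succ_eq (hf : IsWaitingDensity f) (hg : Measurable g) (k : ℕ) (t : ℝ) :
    renewalTerm (waitLaw f) g (k + 1) t =
      ∫⁻ u, finiteDensity f (u - t) * (g u * renewalTerm (waitLaw f) g k u) := by
  have hm : Measurable fun s => g s * renewalTerm (waitLaw f) g k s :=
    hg.mul (measurable_renewalTerm hg k)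
  change ∑' n, (shiftOp (waitLaw f))^[n + 1]
    (fun s => g s * renewalTerm (waitLaw f) g k s) t = _
  rw [hf.tsum_iterate_shiftOp_waitLaw hm, ← lintegral_indicator measurableSet_Ioi]
  refine Eq.trans ?_ (lintegral_add_right_eq_self (fun u => finiteDensity f (u - t) *
    (g u * renewalTerm (waitLaw f) g k u)) t)
  have hfin := hf.ae_renewalDensity_lt_top
  rw [ae_restrict_iff' measurableSet_Ioi] at hfin
  refine lintegral_congr_ae ?_
  filter_upwards [hfin] with s hs
  by_cases h : 0 < s
  · simp [indicator, finiteDensity, h, ENNReal.ofReal_toReal (hs h).ne, add_comm]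
  · simp [indicator, finiteDensity, h]

/-- Integration over the chamber, one coordinate after the other. -/
lemma lintegral_chamberWeight (hf : IsWaitingDensity f) (hg : Measurable g) (n : ℕ)
    {ψ : ℝ → ℝ≥0∞} (hψ : Measurable ψ) :
    ∫⁻ t, ψ (t 0) * chamberWeight f g n t =
      ∫⁻ s, ψ s * (g s * renewalTerm (waitLaw f) g n s) := by
  -- The factor ψ(t 0) is there for the induction: it takes up the link `finiteDensity f (t 0 - x)`
  -- to a new first coordinate x.
  induction n generalizing ψ with
  | zero =>
    refine ((volume_preserving_funUnique (Fin 1) ℝ).symm.lintegral_comp_emb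
      (MeasurableEquiv.measurableEmbedding _) _).symm.trans (lintegral_congr fun s => ?_)
    simp [chamberWeight, renewalTerm]
  | succ n ih =>
    have hφ := hf.measurable_finiteDensity
    have hc := measurable_chamberWeight hf hg n
    rw [← (volume_preserving_piFinSuccAbove (fun _ : Fin (n + 2) => ℝ) 0).symm.lintegral_comp_emb
      (MeasurableEquiv.measurableEmbedding _)]
    have h1 : ∀ q : ℝ × (Fin (n + 1) → ℝ),
        (MeasurableEquiv.piFinSuccAbove (fun _ : Fin (n + 2) => ℝ) 0).symm q =
          Fin.cons q.1 q.2 := by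
      intro q
      simp only [MeasurableEquiv.piFinSuccAbove_symm_apply, Fin.insertNthEquiv_zero]
      rfl
    simp only [h1, chamberWeight_cons, Fin.cons_zero]
    have hm : Measurable fun q : ℝ × (Fin (n + 1) → ℝ) =>
        ψ q.1 * (g q.1 * (finiteDensity f (q.2 0 - q.1) * chamberWeight f g n q.2)) := by
      fun_prop
    rw [Measure.volume_eq_prod, lintegral_prod _ hm.aemeasurable]
    refine lintegral_congr fun x => ?_
    have hm1 : Measurable fun t : Fin (n + 1) → ℝ =>
        finiteDensity f (t 0 - x) * chamberWeight f g n t := by fun_prop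
    dsimp only
    rw [lintegral_const_mul _ (hm1.const_mul _), lintegral_const_mul _ hm1,
      ih (ψ := fun s => finiteDensity f (s - x)) (by fun_prop), renewalTerm_succ_eq hf hg]

lemma chamberWeight_ne_top (hg1 : ∀ t, g t ≤ 1) (n : ℕ) (t : Fin (n + 1) → ℝ) :
    chamberWeight f g n t ≠ ⊤ :=
  ENNReal.mul_ne_top
    (ENNReal.prod_ne_top fun _ _ => ((hg1 _).trans_lt ENNReal.one_lt_top).ne)
    (ENNReal.prod_ne_top fun _ _ => finiteDensity_ne_top _ _)

/-- The distance of `G` from `1` on `(0,∞)`. -/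
def deficit (G : ℝ → ℝ) (t : ℝ) : ℝ≥0∞ :=
  (Ioi (0 : ℝ)).indicator (fun t => ENNReal.ofReal (1 - G t)) t

lemma measurable_deficit {G : ℝ → ℝ} (hG : Measurable G) : Measurable (deficit G) :=
  (hG.const_sub 1).ennreal_ofReal.indicator measurableSet_Ioi

lemma deficit_le_one {G : ℝ → ℝ} (hG : ∀ t, G t ∈ Icc (0 : ℝ) 1) (t : ℝ) : deficit G t ≤ 1 := by
  unfold deficit indicator
  split_ifs
  · rw [← ENNReal.ofReal_one]
    exact ENNReal.ofReal_le_ofReal (by linarith [(hG t).1])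
  · exact zero_le

lemma toReal_deficit {G : ℝ → ℝ} (hG : ∀ t, G t ∈ Icc (0 : ℝ) 1) {t : ℝ} (ht : 0 < t) :
    (deficit G t).toReal = 1 - G t := by
  simp [deficit, indicator, ht, ENNReal.toReal_ofReal (sub_nonneg.2 (hG t).2)]

lemma measurableSet_chamber (n : ℕ) : MeasurableSet (chamber n) := by
  have : chamber n = {t | 0 < t 0} ∩ ⋂ i : Fin n, {t | t i.castSucc < t i.succ} := by
    ext t
    simp [chamber, Fin.strictMono_iff_lt_succ]
  rw [this]
  exact (measurableSet_lt measurable_const (measurable_pi_apply 0)).inter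
    (MeasurableSet.iInter fun i =>
      measurableSet_lt (measurable_pi_apply _) (measurable_pi_apply _))

/-- The weights absorb the chamber: `deficit` vanishes off (0,∞) and `finiteDensity` at nonpositive
gaps. Each of the n + 1 factors G - 1 contributes a sign. -/
lemma indicator_integrand {G : ℝ → ℝ} (hG : ∀ t, G t ∈ Icc (0 : ℝ) 1) (n : ℕ)
    (t : Fin (n + 1) → ℝ) :
    (chamber n).indicator (integrand f G n) t =
      (-1) ^ (n + 1) * (chamberWeight f (deficit G) n t).toReal := by
  by_cases ht : t ∈ chamber n
  · rw [indicator_of_mem ht]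
    have hpos : ∀ i, 0 < t i := fun i => ht.1.trans_le (ht.2.monotone (Fin.zero_le i))
    have hlt := Fin.strictMono_iff_lt_succ.1 ht.2
    rw [integrand, chamberWeight, ENNReal.toReal_mul, ENNReal.toReal_prod, ENNReal.toReal_prod,
      ← mul_assoc]
    congr 1
    · have hc : (-1 : ℝ) ^ (n + 1) = ∏ _i : Fin (n + 1), (-1 : ℝ) := by simp
      rw [hc, ← Finset.prod_mul_distrib]
      refine Finset.prod_congr rfl fun i _ => ?_
      rw [toReal_deficit hG (hpos i)]
      ring
    · refine Finset.prod_congr rfl fun i _ => ?_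
      simp [finiteDensity, indicator, hlt i]
  · rw [indicator_of_notMem ht]
    have : chamberWeight f (deficit G) n t = 0 := by
      by_cases h0 : 0 < t 0
      · have hmono : ¬ StrictMono t := fun h => ht ⟨h0, h⟩
        rw [Fin.strictMono_iff_lt_succ] at hmono
        push Not at hmono
        obtain ⟨i, hi⟩ := hmono
        refine mul_eq_zero_of_right _ (Finset.prod_eq_zero (Finset.mem_univ i) ?_)
        simp [finiteDensity, hi]
      · refine mul_eq_zero_of_left (Finset.prod_eq_zero (Finset.mem_univ 0) ?_) _
        simp [deficit, h0]
    simp [this]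

/-- The integrals over the chambers in terms of the terms of the renewal series. -/
lemma integral_chamber (hf : IsWaitingDensity f) {G : ℝ → ℝ} (hGm : Measurable G)
    (hG : ∀ t, G t ∈ Icc (0 : ℝ) 1) (n : ℕ)
    (hfin : ∫⁻ s, deficit G s * renewalTerm (waitLaw f) (deficit G) n s ≠ ⊤) :
    IntegrableOn (integrand f G n) (chamber n) ∧
      ∫ t in chamber n, integrand f G n t = (-1) ^ (n + 1) *
        (∫⁻ s, deficit G s * renewalTerm (waitLaw f) (deficit G) n s).toReal := by
  have hg := measurable_deficit hGm
  have hm := measurable_chamberWeight hf hg n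
  have h1 := lintegral_chamberWeight hf hg n (ψ := fun _ => 1) measurable_const
  simp only [one_mul] at h1
  have hind : (chamber n).indicator (integrand f G n) = fun t =>
      (-1) ^ (n + 1) * (chamberWeight f (deficit G) n t).toReal :=
    funext (indicator_integrand hG n)
  constructor
  · rw [← integrable_indicator_iff (measurableSet_chamber n), hind]
    exact (integrable_toReal_of_lintegral_ne_top hm.aemeasurable (h1 ▸ hfin)).const_mul _
  · rw [← integral_indicator (measurableSet_chamber n), hind, integral_const_mul,
      integral_toReal hm.aemeasurable (Eventually.of_forall fun t =>
        (chamberWeight_ne_top (deficit_le_one hG) n t).lt_top), h1]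

end chamberIntegral

/-! ### The p.g.fl. of the centre process -/

namespace IsRenewalWeight

variable {ρ : Measure ℝ} {g : ℝ → ℝ≥0∞} {l : ℝ} {C : ℝ≥0∞}

/-- The renewal series solves the renewal equation. -/
lemma renewalSeries_eq (hW : IsRenewalWeight ρ g l C) (t : ℝ) :
    renewalSeries ρ g t = ∫ s, (1 - (g (t + s)).toReal) * renewalSeries ρ g (t + s) ∂ρ := by
  have := hW.law.isProbabilityMeasure
  have hadd : Measurable fun s : ℝ => t + s := measurable_const_add t
  have hp : IsProbabilityMeasure (ρ.map fun s => t + s) :=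
    Measure.isProbabilityMeasure_map hadd.aemeasurable
  have hν : ∫⁻ s, expWeight l s ∂ρ.map (fun s => t + s) ≠ ⊤ := by
    rw [lintegral_map (measurable_expWeight l) hadd]
    simp only [expWeight_add]
    rw [lintegral_const_mul _ (measurable_expWeight l)]
    exact ENNReal.mul_ne_top (expWeight_ne_top _ _)
      (hW.law.lintegral_expWeight_lt_one hW.pos).ne_top
  have h1 := hW.hasSum_lintegral hν
  -- Under the law of t + τ the integrated terms are b_{n+1}(t) again. One series thus has two sums,
  -- and equating them is the renewal equation.
  have hterm : ∀ n, ∫⁻ s, (g s * renewalTerm ρ g n s + renewalTerm ρ g (n + 1) s)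
      ∂ρ.map (fun s => t + s) = renewalTerm ρ g (n + 1) t := by
    intro n
    have hm : Measurable fun s => g s * renewalTerm ρ g n s + renewalTerm ρ g (n + 1) s :=
      (hW.measurable.mul (measurable_renewalTerm hW.measurable n)).add
        (measurable_renewalTerm hW.measurable (n + 1))
    rw [lintegral_map hm hadd, renewalTerm_succ hW.measurable]
  simp only [hterm] at h1
  have hm : Measurable fun s => (1 - (g s).toReal) * renewalSeries ρ g s :=
    (hW.measurable.ennreal_toReal.const_sub 1).mul hW.measurable_renewalSeries
  rw [integral_map_of_stronglyMeasurable hadd hm.stronglyMeasurable] at h1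
  linarith [h1.unique (hW.hasSum_succ t)]

/-- As g b_n + b_{n+1} = ∑_{k≥0} K^k(g b_n), its integral against the delay is one against the mean
measure m dt of the epochs. Hence the single factor m and the flat measure dt₁ in the expansion. -/
lemma lintegral_mul_renewalTerm (hW : IsRenewalWeight ρ g l C) {m : ℝ≥0∞} (hm : m ≠ ⊤) (n : ℕ) :
    m * ∫⁻ t in Ioi 0, g t * renewalTerm ρ g n t =
      ∫⁻ t, (g t * renewalTerm ρ g n t + renewalTerm ρ g (n + 1) t) ∂delayLaw m ρ := by
  have := hW.law.isProbabilityMeasure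
  have hmeas : Measurable fun t => g t * renewalTerm ρ g n t :=
    hW.measurable.mul (measurable_renewalTerm hW.measurable n)
  have h1 := hW.law.tsum_lintegral_delayLaw hm hmeas hW.pos (C := (1 / 2) ^ n * C)
    (ENNReal.mul_ne_top (ENNReal.pow_ne_top (by simp)) hW.ne_top) (hW.mul_renewalTerm_le n)
  rw [← h1, lintegral_add_left hmeas]
  refine (tsum_eq_zero_add' (f := fun k => ∫⁻ t, (shiftOp ρ)^[k]
    (fun t => g t * renewalTerm ρ g n t) t ∂delayLaw m ρ) ENNReal.summable).trans ?_
  congr 1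
  simp only [renewalTerm]
  rw [lintegral_tsum fun k => (measurable_iterate_shiftOp hmeas (k + 1)).aemeasurable]

/-- Jumps go to the right, so from beyond R the walk never meets the support of g and only b_0 = 1
survives. -/
lemma renewalSeries_eq_one (hW : IsRenewalWeight ρ g l C) {R : ℝ} (hR : ∀ t, R < t → g t = 0)
    {t : ℝ} (ht : R < t) : renewalSeries ρ g t = 1 := by
  have hzero : ∀ n k t, R < t → (shiftOp ρ)^[n] (fun s => g s * renewalTerm ρ g k s) t = 0 := by
    intro n k
    induction n with
    | zero => intro t ht; simp [hR t ht]
    | succ n ih =>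
      intro t ht
      rw [Function.iterate_succ_apply', shiftOp, lintegral_eq_zero_of_ae_eq_zero]
      filter_upwards [hW.law.pos] with s hs
      exact ih _ (by linarith)
  have h1 : ∀ k, renewalTerm ρ g (k + 1) t = 0 := fun k =>
    ENNReal.tsum_eq_zero.2 fun n => hzero _ _ _ ht
  have h2 := hW.hasSum_succ t
  simp only [h1, ENNReal.toReal_zero, mul_zero] at h2
  linarith [h2.unique hasSum_zero]

end IsRenewalWeight

/-- First l is taken large enough for the eigenvalue to be below 1/4; then C = e^{lR} makes C
e^{-lt} at least 1 up to R. -/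
lemma exists_isRenewalWeight {ρ : Measure ℝ} (hρ : IsWaitingLaw ρ) {g : ℝ → ℝ≥0∞}
    (hg : Measurable g) (hg1 : ∀ t, g t ≤ 1) {R : ℝ} (hR : ∀ t, R < t → g t = 0) :
    ∃ l C, IsRenewalWeight ρ g l C := by
  obtain ⟨l, hl, hsmall⟩ := hρ.exists_lintegral_expWeight_lt
    (ε := 1 / 4) (ENNReal.div_pos one_ne_zero (by simp))
  refine ⟨l, ENNReal.ofReal (Real.exp (l * R)), hρ, hg, hg1, fun t => ?_, hl,
    ENNReal.ofReal_ne_top, hsmall⟩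
  by_cases ht : R < t
  · simp [hR t ht]
  · refine (hg1 t).trans ?_
    rw [expWeight, ← ENNReal.ofReal_mul (Real.exp_nonneg _), ← Real.exp_add, ← ENNReal.ofReal_one]
    exact ENNReal.ofReal_le_ofReal (Real.one_le_exp (by nlinarith))

section centre

variable {Ω : Type*} [MeasurableSpace Ω] {P : Measure Ω} {f h : ℝ → ℝ}
  {T : ℕ → Ω → ℝ} {D : ℕ × List ℕ → Ω → ℕ × (ℕ → ℝ)}

lemma IsInput.map_wait_zero (hTD : IsInput P f h T D) (hf : IsWaitingDensity f) :
    P.map (T 0) = delayLaw (ENNReal.ofReal (rate f)) (waitLaw f) :=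
  hTD.law_delay.trans hf.delayLaw_eq

lemma IsInput.ae_wait_pos (hTD : IsInput P f h T D) (hf : IsWaitingDensity f) :
    ∀ᵐ t ∂P.map (T 0), 0 < t := by
  rw [hTD.map_wait_zero hf]
  exact delayLaw_pos _ _

variable [IsProbabilityMeasure P]

/-- The p.g.fl. of the centre process through a solution of the renewal equation. -/
lemma IsInput.pgfl_centre_eq (hTD : IsInput P f h T D) (hf : IsWaitingDensity f) {G v B : ℝ → ℝ}
    (hv : Measurable v) (hv' : ∀ t, v t ∈ Icc (0 : ℝ) 1) (hGv : ∀ t, 0 < t → G t = v t)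
    (hB : Measurable B) {C : ℝ} (hBC : ∀ t, 0 < t → |B t| ≤ C) {R : ℝ} (hBR : ∀ t, R < t → B t = 1)
    (heq : ∀ t, 0 < t → B t = ∫ s, v (t + s) * B (t + s) ∂waitLaw f) :
    pgfl P (centre T) G = ∫ t, v t * B t ∂P.map (T 0) := by
  have _ n := Measure.isProbabilityMeasure_map (μ := P) (hTD.measurable_wait n).aemeasurable
  have hT : Measurable fun ω n => T n ω := measurable_pi_lambda _ hTD.measurable_wait
  have h0 := hTD.ae_wait_pos hf
  rw [← integral_expNeg_walk (M := fun n => P.map (T n)) hTD.law_wait hf.isWaitingLaw h0 hv hv' hB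
    hBC hBR heq, ← hTD.map_wait]
  have hm : Measurable fun x => expNeg (∑' n, negLog (v (partialSum x n))) :=
    measurable_expNeg.comp (Measurable.tsum fun n =>
      measurable_negLog.comp (hv.comp (measurable_partialSum n)))
  rw [integral_map_of_stronglyMeasurable hT hm.stronglyMeasurable, pgfl]
  have hpos : ∀ᵐ x ∂P.map (fun ω n => T n ω), ∀ n, 0 < x n := by
    rw [hTD.map_wait]
    refine ae_pos_of_law fun n => ?_
    cases n with
    | zero => exact h0
    | succ n => rw [hTD.law_wait n]; exact hf.isWaitingLaw.pos
  refine integral_congr_ae ?_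
  filter_upwards [ae_of_ae_map hT.aemeasurable hpos] with ω hω
  rw [lintegral_centre]
  congr 1
  refine tsum_congr fun n => ?_
  rw [epoch_eq, hGv _ (partialSum_pos hω n)]

/-- The expansion of the p.g.fl. of the centre process. -/
lemma IsInput.hasSum_pgfl_centre (hTD : IsInput P f h T D) (hf : IsWaitingDensity f) {G : ℝ → ℝ}
    (hGm : Measurable G) (hG : ∀ t, G t ∈ Icc (0 : ℝ) 1) {R : ℝ} (hR : ∀ t, R < t → G t = 1) :
    (∀ n, IntegrableOn (integrand f G n) (chamber n)) ∧
      HasSum (fun n => rate f * ∫ t in chamber n, integrand f G n t) (pgfl P (centre T) G - 1) := by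
  set g := deficit G
  have hg : Measurable g := measurable_deficit hGm
  have hg1 : ∀ t, g t ≤ 1 := deficit_le_one hG
  have hgR : ∀ t, R < t → g t = 0 := fun t ht => by simp [g, deficit, indicator, hR t ht]
  have hρ := hf.isWaitingLaw
  have := hρ.isProbabilityMeasure
  obtain ⟨l, C, hW⟩ := exists_isRenewalWeight hρ hg hg1 hgR
  have hIoi : ∀ n, ∫⁻ s, g s * renewalTerm (waitLaw f) g n s =
      ∫⁻ s in Ioi 0, g s * renewalTerm (waitLaw f) g n s := by
    intro n
    rw [← lintegral_indicator measurableSet_Ioi]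
    refine lintegral_congr fun s => ?_
    by_cases hs : 0 < s <;> simp [indicator, hs, g, deficit]
  have hfin : ∀ n, ∫⁻ s, g s * renewalTerm (waitLaw f) g n s ≠ ⊤ := by
    intro n
    rw [hIoi]
    refine ne_top_of_le_ne_top ?_ (lintegral_mono (hW.mul_renewalTerm_le n))
    rw [lintegral_const_mul _ (measurable_expWeight l)]
    exact ENNReal.mul_ne_top (ENNReal.mul_ne_top (ENNReal.pow_ne_top (by simp)) hW.ne_top)
      (IsWaitingLaw.lintegral_expWeight_Ioi_ne_top hW.pos)
  refine ⟨fun n => (integral_chamber hf hGm hG n (hfin n)).1, ?_⟩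
  set m := ENNReal.ofReal (rate f)
  have hp : IsProbabilityMeasure (delayLaw m (waitLaw f)) := by
    rw [← hTD.map_wait_zero hf]
    exact Measure.isProbabilityMeasure_map (hTD.measurable_wait 0).aemeasurable
  have hν : ∫⁻ t, expWeight l t ∂delayLaw m (waitLaw f) ≠ ⊤ := by
    refine ne_top_of_le_ne_top (b := ∫⁻ _, 1 ∂delayLaw m (waitLaw f)) (by simp)
      (lintegral_mono_ae ?_)
    filter_upwards [delayLaw_pos m (waitLaw f)] with t ht
    rw [expWeight, ← ENNReal.ofReal_one]
    exact ENNReal.ofReal_le_ofReal (Real.exp_le_one_iff.2 (by nlinarith [hW.pos]))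
  have h1 := hW.hasSum_lintegral hν
  have hg0 : ∀ t, (g t).toReal ∈ Icc (0 : ℝ) 1 := fun t =>
    ⟨ENNReal.toReal_nonneg, ENNReal.toReal_le_of_le_ofReal zero_le_one (by simpa using hg1 t)⟩
  have h2 : pgfl P (centre T) G =
      ∫ t, (1 - (g t).toReal) * renewalSeries (waitLaw f) g t ∂delayLaw m (waitLaw f) := by
    rw [← hTD.map_wait_zero hf]
    -- 1 - g equals G only on (0,∞), which suffices because all epochs are almost surely positive.
    refine hTD.pgfl_centre_eq hf (v := fun t => 1 - (g t).toReal)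
      (hg.ennreal_toReal.const_sub 1) (fun t => ⟨?_, ?_⟩) (fun t ht => ?_)
      hW.measurable_renewalSeries (C := 1 + C.toReal) (fun t ht => ?_)
      (fun t ht => hW.renewalSeries_eq_one hgR ht) fun t _ => hW.renewalSeries_eq t
    · linarith [(hg0 t).2]
    · linarith [(hg0 t).1]
    · rw [toReal_deficit hG ht]
      ring
    · have h3 := abs_le.1 (hW.abs_renewalSeries_sub_le t)
      have h4 : IsRenewalWeight.bound l C t ≤ C.toReal := by
        refine mul_le_of_le_one_right ENNReal.toReal_nonneg ?_
        rw [expWeight, ENNReal.toReal_ofReal (Real.exp_nonneg _)]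
        exact Real.exp_le_one_iff.2 (by nlinarith [hW.pos])
      rw [abs_le]
      constructor <;> linarith
  rw [h2]
  refine (congrArg (fun u => HasSum u _) (funext fun n => ?_)).mp h1
  rw [(integral_chamber hf hGm hG n (hfin n)).2, hIoi, ← hW.lintegral_mul_renewalTerm
    ENNReal.ofReal_ne_top, ENNReal.toReal_mul, ENNReal.toReal_ofReal hf.rate_nonneg]
  ring

end centre

/-! ### The cluster p.g.fl. of a function in `Ξ` -/

/-- A cluster started beyond R stays there and meets only z = 1. On the left there is no such bound,
so the cluster p.g.fl. need not lie in `Xi`; the expansion uses the right-hand bound alone. -/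
lemma truncPgfl_eq_one {h z : ℝ → ℝ} {R : ℝ} (hR : ∀ t, R < t → z t = 1) :
    ∀ n t, R < t → truncPgfl h z n t = 1
  | 0, t, ht => hR t ht
  | n + 1, t, ht => by
      have h1 : ∫ s in Ioi (0 : ℝ), (truncPgfl h z n (t + s) - 1) * h s = 0 :=
        setIntegral_eq_zero_of_forall_eq_zero fun s hs => by
          rw [truncPgfl_eq_one hR n (t + s) (by linarith [mem_Ioi.1 hs]), sub_self, zero_mul]
      change z t * offspringPgfl h (truncPgfl h z n) t = 1
      rw [hR t ht, offspringPgfl, h1, Real.exp_zero, one_mul]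

lemma exists_forall_eq_one {z : ℝ → ℝ} (hz : z ∈ Xi) : ∃ R, ∀ t, R < t → z t = 1 := by
  obtain ⟨-, -, B, hB, h1⟩ := hz
  obtain ⟨R, hR⟩ := hB.bddAbove
  exact ⟨R, fun t ht => h1 t fun hmem => (hR hmem).not_gt ht⟩

section clusterPgfl

variable {Ω : Type*} [MeasurableSpace Ω] {P : Measure Ω}
  {D : ℕ × List ℕ → Ω → ℕ × (ℕ → ℝ)}

lemma clusterPgfl_translate (z : ℝ → ℝ) (s : ℝ) :
    clusterPgfl P D (fun x => z (s + x)) 0 = clusterPgfl P D z s := by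
  have h1 : ∀ d u, time d s u = s + time d 0 u := fun d u => by rw [← time_add, add_zero]
  simp only [clusterPgfl, pgfl, lintegral_cluster, h1]

variable [IsProbabilityMeasure P] {f h : ℝ → ℝ} {T : ℕ → Ω → ℝ} {z : ℝ → ℝ}

lemma IsInput.measurable_clusterPgfl (hTD : IsInput P f h T D) (hh : IsOffspringDensity h)
    (hz : z ∈ Xi) : Measurable (clusterPgfl P D z) := by
  rw [funext (hTD.clusterPgfl_eq hh hz.1 hz.2.1)]
  exact measurable_expNeg.comp (measurable_clusterExponent hh hz.1)

lemma IsInput.clusterPgfl_mem (hTD : IsInput P f h T D) (hh : IsOffspringDensity h)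
    (hz : z ∈ Xi) (t : ℝ) : clusterPgfl P D z t ∈ Icc (0 : ℝ) 1 := by
  rw [hTD.clusterPgfl_eq hh hz.1 hz.2.1]
  exact ⟨expNeg_nonneg _, expNeg_le_one _⟩

lemma IsInput.clusterPgfl_eq_one (hTD : IsInput P f h T D) (hh : IsOffspringDensity h)
    (hz : z ∈ Xi) {R : ℝ} (hR : ∀ t, R < t → z t = 1) {t : ℝ} (ht : R < t) :
    clusterPgfl P D z t = 1 := by
  rw [hTD.clusterPgfl_eq hh hz.1 hz.2.1, clusterExponent]
  simp [truncPgfl_eq_one hR _ t ht, negLog_one, expNeg_zero]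

end clusterPgfl

/-! ### The centre process -/

section centre

variable {Ω : Type*} [MeasurableSpace Ω] {P : Measure Ω} [IsProbabilityMeasure P] {f h : ℝ → ℝ}
  {T : ℕ → Ω → ℝ} {D : ℕ × List ℕ → Ω → ℕ × (ℕ → ℝ)}

lemma IsInput.map_centre_shift (hTD : IsInput P f h T D) (hf : IsWaitingDensity f) {s : ℝ}
    (hs : 0 ≤ s) :
    P.map (fun ω => ((centre T ω).map fun x => x - s).restrict (Ici 0)) = P.map (centre T) := by
  have _ n := hTD.isProbabilityMeasure_wait n
  have hT : Measurable fun ω n => T n ω := measurable_pi_lambda _ hTD.measurable_wait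
  have key := map_shiftMeasure_epochMeasure (M := fun n => P.map (T n)) (ρ := waitLaw f)
    hTD.law_wait hf.isWaitingLaw ENNReal.ofReal_ne_top (hTD.map_wait_zero hf) hs
  have hΘ : Measurable fun x => shiftMeasure s (epochMeasure x) :=
    (measurable_shiftMeasure s).comp measurable_epochMeasure
  rw [← hTD.map_wait, Measure.map_map hΘ hT, Measure.map_map measurable_epochMeasure hT] at key
  exact key

lemma IsInput.ae_finite_epoch_le (hTD : IsInput P f h T D) (hf : IsWaitingDensity f) :
    ∀ᵐ ω ∂P, ∀ R : ℝ, {i | epoch T i ω ≤ R}.Finite := by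
  have _ n := hTD.isProbabilityMeasure_wait n
  have hT : Measurable fun ω n => T n ω := measurable_pi_lambda _ hTD.measurable_wait
  have key := ae_tendsto_partialSum (M := fun n => P.map (T n)) hTD.law_wait hf.isWaitingLaw
    (hTD.ae_wait_pos hf)
  rw [← hTD.map_wait] at key
  filter_upwards [ae_of_ae_map hT.aemeasurable key] with ω hω R
  have h1 := hω.eventually_gt_atTop R
  rw [← Nat.cofinite_eq_atTop, eventually_cofinite] at h1
  simp only [not_lt] at h1
  exact h1

end centre

/-! ### Exponential waiting times -/

/-- The exponential of an indefinite integral of a bounded function satisfies its linear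
differential equation in integrated form. -/
lemma integral_mul_exp_integral {w : ℝ → ℝ} (hw : Measurable w) (hw' : ∀ t, w t ∈ Icc (0 : ℝ) 1)
    (μ a b : ℝ) :
    ∫ s in a..b, μ * w s * Real.exp (-(μ * ∫ x in b..s, w x)) =
      Real.exp (μ * ∫ x in a..b, w x) - 1 := by
  have hbd : ∀ t, ‖w t‖ ≤ 1 := fun t => by
    rw [Real.norm_eq_abs, abs_le]
    exact ⟨by linarith [(hw' t).1], (hw' t).2⟩
  have hloc : LocallyIntegrable w :=
    (locallyIntegrable_const (1 : ℝ)).mono hw.aestronglyMeasurable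
      (Eventually.of_forall fun t => by simpa using hbd t)
  have hint : ∀ x y, IntervalIntegrable w volume x y := fun x y =>
    intervalIntegrable_iff.2
      ((hloc.integrableOn_isCompact isCompact_uIcc).mono_set uIoc_subset_uIcc)
  have hsub : ∀ x y, ‖∫ t in x..y, w t‖ ≤ |y - x| := fun x y => by
    simpa using intervalIntegral.norm_integral_le_of_norm_le_const (a := x) (b := y)
      fun t _ => hbd t
  have hΦ : LipschitzWith 1 fun s => ∫ x in b..s, w x :=
    LipschitzWith.of_dist_le_mul fun x y => by
      rw [dist_eq_norm, intervalIntegral.integral_interval_sub_left (hint _ _) (hint _ _),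
        NNReal.coe_one, one_mul, Real.dist_eq]
      exact hsub _ _
  have hmaps : MapsTo (fun s => ∫ x in b..s, w x) (uIcc a b) (Icc (-|a - b|) |a - b|) := by
    intro s hs
    have h1 := abs_sub_right_of_mem_uIcc hs
    rw [abs_sub_comm, abs_sub_comm b a] at h1
    exact abs_le.1 ((hsub b s).trans h1)
  have hcd : ContDiffOn ℝ 1 (fun y => Real.exp (-(μ * y))) (Icc (-|a - b|) |a - b|) := by
    fun_prop
  obtain ⟨K, hK⟩ := hcd.exists_lipschitzOnWith one_ne_zero (convex_Icc _ _) isCompact_Icc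
  -- As w is merely measurable, its integral is known to be differentiable only almost everywhere.
  -- The integral is Lipschitz and the exponential is Lipschitz on its bounded range; absolute
  -- continuity then gives the fundamental theorem.
  have hac : AbsolutelyContinuousOnInterval
      (fun s => Real.exp (-(μ * ∫ x in b..s, w x))) a b :=
    (hK.comp (hΦ.lipschitzOnWith (s := uIcc a b)) hmaps).absolutelyContinuousOnInterval
  have key := hac.integral_deriv_eq_sub
  have hder : ∀ᵐ s, deriv (fun s => Real.exp (-(μ * ∫ x in b..s, w x))) s =
      -(μ * w s * Real.exp (-(μ * ∫ x in b..s, w x))) := by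
    filter_upwards [LocallyIntegrable.ae_hasDerivAt_integral hloc] with s hs
    refine ((hs b).const_mul μ).neg.exp.deriv.trans ?_
    simp only [Pi.neg_apply]
    ring
  rw [intervalIntegral.integral_congr_ae (hder.mono fun s hs _ => hs),
    intervalIntegral.integral_neg, intervalIntegral.integral_same, mul_zero, neg_zero,
    Real.exp_zero, intervalIntegral.integral_symm a b, mul_neg, neg_neg] at key
  linarith

section exponential

variable {f : ℝ → ℝ} {μ : ℝ}

lemma waitLaw_exponential (hexp : ∀ᵐ t, 0 < t → f t = μ * Real.exp (-(μ * t))) :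
    waitLaw f = waitLaw fun t => μ * Real.exp (-(μ * t)) := by
  refine withDensity_congr_ae ?_
  filter_upwards [(ae_restrict_iff' measurableSet_Ioi).2 hexp] with t ht
  rw [ht]

lemma integral_exponential_Ioi (hμ : 0 < μ) (t : ℝ) :
    ∫ s in Ioi t, μ * Real.exp (-(μ * s)) = Real.exp (-(μ * t)) := by
  have h1 := integral_exp_mul_Ioi (neg_lt_zero.2 hμ) t
  rw [integral_const_mul]
  simp only [← neg_mul]
  rw [h1]
  field_simp

lemma rate_exponential (hμ : 0 < μ) (hexp : ∀ᵐ t, 0 < t → f t = μ * Real.exp (-(μ * t))) :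
    rate f = μ := by
  have h1 : ∫ t in Ioi (0 : ℝ), t * f t =
      ∫ t in Ioi (0 : ℝ), μ * (t ^ ((2 : ℝ) - 1) * Real.exp (-(μ * t))) := by
    refine setIntegral_congr_ae measurableSet_Ioi ?_
    filter_upwards [hexp] with t ht h0
    rw [ht h0, show (2 : ℝ) - 1 = 1 by norm_num, Real.rpow_one]
    ring
  rw [rate, h1, integral_const_mul, Real.integral_rpow_mul_exp_neg_mul_Ioi two_pos hμ, Real.rpow_two,
    Real.Gamma_two]
  field_simp

/-- The convolution powers are gamma densities: the exponentials combine to e^{-μt}, and ∫₀ᵗ (t-s)^n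
ds = t^(n+1)/(n+1). -/
lemma convPow_exponential (hμ : 0 < μ) (hexp : ∀ᵐ t, 0 < t → f t = μ * Real.exp (-(μ * t)))
    (n : ℕ) :
    ∀ᵐ t, 0 < t → convPow f n t =
      ENNReal.ofReal (μ * Real.exp (-(μ * t)) * ((μ * t) ^ n / n.factorial)) := by
  induction n with
  | zero =>
    filter_upwards [hexp] with t ht h0
    simp [convPow, ht h0]
  | succ n ih =>
    refine Eventually.of_forall fun t ht => ?_
    -- The reflection s ↦ t - s preserves null sets, so the exceptional set of the induction
    -- hypothesis stays negligible.
    have ih' := (volume.measurePreserving_sub_left t).quasiMeasurePreserving.ae ih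
    set c := μ * Real.exp (-(μ * t)) * (μ ^ (n + 1) / n.factorial)
    have hc : 0 ≤ c := by positivity
    have h1 : convPow f (n + 1) t = ∫⁻ s in Ioo 0 t, ENNReal.ofReal (c * (t - s) ^ n) := by
      refine setLIntegral_congr_fun_ae measurableSet_Ioo ?_
      filter_upwards [hexp, ih'] with s hs hs' hmem
      rw [hs hmem.1, hs' (sub_pos.2 hmem.2), ← ENNReal.ofReal_mul
        (mul_nonneg (by positivity) (div_nonneg (pow_nonneg
          (mul_nonneg hμ.le (sub_pos.2 hmem.2).le) _) (Nat.cast_nonneg _)))]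
      congr 1
      have h2 : Real.exp (-(μ * (t - s))) * Real.exp (-(μ * s)) = Real.exp (-(μ * t)) := by
        rw [← Real.exp_add]
        congr 1
        ring
      simp only [c]
      rw [← h2, mul_pow]
      ring
    have h3 : IntervalIntegrable (fun s => c * (t - s) ^ n) volume 0 t :=
      Continuous.intervalIntegrable (by fun_prop) _ _
    have h4 : IntegrableOn (fun s => c * (t - s) ^ n) (Ioo 0 t) :=
      ((intervalIntegrable_iff_integrableOn_Ioo_of_le ht.le).1 h3)
    have h5 : ∫ s in Ioo 0 t, c * (t - s) ^ n = c * (t ^ (n + 1) / (n + 1)) := by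
      rw [← integral_Ioc_eq_integral_Ioo, ← intervalIntegral.integral_of_le ht.le,
        intervalIntegral.integral_const_mul,
        intervalIntegral.integral_comp_sub_left (fun s => s ^ n)]
      simp
    rw [h1, ← ofReal_integral_eq_lintegral_ofReal h4, h5]
    · congr 1
      simp only [c]
      rw [Nat.factorial_succ, mul_pow]
      push_cast
      field_simp
    · filter_upwards [ae_restrict_mem measurableSet_Ioo] with s hs
      exact mul_nonneg hc (pow_nonneg (sub_pos.2 hs.2).le _)

/-- The exponential series in μt cancels the factor e^{-μt}. -/
lemma renewalDensity_exponential (hμ : 0 < μ)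
    (hexp : ∀ᵐ t, 0 < t → f t = μ * Real.exp (-(μ * t))) :
    ∀ᵐ t, 0 < t → renewalDensity f t = ENNReal.ofReal μ := by
  filter_upwards [ae_all_iff.2 (convPow_exponential hμ hexp)] with t ht h0
  have h1 : HasSum (fun n : ℕ => μ * Real.exp (-(μ * t)) * ((μ * t) ^ n / n.factorial)) μ := by
    have h2 := (NormedSpace.expSeries_div_hasSum_exp (μ * t)).mul_left (μ * Real.exp (-(μ * t)))
    rwa [← Real.exp_eq_exp_ℝ, mul_assoc, ← Real.exp_add, neg_add_cancel, Real.exp_zero,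
      mul_one] at h2
  rw [renewalDensity, tsum_congr fun n => ht n h0, ← ENNReal.ofReal_tsum_of_nonneg _ h1.summable,
    h1.tsum_eq]
  intro n
  positivity

lemma measurable_exp_integral_Ioi {v : ℝ → ℝ} (hv : Measurable v) :
    Measurable fun t => Real.exp (∫ x in Ioi t, μ * (v x - 1)) := by
  have h1 : Measurable fun q : ℝ × ℝ => {q : ℝ × ℝ | q.1 < q.2}.indicator
      (fun q => μ * (v q.2 - 1)) q :=
    Measurable.indicator (by fun_prop) (measurableSet_lt measurable_fst measurable_snd)
  have h2 : ∀ t, ∫ x in Ioi t, μ * (v x - 1) =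
      ∫ x, {q : ℝ × ℝ | q.1 < q.2}.indicator (fun q => μ * (v q.2 - 1)) (t, x) := fun t => by
    rw [← integral_indicator measurableSet_Ioi]
    rfl
  simp only [h2]
  exact Real.measurable_exp.comp h1.stronglyMeasurable.integral_prod_right'.measurable

lemma exp_integral_Ioi_le_one (hμ : 0 < μ) {v : ℝ → ℝ} (hv' : ∀ t, v t ∈ Icc (0 : ℝ) 1) (t : ℝ) :
    Real.exp (∫ x in Ioi t, μ * (v x - 1)) ≤ 1 :=
  Real.exp_le_one_iff.2 (setIntegral_nonpos measurableSet_Ioi fun x _ =>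
    mul_nonpos_of_nonneg_of_nonpos hμ.le (sub_nonpos.2 (hv' x).2))

/-- The solution of the renewal equation for exponential waiting times. -/
lemma renewal_equation_exponential (hμ : 0 < μ) {v : ℝ → ℝ} (hv : Measurable v)
    (hv' : ∀ t, v t ∈ Icc (0 : ℝ) 1) {R : ℝ} (hR : ∀ t, R < t → v t = 1) (t : ℝ) :
    Real.exp (∫ x in Ioi t, μ * (v x - 1)) =
      ∫ s, v (t + s) * Real.exp (∫ x in Ioi (t + s), μ * (v x - 1))
        ∂waitLaw fun s => μ * Real.exp (-(μ * s)) := by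
  -- Beyond b, v = 1 and the integral of H is the tail e^{-μ(b-t)}. On (t,b] it is e^{-μ(b-t)}
  -- (e^{μ∫v} - 1). The sum is e^{μ∫(v-1)} over [t,b].
  set b := max t R
  have htb : t ≤ b := le_max_left _ _
  have hvb : ∀ x, b < x → v x = 1 := fun x hx => hR x ((le_max_right _ _).trans_lt hx)
  have hvint : ∀ x y, IntervalIntegrable v volume x y := fun x y =>
    (intervalIntegrable_const (c := (1 : ℝ))).mono_fun hv.aestronglyMeasurable
      (Eventually.of_forall fun s => by
        simpa [abs_of_nonneg (hv' s).1] using (hv' s).2)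
  have hB : ∀ x, x ≤ b → ∫ y in Ioi x, μ * (v y - 1) = μ * (∫ y in x..b, v y) - μ * (b - x) := by
    intro x hx
    have h1 : ∫ y in Ioi x, μ * (v y - 1) = ∫ y in x..b, μ * (v y - 1) := by
      rw [intervalIntegral.integral_of_le hx]
      refine (setIntegral_eq_of_subset_of_forall_sdiff_eq_zero measurableSet_Ioi
        Ioc_subset_Ioi_self fun y hy => ?_)
      rw [hvb y (by by_contra h; exact hy.2 ⟨hy.1, not_lt.1 h⟩), sub_self, mul_zero]
    rw [h1, intervalIntegral.integral_const_mul, intervalIntegral.integral_sub (hvint _ _)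
      intervalIntegrable_const]
    simp
    ring
  have hB' : ∀ x, b ≤ x → ∫ y in Ioi x, μ * (v y - 1) = 0 := fun x hx =>
    setIntegral_eq_zero_of_forall_eq_zero fun y hy => by
      rw [hvb y (hx.trans_lt hy), sub_self, mul_zero]
  set H : ℝ → ℝ := fun x => μ * Real.exp (-(μ * (x - t))) *
    (v x * Real.exp (∫ y in Ioi x, μ * (v y - 1)))
  have hwait : ∫ s, v (t + s) * Real.exp (∫ x in Ioi (t + s), μ * (v x - 1))
      ∂(waitLaw fun s => μ * Real.exp (-(μ * s))) = ∫ x in Ioi t, H x := by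
    rw [waitLaw, integral_withDensity_eq_integral_toReal_smul (by fun_prop) (by simp)]
    have h1 := (measurePreserving_add_left volume t).setIntegral_preimage_emb
      (measurableEmbedding_addLeft t) H (Ioi t)
    rw [← h1]
    have h2 : (fun s => t + s) ⁻¹' Ioi t = Ioi 0 := by
      ext s
      simp
    rw [h2]
    refine integral_congr_ae (Eventually.of_forall fun s => ?_)
    simp only [H, smul_eq_mul, add_sub_cancel_left]
    rw [ENNReal.toReal_ofReal (by positivity)]
  have hH1 : ∫ x in Ioc t b, H x = Real.exp (-(μ * (b - t))) *
      (Real.exp (μ * ∫ x in t..b, v x) - 1) := by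
    rw [← integral_mul_exp_integral hv hv', ← intervalIntegral.integral_const_mul,
      intervalIntegral.integral_of_le htb]
    refine setIntegral_congr_fun measurableSet_Ioc fun x hx => ?_
    simp only [H]
    rw [hB x hx.2, intervalIntegral.integral_symm x b]
    have h2 : Real.exp (-(μ * (x - t))) * Real.exp (μ * (∫ y in x..b, v y) - μ * (b - x)) =
        Real.exp (-(μ * (b - t))) * Real.exp (-(μ * -∫ y in x..b, v y)) := by
      rw [← Real.exp_add, ← Real.exp_add]
      congr 1
      ring
    linear_combination (μ * v x) * h2
  have hH2' : ∀ x ∈ Ioi b, H x = Real.exp (μ * t) * (μ * Real.exp (-(μ * x))) := by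
    intro x hx
    simp only [H]
    rw [hB' x (le_of_lt hx), hvb x hx, Real.exp_zero]
    have h2 : Real.exp (-(μ * (x - t))) = Real.exp (μ * t) * Real.exp (-(μ * x)) := by
      rw [← Real.exp_add]
      congr 1
      ring
    rw [h2]
    ring
  have hH2 : ∫ x in Ioi b, H x = Real.exp (-(μ * (b - t))) := by
    rw [setIntegral_congr_fun measurableSet_Ioi hH2', integral_const_mul,
      integral_exponential_Ioi hμ, ← Real.exp_add]
    congr 1
    ring
  -- A non-integrable function would have integral 0 by convention, but the value found is positive.
  have hi2 : IntegrableOn H (Ioi b) := by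
    by_contra hni
    rw [integral_undef hni] at hH2
    exact (Real.exp_pos _).ne hH2
  have hi1 : IntegrableOn H (Ioc t b) := by
    have hm : Measurable H := by
      have := measurable_exp_integral_Ioi (μ := μ) hv
      fun_prop
    refine Measure.integrableOn_of_bounded (M := μ) (by simp) hm.aestronglyMeasurable ?_
    filter_upwards [ae_restrict_mem measurableSet_Ioc] with x hx
    have h1 : Real.exp (-(μ * (x - t))) ≤ 1 :=
      Real.exp_le_one_iff.2 (neg_nonpos.2 (mul_nonneg hμ.le (sub_nonneg.2 hx.1.le)))
    have h2 := mul_le_one₀ (hv' x).2 (Real.exp_nonneg _) (exp_integral_Ioi_le_one hμ hv' x)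
    have h3 := mul_nonneg (hv' x).1 (Real.exp_nonneg (∫ y in Ioi x, μ * (v y - 1)))
    rw [Real.norm_eq_abs, abs_of_nonneg (mul_nonneg (by positivity) h3)]
    simpa using mul_le_mul (mul_le_mul_of_nonneg_left h1 hμ.le) h2 h3 (by positivity)
  rw [hwait, ← Ioc_union_Ioi_eq_Ioi htb, setIntegral_union Ioc_disjoint_Ioi_same measurableSet_Ioi
    hi1 hi2, hH1, hH2, Ioc_union_Ioi_eq_Ioi htb, hB t htb, sub_eq_add_neg, Real.exp_add]
  ring

end exponential

lemma integrableOn_sub_one {v : ℝ → ℝ} (hv : Measurable v) (hv' : ∀ t, v t ∈ Icc (0 : ℝ) 1) {R : ℝ}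
    (hR : ∀ t, R < t → v t = 1) : IntegrableOn (fun s => v s - 1) (Ioi 0) := by
  have h1 : IntegrableOn (fun s => v s - 1) (Ioc 0 R) := by
    refine Measure.integrableOn_of_bounded (M := 1) (by simp)
      (hv.sub_const 1).aestronglyMeasurable (Eventually.of_forall fun x => ?_)
    rw [Real.norm_eq_abs, abs_le]
    constructor <;> linarith [(hv' x).1, (hv' x).2]
  refine h1.of_forall_sdiff_eq_zero measurableSet_Ioi fun x hx => ?_
  rw [hR x (by by_contra h; exact hx.2 ⟨hx.1, not_lt.1 h⟩), sub_self]

/-! ### Poisson centres -/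

section poisson

variable {Ω : Type*} [MeasurableSpace Ω] {P : Measure Ω} {f h : ℝ → ℝ}
  {T : ℕ → Ω → ℝ} {D : ℕ × List ℕ → Ω → ℕ × (ℕ → ℝ)} {μ : ℝ}

/-- Lack of memory: the tail is 1 - F(t) = e^{-μt}, so m (1 - F) is the waiting density itself. -/
lemma IsInput.map_wait_zero_exponential (hTD : IsInput P f h T D) (hf : IsWaitingDensity f)
    (hμ : 0 < μ) (hexp : ∀ᵐ t, 0 < t → f t = μ * Real.exp (-(μ * t))) :
    P.map (T 0) = waitLaw fun t => μ * Real.exp (-(μ * t)) := by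
  have hint : ∀ t, IntegrableOn (fun s => μ * Real.exp (-(μ * s))) (Ioi t) := fun t => by
    by_contra hni
    have h1 := integral_exponential_Ioi hμ t
    rw [integral_undef hni] at h1
    exact (Real.exp_pos _).ne h1
  rw [hTD.map_wait_zero hf, rate_exponential hμ hexp, waitLaw_exponential hexp]
  refine withDensity_congr_ae ?_
  filter_upwards [ae_restrict_mem measurableSet_Ioi] with t ht
  rw [waitLaw, withDensity_apply _ measurableSet_Ioi, Measure.restrict_restrict measurableSet_Ioi,
    inter_eq_left.2 (Ioi_subset_Ioi (le_of_lt ht)), ← ofReal_integral_eq_lintegral_ofReal (hint t)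
      (Eventually.of_forall fun s => by positivity), integral_exponential_Ioi hμ,
    ENNReal.ofReal_mul hμ.le]

/-- The p.g.fl. of a Poisson process of centres. -/
lemma IsInput.pgfl_centre_exponential [IsProbabilityMeasure P] (hTD : IsInput P f h T D)
    (hf : IsWaitingDensity f) (hμ : 0 < μ)
    (hexp : ∀ᵐ t, 0 < t → f t = μ * Real.exp (-(μ * t))) {G : ℝ → ℝ} (hGm : Measurable G)
    (hG : ∀ t, G t ∈ Icc (0 : ℝ) 1) {R : ℝ} (hR : ∀ t, R < t → G t = 1) :
    pgfl P (centre T) G = Real.exp (∫ s in Ioi (0 : ℝ), μ * (G s - 1)) := by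
  -- Since the delay is distributed as a waiting time, the integral over it is the right side of the
  -- renewal equation at t = 0.
  have heq := renewal_equation_exponential hμ hGm hG hR
  rw [hTD.pgfl_centre_eq hf hGm hG (fun _ _ => rfl) (measurable_exp_integral_Ioi (μ := μ) hGm)
    (C := 1) (fun t _ => ?_) (R := R) (fun t ht => ?_) fun t _ => ?_,
    hTD.map_wait_zero_exponential hf hμ hexp, heq 0]
  · simp only [zero_add]
  · rw [abs_of_pos (Real.exp_pos _)]
    exact exp_integral_Ioi_le_one hμ hG t
  · rw [setIntegral_eq_zero_of_forall_eq_zero fun x hx => ?_, Real.exp_zero]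
    rw [hR x (ht.trans hx), sub_self, mul_zero]
  · rw [waitLaw_exponential hexp]
    exact heq t

end poisson

end RenewalHawkes

end

/-! ### The assembled theorem -/

open RenewalHawkes in
theorem mainTheorem4 {Ω : Type*} [MeasurableSpace Ω] (P : Measure Ω) [IsProbabilityMeasure P]
    (f h : ℝ → ℝ) (hf : IsWaitingDensity f) (hh : IsOffspringDensity h)
    (T : ℕ → Ω → ℝ) (D : ℕ × List ℕ → Ω → ℕ × (ℕ → ℝ)) (hTD : IsInput P f h T D) :
    -- the delayed renewal process of the centres is stationary
    (∀ s : ℝ, 0 ≤ s →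
      P.map (fun ω => ((centre T ω).map fun x => x - s).restrict (Ici 0)) = P.map (centre T)) ∧
    -- the cluster process is almost surely locally finite
    (∀ᵐ ω ∂P, ∀ B : Set ℝ, Bornology.IsBounded B → process T D ω B < ⊤) ∧
    -- its p.g.fl.
    (∀ z ∈ Xi,
      pgfl P (process T D) z = pgfl P (centre T) (clusterPgfl P D z) ∧
      (∀ n, IntegrableOn (integrand f (clusterPgfl P D z) n) (chamber n)) ∧
      HasSum (fun n => rate f * ∫ t in chamber n, integrand f (clusterPgfl P D z) n t)
        (pgfl P (process T D) z - 1)) ∧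
    -- the Poisson case
    (∀ μ : ℝ, 0 < μ → (∀ᵐ t, 0 < t → f t = μ * Real.exp (-(μ * t))) →
      rate f = μ ∧
      (∀ᵐ t, 0 < t → renewalDensity f t = ENNReal.ofReal μ) ∧
      ∀ z ∈ Xi,
        IntegrableOn (fun s => clusterPgfl P D (fun x => z (s + x)) 0 - 1) (Ioi 0) ∧
        pgfl P (process T D) z =
          Real.exp (∫ s in Ioi (0 : ℝ), μ * (clusterPgfl P D (fun x => z (s + x)) 0 - 1))) := by
  refine ⟨fun s hs => hTD.map_centre_shift hf hs,
    hTD.ae_process_lt_top hh (hTD.ae_finite_epoch_le hf), fun z hz => ?_, fun μ hμ hexp =>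
    ⟨rate_exponential hμ hexp, renewalDensity_exponential hμ hexp, fun z hz => ?_⟩⟩
  · obtain ⟨R, hR⟩ := exists_forall_eq_one hz
    rw [hTD.pgfl_process_eq hh hz.1 hz.2.1]
    exact ⟨rfl, hTD.hasSum_pgfl_centre hf (hTD.measurable_clusterPgfl hh hz)
      (hTD.clusterPgfl_mem hh hz) fun t ht => hTD.clusterPgfl_eq_one hh hz hR ht⟩
  · obtain ⟨R, hR⟩ := exists_forall_eq_one hz
    have hm := hTD.measurable_clusterPgfl hh hz
    have hmem := hTD.clusterPgfl_mem hh hz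
    have hone := fun t ht => hTD.clusterPgfl_eq_one hh hz hR (t := t) ht
    simp only [clusterPgfl_translate]
    exact ⟨integrableOn_sub_one hm hmem hone, (hTD.pgfl_process_eq hh hz.1 hz.2.1).trans
      (hTD.pgfl_centre_exponential hf hμ hexp hm hmem hone)⟩
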